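/- Let $K\subset\mathbb R^2$ be a compact strictly convex set bounded by a curve $\Gamma=\partial K$ of class $\mathcal C^2$; that is, its support function $p(\varphi)=\sup_{x\in K}\langle x,N(\varphi)\rangle$, $N(\varphi)=(\cos\varphi,\sin\varphi)$, is of class $\mathcal C^2$ and $p+p''>0$. Let $F$ be the area of $K$, $L$ the length of $\Gamma$, $\Delta=L^2-4\pi F$, and let $F_e$ be the area with multiplicities enclosed by the evolute of $\Gamma$. For $P\notin K$ let $\omega=\omega(P)$ be the visual angle of $\Gamma$ from $P$, i.e. the angle between the two tangents from $P$ to $\Gamma$, and let $dP$ be the area measure. Here the curve with generalized support function $f$ is the envelope $t\mapsto f(t)N(t)+f'(t)N'(t)$ of the lines $x\cos t+y\sin t=f(t)$; the area with multiplicities that it encloses, for $f$ of class $\mathcal C^1$ and $2\pi$-periodic, is $\frac12\int_0^{2\pi}(f^2-f'^2)\,dt$ (which is $\frac12\int_0^{2\pi} f(f+f'')\,dt$ if $f$ is $\mathcal C^2$), and the evolute of $\Gamma$ has generalized support function $p'(\varphi-\pi/2)$. A curve parallel to the curve with generalized support function $f$ is one with generalized support function $f+d$, $d\in\mathbb R$.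 Astroids and Steiner curves (deltoids) are the hypocycloids with four and three cusps, of any size and in any position. Then the function $\omega-\sin\omega-\frac23\sin^3\omega$ is integrable over $\mathbb R^2\setminus K$, and the following are equivalent. (1) $$\pi|F_e|-\Delta=\frac54L^2+5\int_{P\notin K}\Bigl(\omega-\sin\omega-\frac23\sin^3\omega\Bigr)\,dP .$$ (2) One of the following holds: a) $K$ is a disk or is bounded by a curve parallel to an astroid; b) $K$ is bounded by a curve parallel to a Steiner curve; c) $K$ is the Minkowski sum of finitely many (at least two) domains of the above types. Here the summands need not be convex: a summand is a disk, or the domain of a curve parallel to an astroid or to a Steiner curve, it is given by its generalized support function, and $K$ being the Minkowski sum means that the support function of $K$ is the sum of the generalized support functions of the summands (for convex summands this is the usual Minkowski sum). (3) The support function of $K$ with respect to its Steiner point $s(K)=\frac1\pi\int_0^{2\pi}p(\varphi)N(\varphi)\,d\varphi$ as origin has the form $$a_0+a_2\cos2\varphi+b_2\sin2\varphi+a_3\cos3\varphi+b_3\sin3\varphi$$ with real constants $a_0,a_2,b_2,a_3,b_3$. -/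

import Mathlib

open MeasureTheory Set
open scoped Real Pointwise

noncomputable section

namespace VisualAngleDeficit

/-- The Euclidean plane. -/
abbrev Plane : Type := EuclideanSpace ℝ (Fin 2)

/-- The unit vector `N(φ) = (cos φ, sin φ)`. -/
def normalVec (φ : ℝ) : Plane := !₂[Real.cos φ, Real.sin φ]

/-- Its derivative `N'(φ) = (-sin φ, cos φ)`. -/
def tangentVec (φ : ℝ) : Plane := !₂[-Real.sin φ, Real.cos φ]

/-- The support function `p(φ) = sup {⟨x, N(φ)⟩ : x ∈ K}` of `K` with respect to the origin. -/
def supportFn (K : Set Plane) (φ : ℝ) : ℝ :=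
  sSup ((fun x : Plane => inner ℝ x (normalVec φ)) '' K)

/-- A compact strictly convex set bounded by a curve of class `C²`: the support function is `C²` and
the radius of curvature `p + p''` is everywhere positive. -/
structure IsStrictlyConvexC2 (K : Set Plane) : Prop where
  nonempty : K.Nonempty
  isCompact : IsCompact K
  convex : Convex ℝ K
  contDiff : ContDiff ℝ 2 (supportFn K)
  curvature_pos : ∀ φ : ℝ, 0 < supportFn K φ + deriv (deriv (supportFn K)) φ

/-- The envelope of the family of lines `x cos t + y sin t = f(t)`, i.e. the curve with generalized
support function `f`: the point with parameter `t` is `f(t) N(t) + f'(t) N'(t)`. For `f` the support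
function of a strictly convex `K` this parametrizes the boundary of `K` by its outer normal. -/
def envelope (f : ℝ → ℝ) (t : ℝ) : Plane :=
  f t • normalVec t + deriv f t • tangentVec t

/-- The length of the boundary of `K`, as the arc length of its parametrization by the normal. -/
def boundaryLength (K : Set Plane) : ℝ :=
  ∫ φ in (0 : ℝ)..(2 * π), ‖deriv (envelope (supportFn K)) φ‖

/-- The area of `K`. -/
def area (K : Set Plane) : ℝ := (volume K).toReal

/-- The area with multiplicities swept by the radius vector of the closed curve with the
`2π`-periodic generalized support function `f`. It is `½ ∮ (x dy - y dx) = ½ ∫ f (f + f'')`,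
integrated by parts so that it makes sense for every `f` of class `C¹`;
see `sweptArea_eq_line_integral` and `sweptArea_eq`. -/
def sweptArea (f : ℝ → ℝ) : ℝ :=
  (1 / 2) * ∫ t in (0 : ℝ)..(2 * π), (f t ^ 2 - deriv f t ^ 2)

/-- The evolute (the locus of the centres of curvature) of the boundary of `K`. -/
def evolute (K : Set Plane) (φ : ℝ) : Plane :=
  envelope (supportFn K) φ -
    (supportFn K φ + deriv (deriv (supportFn K)) φ) • normalVec φ

/-- The generalized support function `p'(φ - π/2)` of the evolute;
see `envelope_evoluteSupport`. -/
def evoluteSupport (K : Set Plane) (φ : ℝ) : ℝ := deriv (supportFn K) (φ - π / 2)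

/-- The area with multiplicities enclosed by the evolute of the boundary of `K`. -/
def evoluteArea (K : Set Plane) : ℝ := sweptArea (evoluteSupport K)

/-- The point `x` of `K` is a point of contact of a tangent (support) line of `K` through `P`. -/
def IsTangencyPoint (K : Set Plane) (P x : Plane) : Prop :=
  x ∈ K ∧ ∃ u : Plane, u ≠ 0 ∧ inner ℝ u P = inner ℝ u x ∧ ∀ y ∈ K, inner ℝ u y ≤ inner ℝ u x

/-- The visual angle of `K` from an exterior point `P`: the angle at `P` between the tangents from
`P` to `K`. For a strictly convex `K` there are two points of contact `x ≠ y`, and the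
supremum is the angle `x P y`; the pairs `x = y` only contribute the value `0`. -/
def visualAngle (K : Set Plane) (P : Plane) : ℝ :=
  sSup {θ : ℝ | ∃ x y : Plane, IsTangencyPoint K P x ∧ IsTangencyPoint K P y ∧
    θ = EuclideanGeometry.angle x P y}

/-- The integrand `ω - sin ω - (2/3) sin³ ω`, where `ω` is the visual angle of `K` from `P`. -/
def visualIntegrand (K : Set Plane) (P : Plane) : ℝ :=
  visualAngle K P - Real.sin (visualAngle K P) - (2 / 3) * Real.sin (visualAngle K P) ^ 3

/-- Equality `π|F_e| - Δ = (5/4) L² + 5 ∫_{P ∉ K} (ω - sin ω - (2/3) sin³ ω) dP`, where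
`Δ = L² - 4πF`. -/
def EqualityHolds (K : Set Plane) : Prop :=
  π * |evoluteArea K| - (boundaryLength K ^ 2 - 4 * π * area K) =
    (5 / 4) * boundaryLength K ^ 2 + 5 * ∫ P in Kᶜ, visualIntegrand K P

/-- The hypocycloid traced by rolling a circle of radius `r` inside a circle of radius `k r`
centred at the origin. -/
def hypocycloid (k r t : ℝ) : Plane :=
  !₂[r * (k - 1) * Real.sin t - r * Real.sin ((k - 1) * t),
     r * (k - 1) * Real.cos t + r * Real.cos ((k - 1) * t)]

/-- Rotation of the plane about the origin by the angle `α`. -/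
def rotate (α : ℝ) (v : Plane) : Plane := v 0 • normalVec α + v 1 • tangentVec α

/-- `f` is a generalized support function of a hypocycloid of ratio `k`, in any position (centre `c`,
rotated by `α`) and of any size `r > 0`. The normal of the unrotated hypocycloid at the parameter
`t` has the angle `(k - 2) t / 2`. -/
def IsHypocycloidSupport (k : ℝ) (f : ℝ → ℝ) : Prop :=
  ∃ (r : ℝ) (c : Plane) (α : ℝ), 0 < r ∧
    ∀ t : ℝ, envelope f (α + (k - 2) / 2 * t) = c + rotate α (hypocycloid k r t)

/-- `f` is a generalized support function of a curve parallel to an astroid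
(at some signed distance `d`). -/
def IsAstroidParallel (f : ℝ → ℝ) : Prop :=
  ∃ (g : ℝ → ℝ) (d : ℝ), IsHypocycloidSupport 4 g ∧ ∀ t : ℝ, f t = g t + d

/-- `f` is a generalized support function of a curve parallel to a Steiner curve (deltoid)
(at some signed distance `d`). -/
def IsDeltoidParallel (f : ℝ → ℝ) : Prop :=
  ∃ (g : ℝ → ℝ) (d : ℝ), IsHypocycloidSupport 3 g ∧ ∀ t : ℝ, f t = g t + d

/-- `f` is the support function of a disk. -/
def IsDiskSupport (f : ℝ → ℝ) : Prop :=
  ∃ (c : Plane) (r : ℝ), 0 < r ∧ ∀ t : ℝ, f t = supportFn (Metric.closedBall c r) t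

/-- `K` is bounded by the curve with generalized support function `f`. -/
def IsBoundedBy (K : Set Plane) (f : ℝ → ℝ) : Prop :=
  frontier K = Set.range (envelope f)

/-- `K` is a disk or is bounded by a curve parallel to an astroid. -/
def IsDiskOrAstroidType (K : Set Plane) : Prop :=
  (∃ (c : Plane) (r : ℝ), 0 < r ∧ K = Metric.closedBall c r) ∨
    ∃ f : ℝ → ℝ, IsAstroidParallel f ∧ IsBoundedBy K f

/-- `K` is bounded by a curve parallel to a Steiner curve. -/
def IsDeltoidType (K : Set Plane) : Prop :=
  ∃ f : ℝ → ℝ, IsDeltoidParallel f ∧ IsBoundedBy K f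

/-- `K` is the Minkowski sum of finitely many (at least two) domains, each a disk or bounded by a
curve parallel to an astroid or to a Steiner curve. The summands need not be convex: they are given
by their generalized support functions, and the Minkowski sum is the set whose support function is
the sum of these. For convex summands this is the usual Minkowski sum; see `supportFn_add`. -/
def IsMinkowskiSumType (K : Set Plane) : Prop :=
  ∃ (n : ℕ) (f : Fin n → ℝ → ℝ), 2 ≤ n ∧
    (∀ i, IsDiskSupport (f i) ∨ IsAstroidParallel (f i) ∨ IsDeltoidParallel (f i)) ∧
    ∀ φ : ℝ, supportFn K φ = ∑ i, f i φ

/-- The Steiner point `s(K) = (1/π) ∫₀^{2π} p(φ) N(φ) dφ`. -/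
def steinerPoint (K : Set Plane) : Plane :=
  (1 / π) • ∫ φ in (0 : ℝ)..(2 * π), supportFn K φ • normalVec φ

/-- The support function of `K` with respect to its Steiner point as origin. -/
def steinerSupportFn (K : Set Plane) : ℝ → ℝ :=
  supportFn ((fun x => x - steinerPoint K) '' K)

/-- The support function of `K` about the Steiner point has only Fourier modes `0`, `2`, `3`. -/
def HasOnlyModesZeroTwoThree (K : Set Plane) : Prop :=
  ∃ a₀ a₂ b₂ a₃ b₃ : ℝ, ∀ φ : ℝ, steinerSupportFn K φ =
    a₀ + a₂ * Real.cos (2 * φ) + b₂ * Real.sin (2 * φ)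
      + a₃ * Real.cos (3 * φ) + b₃ * Real.sin (3 * φ)

/-! Facts that confirm the readings above. -/

/-- The evolute is the curve with generalized support function `p'(φ - π/2)`. -/
theorem envelope_evoluteSupport (K : Set Plane) (φ : ℝ) :
    envelope (evoluteSupport K) (φ + π / 2) = evolute K φ := by
  have h : deriv (evoluteSupport K) (φ + π / 2) = deriv (deriv (supportFn K)) φ := by
    unfold evoluteSupport
    rw [deriv_comp_sub_const]
    simp
  unfold evolute envelope
  rw [h]
  ext i
  fin_cases i <;>
    simp [evoluteSupport, normalVec, tangentVec, Real.cos_add_pi_div_two,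
      Real.sin_add_pi_div_two] <;> ring

/-- For `f` of class `C²` the swept area is `½ ∫ f (f + f'')`. -/
theorem sweptArea_eq (f : ℝ → ℝ) (hf : ContDiff ℝ 2 f) (hp : Function.Periodic f (2 * π)) :
    sweptArea f = (1 / 2) * ∫ t in (0 : ℝ)..(2 * π), f t * (f t + deriv (deriv f) t) := by
  have h1 : ContDiff ℝ 1 (deriv f) := by
    have h2 : ContDiff ℝ (1 + 1) f := by simpa [one_add_one_eq_two] using hf
    exact (contDiff_succ_iff_deriv.1 h2).2.2
  have hc2 : Continuous (deriv (deriv f)) := h1.continuous_deriv le_rfl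
  have hc1 : Continuous (deriv f) := h1.continuous
  have hc0 : Continuous f := hf.continuous
  have hd : Differentiable ℝ f := hf.differentiable (by norm_num)
  have hd1 : Differentiable ℝ (deriv f) := h1.differentiable (by norm_num)
  have hp0 : f (2 * π) = f 0 := by simpa using hp 0
  have hp1 : deriv f (2 * π) = deriv f 0 := by
    have h3 : (fun x => f (x + 2 * π)) = f := funext hp
    have h4 := deriv_comp_add_const f (2 * π) 0
    rw [h3] at h4
    simpa using h4.symm
  have hparts := intervalIntegral.integral_mul_deriv_eq_deriv_mul (a := 0) (b := 2 * π)
    (u := f) (v := deriv f) (u' := deriv f) (v' := deriv (deriv f))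
    (fun x _ => (hd x).hasDerivAt) (fun x _ => (hd1 x).hasDerivAt)
    (hc1.intervalIntegrable _ _) (hc2.intervalIntegrable _ _)
  rw [hp0, hp1, sub_self, zero_sub] at hparts
  unfold sweptArea
  congr 1
  have e1 : (∫ t in (0 : ℝ)..(2 * π), (f t ^ 2 - deriv f t ^ 2)) =
      (∫ t in (0 : ℝ)..(2 * π), f t ^ 2) - ∫ t in (0 : ℝ)..(2 * π), deriv f t * deriv f t := by
    rw [← intervalIntegral.integral_sub]
    · simp [sq]
    · exact (hc0.pow 2).intervalIntegrable _ _
    · exact (hc1.mul hc1).intervalIntegrable _ _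
  have e2 : (∫ t in (0 : ℝ)..(2 * π), f t * (f t + deriv (deriv f) t)) =
      (∫ t in (0 : ℝ)..(2 * π), f t ^ 2) +
        ∫ t in (0 : ℝ)..(2 * π), f t * deriv (deriv f) t := by
    rw [← intervalIntegral.integral_add]
    · simp [sq, mul_add]
    · exact (hc0.pow 2).intervalIntegrable _ _
    · exact (hc0.mul hc2).intervalIntegrable _ _
  rw [e1, e2, hparts]
  ring

/-- For `f` of class `C²` the swept area is the line integral `½ ∮ (x dy - y dx)`. -/
theorem sweptArea_eq_line_integral (f : ℝ → ℝ) (hf : ContDiff ℝ 2 f)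
    (hp : Function.Periodic f (2 * π)) :
    sweptArea f = (1 / 2) * ∫ t in (0 : ℝ)..(2 * π),
      (envelope f t 0 * deriv (fun s => envelope f s 1) t
        - envelope f t 1 * deriv (fun s => envelope f s 0) t) := by
  rw [sweptArea_eq f hf hp]
  have h1 : ContDiff ℝ 1 (deriv f) := by
    have h2 : ContDiff ℝ (1 + 1) f := by simpa [one_add_one_eq_two] using hf
    exact (contDiff_succ_iff_deriv.1 h2).2.2
  have hd : Differentiable ℝ f := hf.differentiable (by norm_num)
  have hd1 : Differentiable ℝ (deriv f) := h1.differentiable (by norm_num)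
  congr 1
  apply intervalIntegral.integral_congr
  intro t _
  have hx : deriv (fun s => envelope f s 0) t = -(f t + deriv (deriv f) t) * Real.sin t := by
    have h := ((hd t).hasDerivAt.mul (Real.hasDerivAt_cos t)).add
      ((hd1 t).hasDerivAt.mul (Real.hasDerivAt_sin t).neg)
    have e : (fun s => envelope f s 0) = (f * Real.cos + deriv f * -Real.sin) := by
      funext s
      simp [envelope, normalVec, tangentVec]
    rw [e, h.deriv]
    simp
    ring
  have hy : deriv (fun s => envelope f s 1) t = (f t + deriv (deriv f) t) * Real.cos t := by
    have h := ((hd t).hasDerivAt.mul (Real.hasDerivAt_sin t)).add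
      ((hd1 t).hasDerivAt.mul (Real.hasDerivAt_cos t))
    have e : (fun s => envelope f s 1) = (f * Real.sin + deriv f * Real.cos) := by
      funext s
      simp [envelope, normalVec, tangentVec]
    rw [e, h.deriv]
    simp
    ring
  simp only [hx, hy]
  simp [envelope, normalVec, tangentVec]
  linear_combination (-(f t * (f t + deriv (deriv f) t))) * Real.sin_sq_add_cos_sq t

/-- Support functions are additive under Minkowski addition. -/
theorem supportFn_add (A B : Set Plane) (hA : IsCompact A) (hB : IsCompact B)
    (hA' : A.Nonempty) (hB' : B.Nonempty) (φ : ℝ) :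
    supportFn (A + B) φ = supportFn A φ + supportFn B φ := by
  have hc : Continuous (fun x : Plane => (inner ℝ x (normalVec φ) : ℝ)) := by fun_prop
  unfold supportFn
  rw [← csSup_add (hA'.image _) (hA.image hc).bddAbove (hB'.image _) (hB.image hc).bddAbove]
  congr 1
  ext z
  constructor
  · rintro ⟨_, ⟨a, ha, b, hb, rfl⟩, rfl⟩
    exact ⟨_, ⟨a, ha, rfl⟩, _, ⟨b, hb, rfl⟩, (inner_add_left _ _ _).symm⟩
  · rintro ⟨_, ⟨a, ha, rfl⟩, _, ⟨b, hb, rfl⟩, rfl⟩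
    exact ⟨_, ⟨a, ha, b, hb, rfl⟩, inner_add_left _ _ _⟩

end VisualAngleDeficit

end

/-! Everything is reduced to the Fourier coefficients of the support function `p`.

A point `P` outside `K` lies on exactly two tangents, with normal angles `φ` and `φ + δ`, `0 < δ <
π`, and it sees `K` under the angle `ω = π - δ`. In these coordinates `dP` is the product of the two
tangent lengths divided by `sin δ`, times `dδ dφ` (`tangentMeet_image`, `visualAngle_eq`,
`jacobian_mul_visual`). Integrating over `φ` at fixed `δ` leaves only the autocorrelation `R(δ) = ∫
p(φ) p(φ + δ) dφ`: with `V = R - R(0) cos` the slice is `angleFn (π - δ)` times the second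
derivative of `V / sin` (`integral_tanLen_mul`, `integral_tangentIntegrand_slice`).

Two integrations by parts move the derivatives onto `angleFn (π - δ)`, whose second derivative is
`-3 sin δ cos 2δ`. The sine cancels, so the exterior integral sees a single frequency: it equals
`-(3/2) w₂ - πF`, where `wₙ` is the sum of the squares of the `n`-th cosine and sine integrals of
`p` (`integral_angleFn_mul`, `integral_visualIntegrand`). Area, length and evolute area are also
quadratic in `p`. By Parseval, four times the difference of the two sides of the equality is the sum
over integers `n` of `(n² - 1)(n² - 9) wₙ`, with the terms `n = 0` and `n = ±2` cancelled by the
length and by the integral. The polynomial vanishes at `±1` and `±3` and is positive for `|n| ≥ 4`,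
so equality means that all frequencies from four on are absent (`equalityHolds_iff_coeff`).
Frequency one is a translation, removed by taking the Steiner point as origin.

For the geometric description, a hypocycloid of ratio `k` has, up to translation, a generalized
support function which is a pure harmonic of frequency `k / (k - 2)`: two for the astroid, three for
the deltoid (`isHypocycloidSupport_iff`). The delicate implication starts from an equality of point
sets between the boundary of `K` and a curve parallel to a hypocycloid; this must be turned into
information on `p`, although the curve may be traversed with either orientation of its normal
(`eq_or_eq_neg_of_isBoundedBy`, `hasModes_of_astroid`, `hasModes_of_deltoid`). -/

namespace VisualAngleDeficit

/-! ### Sturm comparison for `f + f''` -/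

/-- This is the Wronskian of `f` with `t ↦ sin (x - t)`, a solution of `y'' + y = 0`, so the terms
in `f'` cancel. -/
theorem hasDerivAt_sturm {f f' f'' : ℝ → ℝ} (h : ∀ x, HasDerivAt f (f' x) x)
    (h' : ∀ x, HasDerivAt f' (f'' x) x) (x τ : ℝ) :
    HasDerivAt (fun t => f' t * Real.sin (x - t) + f t * Real.cos (x - t))
      ((f τ + f'' τ) * Real.sin (x - τ)) τ := by
  have hs : HasDerivAt (fun t => Real.sin (x - t)) (Real.cos (x - τ) * (-1)) τ :=
    ((hasDerivAt_id' τ).const_sub x).sin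
  have hc : HasDerivAt (fun t => Real.cos (x - t)) (-Real.sin (x - τ) * (-1)) τ :=
    ((hasDerivAt_id' τ).const_sub x).cos
  exact (((h' τ).mul hs).add ((h τ).mul hc)).congr_deriv (by ring)

/-- The Wronskian vanishes at `t = a`, equals `f x` at `t = x`, and is monotone in between because
`x - t` stays in `[0, π]`. -/
theorem sturm_nonneg {f f' f'' : ℝ → ℝ} (h : ∀ x, HasDerivAt f (f' x) x)
    (h' : ∀ x, HasDerivAt f' (f'' x) x) (hpos : ∀ x, 0 ≤ f x + f'' x) {a x : ℝ}
    (ha : f a = 0) (ha' : f' a = 0) (hax : a ≤ x) (hx : x ≤ a + π) : 0 ≤ f x := by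
  have hd := hasDerivAt_sturm h h' x
  have hm : MonotoneOn (fun t => f' t * Real.sin (x - t) + f t * Real.cos (x - t)) (Icc a x) := by
    apply monotoneOn_of_deriv_nonneg (convex_Icc a x)
      (fun t _ => (hd t).continuousAt.continuousWithinAt)
      (fun t _ => (hd t).differentiableAt.differentiableWithinAt)
    intro t ht
    rw [interior_Icc] at ht
    rw [(hd t).deriv]
    exact mul_nonneg (hpos t)
      (Real.sin_nonneg_of_nonneg_of_le_pi (by linarith [ht.2]) (by linarith [ht.1]))
  simpa [ha, ha'] using hm (left_mem_Icc.2 hax) (right_mem_Icc.2 hax) hax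

theorem sturm_pos {f f' f'' : ℝ → ℝ} (h : ∀ x, HasDerivAt f (f' x) x)
    (h' : ∀ x, HasDerivAt f' (f'' x) x) (hpos : ∀ x, 0 < f x + f'' x) {a x : ℝ}
    (ha : f a = 0) (ha' : f' a = 0) (hax : a < x) (hx : x ≤ a + π) : 0 < f x := by
  have hd := hasDerivAt_sturm h h' x
  have hm : StrictMonoOn (fun t => f' t * Real.sin (x - t) + f t * Real.cos (x - t))
      (Icc a x) := by
    apply strictMonoOn_of_deriv_pos (convex_Icc a x)
      (fun t _ => (hd t).continuousAt.continuousWithinAt)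
    intro t ht
    rw [interior_Icc] at ht
    rw [(hd t).deriv]
    exact mul_pos (hpos t)
      (Real.sin_pos_of_pos_of_lt_pi (by linarith [ht.2]) (by linarith [ht.1]))
  simpa [ha, ha'] using hm (left_mem_Icc.2 hax.le) (right_mem_Icc.2 hax.le) hax

theorem hasDerivAt_reflect {f f' : ℝ → ℝ} (h : ∀ x, HasDerivAt f (f' x) x) (x : ℝ) :
    HasDerivAt (fun t => f (-t)) (-f' (-x)) x := by
  simpa [Function.comp_def] using (h (-x)).comp x (hasDerivAt_neg x)

theorem sturm_nonneg_left {f f' f'' : ℝ → ℝ} (h : ∀ x, HasDerivAt f (f' x) x)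
    (h' : ∀ x, HasDerivAt f' (f'' x) x) (hpos : ∀ x, 0 ≤ f x + f'' x) {a x : ℝ}
    (ha : f a = 0) (ha' : f' a = 0) (hax : x ≤ a) (hx : a - π ≤ x) : 0 ≤ f x := by
  have := sturm_nonneg (f := fun t => f (-t)) (f' := fun t => -f' (-t)) (f'' := fun t => f'' (-t))
    (hasDerivAt_reflect h) (fun x => (hasDerivAt_reflect h' x).neg.congr_deriv (neg_neg _))
    (fun x => hpos (-x)) (a := -a) (x := -x) (by simpa) (by simpa) (by linarith) (by linarith)
  simpa using this

theorem sturm_pos_left {f f' f'' : ℝ → ℝ} (h : ∀ x, HasDerivAt f (f' x) x)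
    (h' : ∀ x, HasDerivAt f' (f'' x) x) (hpos : ∀ x, 0 < f x + f'' x) {a x : ℝ}
    (ha : f a = 0) (ha' : f' a = 0) (hax : x < a) (hx : a - π ≤ x) : 0 < f x := by
  have := sturm_pos (f := fun t => f (-t)) (f' := fun t => -f' (-t)) (f'' := fun t => f'' (-t))
    (hasDerivAt_reflect h) (fun x => (hasDerivAt_reflect h' x).neg.congr_deriv (neg_neg _))
    (fun x => hpos (-x)) (a := -a) (x := -x) (by simpa) (by simpa) (by linarith) (by linarith)
  simpa using this

theorem hasDerivAt_trig (A B a x : ℝ) :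
    HasDerivAt (fun t => A * Real.cos (t - a) + B * Real.sin (t - a))
      (B * Real.cos (x - a) - A * Real.sin (x - a)) x := by
  have h1 := ((hasDerivAt_id' x).sub_const a).cos.const_mul A
  have h2 := ((hasDerivAt_id' x).sub_const a).sin.const_mul B
  exact (h1.add h2).congr_deriv (by ring)

theorem hasDerivAt_sub_trig {f f' : ℝ → ℝ} (h : ∀ x, HasDerivAt f (f' x) x) (A B a x : ℝ) :
    HasDerivAt (fun t => f t - (A * Real.cos (t - a) + B * Real.sin (t - a)))
      (f' x - (B * Real.cos (x - a) + (-A) * Real.sin (x - a))) x := by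
  exact ((h x).sub (hasDerivAt_trig A B a x)).congr_deriv (by ring)

/-- Subtract from `h` the solution of `y'' + y = 0` with the same value and slope at `a` and apply
the Sturm comparison. For a support function this says that a contact point lies strictly inside the
other supporting half-planes. -/
theorem trig_lt_right {h h' h'' : ℝ → ℝ} (d : ∀ x, HasDerivAt h (h' x) x)
    (d' : ∀ x, HasDerivAt h' (h'' x) x) (hpos : ∀ x, 0 < h x + h'' x) {a x : ℝ}
    (hax : a < x) (hx : x ≤ a + π) :
    h a * Real.cos (x - a) + h' a * Real.sin (x - a) < h x := by
  have := sturm_pos (hasDerivAt_sub_trig d (h a) (h' a) a)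
    (hasDerivAt_sub_trig d' (h' a) (-h a) a)
    (fun x => by linarith [hpos x]) (a := a) (x := x) (by simp) (by simp) hax hx
  linarith

theorem trig_lt_left {h h' h'' : ℝ → ℝ} (d : ∀ x, HasDerivAt h (h' x) x)
    (d' : ∀ x, HasDerivAt h' (h'' x) x) (hpos : ∀ x, 0 < h x + h'' x) {a x : ℝ}
    (hax : x < a) (hx : a - π ≤ x) :
    h a * Real.cos (x - a) + h' a * Real.sin (x - a) < h x := by
  have := sturm_pos_left (hasDerivAt_sub_trig d (h a) (h' a) a)
    (hasDerivAt_sub_trig d' (h' a) (-h a) a)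
    (fun x => by linarith [hpos x]) (a := a) (x := x) (by simp) (by simp) hax hx
  linarith

/-! ### Zeros of a function with `h + h'' > 0` -/

section Zeros

variable {h h' h'' : ℝ → ℝ} (d : ∀ x, HasDerivAt h (h' x) x)
    (d' : ∀ x, HasDerivAt h' (h'' x) x) (hpos : ∀ x, 0 < h x + h'' x)
include d d' hpos

theorem deriv_neg_of_zeros {a b : ℝ} (ha : h a = 0) (hb : h b = 0) (hab : a < b)
    (hba : b < a + π) : h' a < 0 := by
  have := trig_lt_right d d' hpos hab hba.le
  have hs : 0 < Real.sin (b - a) := Real.sin_pos_of_pos_of_lt_pi (by linarith) (by linarith)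
  rw [ha, hb] at this
  nlinarith

theorem deriv_pos_of_zeros {a b : ℝ} (ha : h a = 0) (hb : h b = 0) (hab : a < b)
    (hba : b < a + π) : 0 < h' b := by
  have := trig_lt_left d d' hpos hab (by linarith)
  have hs : Real.sin (a - b) < 0 := Real.sin_neg_of_neg_of_neg_pi_lt (by linarith) (by linarith)
  rw [ha, hb] at this
  nlinarith

theorem pos_left_of_zero {a x : ℝ} (ha : h a = 0) (ha' : h' a ≤ 0) (hx : x < a)
    (hx' : a - π ≤ x) : 0 < h x := by
  have := trig_lt_left d d' hpos hx hx'
  have hs : Real.sin (x - a) ≤ 0 := Real.sin_nonpos_of_nonpos_of_neg_pi_le (by linarith) (by linarith)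
  rw [ha] at this
  nlinarith

theorem pos_right_of_zero {a x : ℝ} (ha : h a = 0) (ha' : 0 ≤ h' a) (hx : a < x)
    (hx' : x ≤ a + π) : 0 < h x := by
  have := trig_lt_right d d' hpos hx hx'
  have hs : 0 ≤ Real.sin (x - a) := Real.sin_nonneg_of_nonneg_of_le_pi (by linarith) (by linarith)
  rw [ha] at this
  nlinarith

/-- At a zero with nonpositive slope `h` is positive on the half period to the left, with
nonnegative slope on the half period to the right. An intermediate zero would thus make `h` positive
at `a` or at `b`. -/
theorem ne_zero_of_mem_Ioo_zeros {a b x : ℝ} (ha : h a = 0) (hb : h b = 0)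
    (hba : b < a + π) (hx : x ∈ Ioo a b) : h x ≠ 0 := by
  intro h0
  rcases le_total (h' x) 0 with hl | hl
  · have := pos_left_of_zero d d' hpos h0 hl hx.1 (by linarith [hx.2])
    linarith
  · have := pos_right_of_zero d d' hpos h0 hl hx.2 (by linarith [hx.1])
    linarith

variable (hper : Function.Periodic h (2 * π))
include hper

/-- Between consecutive zeros `a < b < a + π`, the only zeros modulo `2π` are `a` and `b`. -/
theorem eq_or_eq_of_zeros {a b x : ℝ} (ha : h a = 0) (hb : h b = 0) (hab : a < b)
    (hba : b < a + π) (hx : x ∈ Ico a (a + 2 * π)) (h0 : h x = 0) : x = a ∨ x = b := by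
  by_contra! hne
  rcases lt_or_gt_of_ne hne.2 with hl | hl
  · exact ne_zero_of_mem_Ioo_zeros d d' hpos ha hb hba ⟨lt_of_le_of_ne hx.1 hne.1.symm, hl⟩ h0
  · rcases le_total x (b + π) with h1 | h1
    · have := pos_right_of_zero d d' hpos hb (deriv_pos_of_zeros d d' hpos ha hb hab hba).le hl h1
      linarith
    · have := pos_left_of_zero d d' hpos ha (deriv_neg_of_zeros d d' hpos ha hb hab hba).le
        (x := x - 2 * π) (by linarith [hx.2]) (by linarith)
      rw [hper.sub_eq] at this
      linarith

/-- A function with `h + h'' > 0` taking a negative value has two zeros at distance `< π`. -/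
theorem exists_zeros_of_neg {c : ℝ} (hc : h c < 0) :
    ∃ a b, a < b ∧ b < a + π ∧ h a = 0 ∧ h b = 0 := by
  -- Comparison at distance exactly `π`, where the cosine is `-1`; for a support function this is
  -- positivity of the width.
  have hopp : ∀ x, 0 < h x + h (x + π) := by
    intro x
    have := trig_lt_right d d' hpos (a := x) (x := x + π) (by linarith [Real.pi_pos]) le_rfl
    simp at this
    linarith
  have hcont : Continuous h := continuous_iff_continuousAt.2 fun x => (d x).continuousAt
  have hr : 0 < h (c + π) := by linarith [hopp c]
  have hl : 0 < h (c - π) := by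
    have := hper (c - π)
    rw [show c - π + 2 * π = c + π by ring] at this
    linarith
  have hpi := Real.pi_pos
  obtain ⟨a, ha, ha0⟩ := intermediate_value_Icc' (by linarith : c - π ≤ c) hcont.continuousOn
    (show (0 : ℝ) ∈ Icc (h c) (h (c - π)) from ⟨hc.le, hl.le⟩)
  obtain ⟨b, hb, hb0⟩ := intermediate_value_Icc (by linarith : c ≤ c + π) hcont.continuousOn
    (show (0 : ℝ) ∈ Icc (h c) (h (c + π)) from ⟨hc.le, hr.le⟩)
  have hac : a < c := lt_of_le_of_ne ha.2 (by rintro rfl; linarith)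
  have hbc : c < b := lt_of_le_of_ne hb.1 (by rintro rfl; linarith)
  have ha' : h' a < 0 := by
    by_contra! hcon
    have := pos_right_of_zero d d' hpos ha0 hcon hac (by linarith [ha.1])
    linarith
  refine ⟨a, b, by linarith, ?_, ha0, hb0⟩
  -- Distance exactly `π` contradicts `hopp`. If it is larger, `b - 2π` lies within `π` to the left
  -- of `a`, where `h` is positive because `h' a < 0`, yet it is a zero by periodicity.
  by_contra! hcon
  have hbl : b < c + π := lt_of_le_of_ne hb.2 (by rintro rfl; linarith)
  rcases eq_or_lt_of_le hcon with he | hlt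
  · have := hopp a
    rw [he, ha0, hb0] at this
    linarith
  · have hca : c - π < a := lt_of_le_of_ne ha.1 (by rintro h; rw [← h] at ha0; linarith)
    have := pos_left_of_zero d d' hpos ha0 ha'.le (x := b - 2 * π) (by linarith) (by linarith)
    rw [hper.sub_eq] at this
    linarith

end Zeros

/-! ### Support functions -/

theorem inner_normalVec (x : Plane) (φ : ℝ) :
    inner ℝ x (normalVec φ) = x 0 * Real.cos φ + x 1 * Real.sin φ := by
  simp [normalVec, PiLp.inner_apply, Fin.sum_univ_two, mul_comm]

theorem inner_tangentVec (x : Plane) (φ : ℝ) :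
    inner ℝ x (tangentVec φ) = -x 0 * Real.sin φ + x 1 * Real.cos φ := by
  simp [tangentVec, PiLp.inner_apply, Fin.sum_univ_two, mul_comm]

theorem hasDerivAt_inner_normalVec (x : Plane) (φ : ℝ) :
    HasDerivAt (fun t => inner ℝ x (normalVec t)) (inner ℝ x (tangentVec φ)) φ := by
  simp only [inner_normalVec, inner_tangentVec]
  exact (((Real.hasDerivAt_cos φ).const_mul (x 0)).add
    ((Real.hasDerivAt_sin φ).const_mul (x 1))).congr_deriv (by ring)

theorem hasDerivAt_inner_tangentVec (x : Plane) (φ : ℝ) :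
    HasDerivAt (fun t => inner ℝ x (tangentVec t)) (-inner ℝ x (normalVec φ)) φ := by
  simp only [inner_normalVec, inner_tangentVec]
  exact (((Real.hasDerivAt_sin φ).const_mul (-x 0)).add
    ((Real.hasDerivAt_cos φ).const_mul (x 1))).congr_deriv (by ring)

theorem inner_envelope_normalVec (f : ℝ → ℝ) (t φ : ℝ) :
    inner ℝ (envelope f t) (normalVec φ) =
      f t * Real.cos (φ - t) + deriv f t * Real.sin (φ - t) := by
  rw [inner_normalVec, Real.cos_sub, Real.sin_sub]
  simp [envelope, normalVec, tangentVec]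
  ring

theorem inner_envelope_tangentVec (f : ℝ → ℝ) (t φ : ℝ) :
    inner ℝ (envelope f t) (tangentVec φ) =
      deriv f t * Real.cos (φ - t) - f t * Real.sin (φ - t) := by
  rw [inner_tangentVec, Real.cos_sub, Real.sin_sub]
  simp [envelope, normalVec, tangentVec]
  ring

theorem plane_ext_of_inner {x y : Plane} (φ : ℝ)
    (h0 : inner ℝ x (normalVec φ) = inner ℝ y (normalVec φ))
    (h1 : inner ℝ x (tangentVec φ) = inner ℝ y (tangentVec φ)) : x = y := by
  rw [inner_normalVec, inner_normalVec] at h0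
  rw [inner_tangentVec, inner_tangentVec] at h1
  have := Real.sin_sq_add_cos_sq φ
  ext i
  fin_cases i
  · show x 0 = y 0
    linear_combination Real.cos φ * h0 - Real.sin φ * h1 + (y 0 - x 0) * this
  · show x 1 = y 1
    linear_combination Real.sin φ * h0 + Real.cos φ * h1 + (y 1 - x 1) * this

theorem eq_smul_normalVec (u : Plane) : ∃ φ : ℝ, u = ‖u‖ • normalVec φ := by
  refine ⟨Complex.arg ⟨u 0, u 1⟩, ?_⟩
  have hn : ‖u‖ = ‖(⟨u 0, u 1⟩ : ℂ)‖ := by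
    rw [EuclideanSpace.norm_eq, Complex.norm_def, Complex.normSq_apply]
    simp [Fin.sum_univ_two, sq]
  ext i
  fin_cases i
  · simp [normalVec, hn, Complex.norm_mul_cos_arg]
  · simp [normalVec, hn, Complex.norm_mul_sin_arg]

theorem normalVec_periodic : Function.Periodic normalVec (2 * π) := by
  intro φ
  simp [normalVec]

theorem tangentVec_periodic : Function.Periodic tangentVec (2 * π) := by
  intro φ
  simp [tangentVec]

theorem normalVec_add_pi (φ : ℝ) : normalVec (φ + π) = -normalVec φ := by
  ext i; fin_cases i <;> simp [normalVec]

theorem supportFn_periodic (K : Set Plane) : Function.Periodic (supportFn K) (2 * π) := by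
  intro φ
  simp only [supportFn, normalVec_periodic φ]

theorem deriv_periodic {f : ℝ → ℝ} {c : ℝ} (hf : Function.Periodic f c) :
    Function.Periodic (deriv f) c := by
  intro x
  rw [← deriv_comp_add_const, funext hf]

theorem envelope_periodic {f : ℝ → ℝ} (hf : Function.Periodic f (2 * π)) :
    Function.Periodic (envelope f) (2 * π) := by
  intro x
  simp only [envelope, hf x, deriv_periodic hf x, normalVec_periodic x, tangentVec_periodic x]

theorem inner_le_supportFn {K : Set Plane} (hK : IsCompact K) {x : Plane} (hx : x ∈ K) (φ : ℝ) :
    inner ℝ x (normalVec φ) ≤ supportFn K φ := by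
  have hc : Continuous (fun x : Plane => (inner ℝ x (normalVec φ) : ℝ)) := by fun_prop
  exact le_csSup (hK.image hc).bddAbove ⟨x, hx, rfl⟩

theorem exists_inner_eq_supportFn {K : Set Plane} (hK : IsCompact K) (hne : K.Nonempty) (φ : ℝ) :
    ∃ x ∈ K, inner ℝ x (normalVec φ) = supportFn K φ := by
  have hc : Continuous (fun x : Plane => (inner ℝ x (normalVec φ) : ℝ)) := by fun_prop
  obtain ⟨x, hx, h⟩ := (hK.image hc).sSup_mem (hne.image _)
  exact ⟨x, hx, h⟩

/-- A separating functional is represented by a vector, and minus that vector is a nonnegative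
multiple of some `N(φ)`; at that angle the separation contradicts the support inequality. -/
theorem mem_of_forall_inner_le {K : Set Plane} (hK : IsCompact K) (hc : Convex ℝ K)
    (hne : K.Nonempty) {x : Plane} (h : ∀ φ, inner ℝ x (normalVec φ) ≤ supportFn K φ) : x ∈ K := by
  by_contra hx
  obtain ⟨l, c, hl, hlb⟩ := geometric_hahn_banach_point_closed hc hK.isClosed hx
  obtain ⟨φ, hφ⟩ := eq_smul_normalVec (-((InnerProductSpace.toDual ℝ Plane).symm l))
  set u := (InnerProductSpace.toDual ℝ Plane).symm l with hu
  have hlu : ∀ y, l y = inner ℝ u y := fun y => by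
    rw [hu, InnerProductSpace.toDual_symm_apply]
  obtain ⟨y, hy, hys⟩ := exists_inner_eq_supportFn hK hne φ
  have h1 := hlb y hy
  have h2 := h φ
  rw [← hys] at h2
  have e : ∀ z : Plane, l z = -(‖-u‖ * inner ℝ z (normalVec φ)) := fun z => by
    have h3 : inner ℝ (-u) z = ‖-u‖ * inner ℝ z (normalVec φ) := by
      conv_lhs => rw [hφ]
      rw [real_inner_smul_left, real_inner_comm]
    rw [hlu, ← h3, inner_neg_left, neg_neg]
  rw [e] at h1 hl
  nlinarith [norm_nonneg (-u)]

namespace IsStrictlyConvexC2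

variable {K : Set Plane} (hK : IsStrictlyConvexC2 K)
include hK

theorem hasDerivAt (φ : ℝ) : HasDerivAt (supportFn K) (deriv (supportFn K) φ) φ :=
  (hK.contDiff.differentiable (by norm_num) φ).hasDerivAt

theorem contDiff_deriv : ContDiff ℝ 1 (deriv (supportFn K)) := by
  have h2 : ContDiff ℝ (1 + 1) (supportFn K) := by
    simpa [one_add_one_eq_two] using hK.contDiff
  exact (contDiff_succ_iff_deriv.1 h2).2.2

theorem hasDerivAt_deriv (φ : ℝ) :
    HasDerivAt (deriv (supportFn K)) (deriv (deriv (supportFn K)) φ) φ :=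
  (hK.contDiff_deriv.differentiable (by norm_num) φ).hasDerivAt

theorem continuous : Continuous (supportFn K) := hK.contDiff.continuous

theorem continuous_deriv : Continuous (deriv (supportFn K)) := hK.contDiff_deriv.continuous

theorem continuous_deriv2 : Continuous (deriv (deriv (supportFn K))) :=
  hK.contDiff_deriv.continuous_deriv le_rfl

/-- The function `p - ⟨x, N⟩` is nonnegative and vanishes at `φ`, so its derivative vanishes there
too. This fixes both components of `x` in the frame `N(φ)`, `N'(φ)`; differentiability of `p` is
what makes the contact point unique. -/
theorem eq_envelope {x : Plane} (hx : x ∈ K) {φ : ℝ}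
    (h : inner ℝ x (normalVec φ) = supportFn K φ) : x = envelope (supportFn K) φ := by
  have hd := (hK.hasDerivAt φ).sub (hasDerivAt_inner_normalVec x φ)
  have hmin : IsLocalMin (supportFn K - fun t => inner ℝ x (normalVec t)) φ := by
    refine Filter.Eventually.of_forall fun t => ?_
    simp only [Pi.sub_apply, h]
    linarith [inner_le_supportFn hK.isCompact hx t]
  have h0 := hmin.hasDerivAt_eq_zero hd
  apply plane_ext_of_inner φ
  · rw [inner_envelope_normalVec, h]; simp
  · rw [inner_envelope_tangentVec]; simp; linarith

theorem envelope_mem (φ : ℝ) : envelope (supportFn K) φ ∈ K := by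
  obtain ⟨x, hx, h⟩ := exists_inner_eq_supportFn hK.isCompact hK.nonempty φ
  rwa [← hK.eq_envelope hx h]

theorem mem_iff (x : Plane) : x ∈ K ↔ ∀ φ, inner ℝ x (normalVec φ) ≤ supportFn K φ :=
  ⟨fun hx φ => inner_le_supportFn hK.isCompact hx φ,
    mem_of_forall_inner_le hK.isCompact hK.convex hK.nonempty⟩

end IsStrictlyConvexC2

/-- The support function of `K` about the point `P`. -/
noncomputable def gap (K : Set Plane) (P : Plane) (φ : ℝ) : ℝ :=
  supportFn K φ - inner ℝ P (normalVec φ)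

/-- The derivative of `gap`. -/
noncomputable def gapDeriv (K : Set Plane) (P : Plane) (φ : ℝ) : ℝ :=
  deriv (supportFn K) φ - inner ℝ P (tangentVec φ)

theorem gap_periodic (K : Set Plane) (P : Plane) : Function.Periodic (gap K P) (2 * π) := by
  intro φ
  simp only [gap, supportFn_periodic K φ, normalVec_periodic φ]

theorem gapDeriv_periodic (K : Set Plane) (P : Plane) :
    Function.Periodic (gapDeriv K P) (2 * π) := by
  intro φ
  simp only [gapDeriv, deriv_periodic (supportFn_periodic K) φ, tangentVec_periodic φ]

/-- Boundary points correspond to double zeros of `gap`, exterior points to pairs of simple zeros.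
-/
theorem eq_envelope_iff {K : Set Plane} {P : Plane} {φ : ℝ} :
    P = envelope (supportFn K) φ ↔ gap K P φ = 0 ∧ gapDeriv K P φ = 0 := by
  constructor
  · rintro rfl
    simp [gap, gapDeriv, inner_envelope_normalVec, inner_envelope_tangentVec]
  · rintro ⟨h0, h1⟩
    apply plane_ext_of_inner φ
    · simp only [gap] at h0
      rw [inner_envelope_normalVec]; simp; linarith
    · simp only [gapDeriv] at h1
      rw [inner_envelope_tangentVec]; simp; linarith

namespace IsStrictlyConvexC2

variable {K : Set Plane} (hK : IsStrictlyConvexC2 K)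
include hK

theorem hasDerivAt_gap (P : Plane) (φ : ℝ) : HasDerivAt (gap K P) (gapDeriv K P φ) φ :=
  (hK.hasDerivAt φ).sub (hasDerivAt_inner_normalVec P φ)

theorem hasDerivAt_gapDeriv (P : Plane) (φ : ℝ) :
    HasDerivAt (gapDeriv K P) (deriv (deriv (supportFn K)) φ + inner ℝ P (normalVec φ)) φ := by
  exact ((hK.hasDerivAt_deriv φ).sub (hasDerivAt_inner_tangentVec P φ)).congr_deriv (by ring)

theorem gap_add_pos (P : Plane) (φ : ℝ) :
    0 < gap K P φ + (deriv (deriv (supportFn K)) φ + inner ℝ P (normalVec φ)) := by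
  have := hK.curvature_pos φ
  unfold gap
  linarith

theorem mem_iff_gap (P : Plane) : P ∈ K ↔ ∀ φ, 0 ≤ gap K P φ := by
  rw [hK.mem_iff]
  simp [gap]

/-- The point with normal angle `a` is the only contact point of the support line with normal
angle `a`. -/
theorem gap_envelope_pos {a x : ℝ} (hx : x ∈ Ioo a (a + 2 * π)) :
    0 < gap K (envelope (supportFn K) a) x := by
  obtain ⟨h0, h1⟩ := (eq_envelope_iff (K := K) (P := envelope (supportFn K) a) (φ := a)).1 rfl
  rcases le_total x (a + π) with h | h
  · exact pos_right_of_zero (hK.hasDerivAt_gap _) (hK.hasDerivAt_gapDeriv _) (hK.gap_add_pos _)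
      h0 h1.ge hx.1 h
  · have := pos_left_of_zero (hK.hasDerivAt_gap _) (hK.hasDerivAt_gapDeriv _) (hK.gap_add_pos _)
      h0 h1.le (x := x - 2 * π) (by linarith [hx.2]) (by linarith)
    rwa [(gap_periodic K _).sub_eq] at this

theorem envelope_injOn (a : ℝ) : InjOn (envelope (supportFn K)) (Ico a (a + 2 * π)) := by
  have key : ∀ x y : ℝ, x < y → y < x + 2 * π →
      envelope (supportFn K) x ≠ envelope (supportFn K) y := by
    intro x y hxy hyx he
    have h1 := hK.gap_envelope_pos (a := x) (x := y) ⟨hxy, hyx⟩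
    have h2 := (eq_envelope_iff (K := K) (P := envelope (supportFn K) y) (φ := y)).1 rfl
    rw [he] at h1
    linarith [h2.1]
  intro x hx y hy he
  rcases lt_trichotomy x y with h | h | h
  · exact absurd he (key x y h (by linarith [hx.1, hy.2]))
  · exact h
  · exact absurd he.symm (key y x h (by linarith [hy.1, hx.2]))

end IsStrictlyConvexC2

/-! ### The visual angle -/

theorem norm_tangentVec (φ : ℝ) : ‖tangentVec φ‖ = 1 := by
  simp [EuclideanSpace.norm_eq, tangentVec, Fin.sum_univ_two]

theorem norm_normalVec (φ : ℝ) : ‖normalVec φ‖ = 1 := by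
  simp [EuclideanSpace.norm_eq, normalVec, Fin.sum_univ_two]

theorem angle_tangentVec (φ : ℝ) {δ : ℝ} (h0 : 0 ≤ δ) (hπ : δ ≤ π) :
    InnerProductGeometry.angle (tangentVec φ) (tangentVec (φ + δ)) = δ := by
  rw [InnerProductGeometry.angle, norm_tangentVec, norm_tangentVec, inner_tangentVec]
  have : Real.cos δ = Real.cos (φ + δ - φ) := by ring_nf
  rw [show -tangentVec φ 0 * Real.sin (φ + δ) + tangentVec φ 1 * Real.cos (φ + δ) = Real.cos δ by
    rw [this, Real.cos_sub]; simp [tangentVec]; ring]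
  simp [Real.arccos_cos h0 hπ]

/-- The support line passes through `P`, so the vector from `P` to the contact point has only a
tangential component, and `gapDeriv` is its signed length. -/
theorem envelope_sub_eq {K : Set Plane} {P : Plane} {φ : ℝ} (h : gap K P φ = 0) :
    envelope (supportFn K) φ - P = gapDeriv K P φ • tangentVec φ := by
  apply plane_ext_of_inner φ
  · rw [inner_sub_left, real_inner_smul_left, inner_envelope_normalVec, inner_normalVec (tangentVec φ)]
    simp only [gap] at h
    simp [tangentVec]
    linear_combination h
  · rw [inner_sub_left, real_inner_smul_left, inner_envelope_tangentVec, real_inner_self_eq_norm_sq,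
      norm_tangentVec]
    simp [gapDeriv]

namespace IsStrictlyConvexC2

variable {K : Set Plane} (hK : IsStrictlyConvexC2 K)
include hK

theorem gapDeriv_neg {P : Plane} {φ δ : ℝ} (hδ : δ ∈ Ioo 0 π)
    (h1 : gap K P φ = 0) (h2 : gap K P (φ + δ) = 0) : gapDeriv K P φ < 0 :=
  deriv_neg_of_zeros (hK.hasDerivAt_gap P) (hK.hasDerivAt_gapDeriv P) (hK.gap_add_pos P) h1 h2
    (by linarith [hδ.1]) (by linarith [hδ.2])

theorem gapDeriv_pos {P : Plane} {φ δ : ℝ} (hδ : δ ∈ Ioo 0 π)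
    (h1 : gap K P φ = 0) (h2 : gap K P (φ + δ) = 0) : 0 < gapDeriv K P (φ + δ) :=
  deriv_pos_of_zeros (hK.hasDerivAt_gap P) (hK.hasDerivAt_gapDeriv P) (hK.gap_add_pos P) h1 h2
    (by linarith [hδ.1]) (by linarith [hδ.2])

/-- For a point of `K` every zero of `gap` is a minimum, but the first of two zeros at distance less
than `π` has negative slope. -/
theorem notMem_of_zeros {P : Plane} {φ δ : ℝ} (hδ : δ ∈ Ioo 0 π)
    (h1 : gap K P φ = 0) (h2 : gap K P (φ + δ) = 0) : P ∉ K := by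
  intro hP
  have hmin : IsLocalMin (gap K P) φ :=
    Filter.Eventually.of_forall fun t => h1 ▸ (hK.mem_iff_gap P).1 hP t
  have := hmin.hasDerivAt_eq_zero (hK.hasDerivAt_gap P φ)
  linarith [hK.gapDeriv_neg hδ h1 h2]

theorem isTangencyPoint_iff {P x : Plane} :
    IsTangencyPoint K P x ↔ ∃ φ, x = envelope (supportFn K) φ ∧ gap K P φ = 0 := by
  constructor
  · rintro ⟨hx, u, hu, huP, hmax⟩
    obtain ⟨φ, hφ⟩ := eq_smul_normalVec u
    have hn : 0 < ‖u‖ := norm_pos_iff.2 hu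
    have e : ∀ z : Plane, inner ℝ u z = ‖u‖ * inner ℝ z (normalVec φ) := fun z => by
      conv_lhs => rw [hφ]
      rw [real_inner_smul_left, real_inner_comm]
    have hxs : inner ℝ x (normalVec φ) = supportFn K φ := by
      apply le_antisymm (inner_le_supportFn hK.isCompact hx φ)
      obtain ⟨y, hy, hys⟩ := exists_inner_eq_supportFn hK.isCompact hK.nonempty φ
      have := hmax y hy
      rw [e, e, hys] at this
      exact le_of_mul_le_mul_left this hn
    rw [e, e] at huP
    have := mul_left_cancel₀ hn.ne' huP
    exact ⟨φ, hK.eq_envelope hx hxs, by rw [gap, this, hxs, sub_self]⟩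
  · rintro ⟨φ, rfl, h⟩
    have hs : inner ℝ (envelope (supportFn K) φ) (normalVec φ) = supportFn K φ := by
      rw [inner_envelope_normalVec]; simp
    refine ⟨hK.envelope_mem φ, normalVec φ, ?_, ?_, ?_⟩
    · rw [← norm_ne_zero_iff, norm_normalVec]; norm_num
    · rw [real_inner_comm, real_inner_comm _ (normalVec φ), hs]
      simp only [gap] at h
      linarith
    · intro y hy
      rw [real_inner_comm, real_inner_comm _ (normalVec φ), hs]
      exact inner_le_supportFn hK.isCompact hy φ

/-- The two contact points are seen from `P` along a negative multiple of `N'(φ)` and a positive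
multiple of `N'(φ + δ)`, whence the angle `π - δ`. Modulo `2π` there are no further zeros of `gap`,
so the supremum runs over these two points only. -/
theorem visualAngle_eq {P : Plane} {φ δ : ℝ} (hδ : δ ∈ Ioo 0 π)
    (h1 : gap K P φ = 0) (h2 : gap K P (φ + δ) = 0) : visualAngle K P = π - δ := by
  have hP := hK.notMem_of_zeros hδ h1 h2
  have hang : EuclideanGeometry.angle (envelope (supportFn K) φ) P
      (envelope (supportFn K) (φ + δ)) = π - δ := by
    rw [EuclideanGeometry.angle, vsub_eq_sub, vsub_eq_sub, envelope_sub_eq h1, envelope_sub_eq h2,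
      InnerProductGeometry.angle_smul_left_of_neg _ _ (hK.gapDeriv_neg hδ h1 h2),
      InnerProductGeometry.angle_smul_right_of_pos _ _ (hK.gapDeriv_pos hδ h1 h2),
      InnerProductGeometry.angle_neg_left, angle_tangentVec φ hδ.1.le hδ.2.le]
  have hself : ∀ ψ, EuclideanGeometry.angle (envelope (supportFn K) ψ) P
      (envelope (supportFn K) ψ) = 0 := fun ψ =>
    EuclideanGeometry.angle_self_of_ne fun he => hP (he ▸ hK.envelope_mem ψ)
  have hpt : ∀ x, IsTangencyPoint K P x →
      x = envelope (supportFn K) φ ∨ x = envelope (supportFn K) (φ + δ) := by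
    intro x hx
    obtain ⟨ψ, rfl, h0⟩ := hK.isTangencyPoint_iff.1 hx
    have hpi : (0 : ℝ) < 2 * π := by positivity
    obtain ⟨n, hψ'⟩ : ∃ n : ℤ, ψ - n * (2 * π) ∈ Ico φ (φ + 2 * π) :=
      ⟨toIcoDiv hpi φ ψ, by rw [← zsmul_eq_mul]; exact toIcoMod_mem_Ico hpi φ ψ⟩
    have hg : gap K P (ψ - n * (2 * π)) = 0 := by
      rw [(gap_periodic K P).sub_int_mul_eq, h0]
    rw [← (envelope_periodic (supportFn_periodic K)).sub_int_mul_eq (n := n)]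
    rcases eq_or_eq_of_zeros (hK.hasDerivAt_gap P) (hK.hasDerivAt_gapDeriv P) (hK.gap_add_pos P)
      (gap_periodic K P) h1 h2 (by linarith [hδ.1]) (by linarith [hδ.2]) hψ' hg with h | h
    · left; rw [h]
    · right; rw [h]
  refine IsGreatest.csSup_eq ⟨?_, ?_⟩
  · exact ⟨_, _, hK.isTangencyPoint_iff.2 ⟨φ, rfl, h1⟩,
      hK.isTangencyPoint_iff.2 ⟨φ + δ, rfl, h2⟩, hang.symm⟩
  · rintro θ ⟨x, y, hx, hy, rfl⟩
    have : 0 ≤ π - δ := by linarith [hδ.2]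
    rcases hpt x hx with rfl | rfl <;> rcases hpt y hy with rfl | rfl
    · rw [hself]; exact this
    · rw [hang]
    · rw [EuclideanGeometry.angle_comm, hang]
    · rw [hself]; exact this

theorem exists_zeros {P : Plane} (hP : P ∉ K) :
    ∃ φ ∈ Ico 0 (2 * π), ∃ δ ∈ Ioo 0 π, gap K P φ = 0 ∧ gap K P (φ + δ) = 0 := by
  rw [hK.mem_iff_gap] at hP
  push Not at hP
  obtain ⟨c, hc⟩ := hP
  obtain ⟨a, b, hab, hba, ha, hb⟩ := exists_zeros_of_neg (hK.hasDerivAt_gap P)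
    (hK.hasDerivAt_gapDeriv P) (hK.gap_add_pos P) (gap_periodic K P) hc
  have hpi : (0 : ℝ) < 2 * π := by positivity
  have hm := toIcoMod_mem_Ico hpi 0 a
  rw [zero_add] at hm
  refine ⟨_, hm, b - a, ⟨by linarith, by linarith⟩, ?_, ?_⟩
  · rw [toIcoMod, (gap_periodic K P).sub_zsmul_eq, ha]
  · rw [toIcoMod, show a - toIcoDiv hpi 0 a • (2 * π) + (b - a) = b - toIcoDiv hpi 0 a • (2 * π) by
      ring, (gap_periodic K P).sub_zsmul_eq, hb]

/-- The sign of `gapDeriv`, negative at the first zero and positive at the second, tells which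
tangent is which, so the roles of the two zeros cannot be exchanged. -/
theorem zeros_unique {P : Plane} {φ δ φ' δ' : ℝ} (hφ : φ ∈ Ico 0 (2 * π))
    (hφ' : φ' ∈ Ico 0 (2 * π)) (hδ : δ ∈ Ioo 0 π) (hδ' : δ' ∈ Ioo 0 π)
    (h1 : gap K P φ = 0) (h2 : gap K P (φ + δ) = 0)
    (h1' : gap K P φ' = 0) (h2' : gap K P (φ' + δ') = 0) : φ = φ' ∧ δ = δ' := by
  have hφφ : φ = φ' := by
    have hneg := hK.gapDeriv_neg hδ' h1' h2'
    have hpos := hK.gapDeriv_pos hδ h1 h2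
    have key := fun x hx h0 => eq_or_eq_of_zeros (hK.hasDerivAt_gap P) (hK.hasDerivAt_gapDeriv P)
      (hK.gap_add_pos P) (gap_periodic K P) h1 h2 (by linarith [hδ.1]) (by linarith [hδ.2])
      (x := x) hx h0
    rcases le_or_gt φ φ' with h | h
    · rcases key φ' ⟨h, by linarith [hφ.1, hφ'.2]⟩ h1' with he | he
      · exact he.symm
      · rw [he] at hneg; linarith
    · have hp := gap_periodic K P φ'
      rcases key (φ' + 2 * π) ⟨by linarith [hφ.2, hφ'.1], by linarith⟩ (by rw [hp, h1']) with he | he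
      · linarith [hφ.2, hφ'.1]
      · rw [← gapDeriv_periodic K P, he] at hneg; linarith
  subst hφφ
  refine ⟨rfl, ?_⟩
  rcases eq_or_eq_of_zeros (hK.hasDerivAt_gap P) (hK.hasDerivAt_gapDeriv P) (hK.gap_add_pos P)
    (gap_periodic K P) h1 h2 (by linarith [hδ.1]) (by linarith [hδ.2])
    (x := φ + δ') ⟨by linarith [hδ'.1], by linarith [hδ'.2, Real.pi_pos]⟩ h2' with he | he
  · linarith [hδ'.1]
  · linarith

end IsStrictlyConvexC2

/-! ### Change of variables in the plane -/

theorem det_prod_fst_snd (a b c d : ℝ) :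
    ((a • ContinuousLinearMap.fst ℝ ℝ ℝ + b • ContinuousLinearMap.snd ℝ ℝ ℝ).prod
      (c • ContinuousLinearMap.fst ℝ ℝ ℝ + d • ContinuousLinearMap.snd ℝ ℝ ℝ)).det =
      a * d - b * c := by
  rw [ContinuousLinearMap.det, ← LinearMap.det_toMatrix (Module.Basis.finTwoProd ℝ),
    Matrix.det_fin_two]
  simp [LinearMap.toMatrix_apply]

/-- The identification of the Euclidean plane with `ℝ × ℝ`. -/
noncomputable def planeEquiv : Plane ≃ᵐ ℝ × ℝ :=
  (MeasurableEquiv.toLp 2 (Fin 2 → ℝ)).symm.trans MeasurableEquiv.finTwoArrow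

theorem measurePreserving_planeEquiv : MeasurePreserving planeEquiv volume volume :=
  (volume_preserving_finTwoArrow ℝ).comp
    (EuclideanSpace.volume_preserving_symm_measurableEquiv_toLp (Fin 2))

theorem planeEquiv_symm_apply (z : ℝ × ℝ) : planeEquiv.symm z = !₂[z.1, z.2] := rfl

section ChangeOfVariables

variable {S : Set (ℝ × ℝ)} (hS : MeasurableSet S) {X Y a b c d : ℝ × ℝ → ℝ}
  (hX : ∀ z ∈ S, HasFDerivAt X
    (a z • ContinuousLinearMap.fst ℝ ℝ ℝ + b z • ContinuousLinearMap.snd ℝ ℝ ℝ) z)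
  (hY : ∀ z ∈ S, HasFDerivAt Y
    (c z • ContinuousLinearMap.fst ℝ ℝ ℝ + d z • ContinuousLinearMap.snd ℝ ℝ ℝ) z)
  (hinj : InjOn (fun z => (!₂[X z, Y z] : Plane)) S) (g : Plane → ℝ)
include hS hX hY hinj

theorem integrableOn_image_plane_iff :
    IntegrableOn g ((fun z => (!₂[X z, Y z] : Plane)) '' S) ↔
      IntegrableOn (fun z => |a z * d z - b z * c z| * g !₂[X z, Y z]) S := by
  have he := measurePreserving_planeEquiv.symm
  have himg : (fun z => (!₂[X z, Y z] : Plane)) '' S =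
      planeEquiv.symm '' ((fun z => (X z, Y z)) '' S) := by
    rw [image_image]; rfl
  rw [himg, he.integrableOn_image planeEquiv.symm.measurableEmbedding,
    integrableOn_image_iff_integrableOn_abs_det_fderiv_smul volume hS
      (fun z hz => ((hX z hz).prodMk (hY z hz)).hasFDerivWithinAt)
      (fun z hz w hw h => hinj hz hw (by simpa using h))]
  simp only [det_prod_fst_snd, smul_eq_mul, Function.comp, planeEquiv_symm_apply]

theorem setIntegral_image_plane :
    ∫ P in (fun z => (!₂[X z, Y z] : Plane)) '' S, g P =
      ∫ z in S, |a z * d z - b z * c z| * g !₂[X z, Y z] := by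
  have he := measurePreserving_planeEquiv.symm
  have himg : (fun z => (!₂[X z, Y z] : Plane)) '' S =
      planeEquiv.symm '' ((fun z => (X z, Y z)) '' S) := by
    rw [image_image]; rfl
  rw [himg, he.setIntegral_image_emb planeEquiv.symm.measurableEmbedding,
    integral_image_eq_integral_abs_det_fderiv_smul volume hS
      (fun z hz => ((hX z hz).prodMk (hY z hz)).hasFDerivWithinAt)
      (fun z hz w hw h => hinj hz hw (by simpa using h))]
  simp only [det_prod_fst_snd, smul_eq_mul, planeEquiv_symm_apply]

end ChangeOfVariables

/-! ### Exterior points as intersections of two tangents -/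

/-- Signed distance from the foot of the origin on the tangent with normal angle `φ` to the
intersection with the tangent with normal angle `φ + δ`. -/
noncomputable def footDist (p : ℝ → ℝ) (z : ℝ × ℝ) : ℝ :=
  (p (z.2 + z.1) - p z.2 * Real.cos z.1) / Real.sin z.1

/-- Length of the first tangent from the intersection point. -/
noncomputable def tanLenL (p : ℝ → ℝ) (z : ℝ × ℝ) : ℝ := footDist p z - deriv p z.2

/-- Length of the second tangent from the intersection point. -/
noncomputable def tanLenR (p : ℝ → ℝ) (z : ℝ × ℝ) : ℝ :=
  (p z.2 - p (z.2 + z.1) * Real.cos z.1) / Real.sin z.1 + deriv p (z.2 + z.1)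

/-- The intersection of the tangents with normal angles `φ` and `φ + δ`, for `z = (δ, φ)`. -/
noncomputable def tangentMeet (p : ℝ → ℝ) (z : ℝ × ℝ) : Plane :=
  !₂[p z.2 * Real.cos z.2 - footDist p z * Real.sin z.2,
    p z.2 * Real.sin z.2 + footDist p z * Real.cos z.2]

theorem inner_tangentMeet_normalVec (p : ℝ → ℝ) (z : ℝ × ℝ) (φ : ℝ) :
    inner ℝ (tangentMeet p z) (normalVec φ) =
      p z.2 * Real.cos (φ - z.2) + footDist p z * Real.sin (φ - z.2) := by
  rw [inner_normalVec, Real.cos_sub, Real.sin_sub]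
  simp [tangentMeet]
  ring

theorem inner_tangentMeet_tangentVec (p : ℝ → ℝ) (z : ℝ × ℝ) (φ : ℝ) :
    inner ℝ (tangentMeet p z) (tangentVec φ) =
      footDist p z * Real.cos (φ - z.2) - p z.2 * Real.sin (φ - z.2) := by
  rw [inner_tangentVec, Real.cos_sub, Real.sin_sub]
  simp [tangentMeet]
  ring

theorem gap_tangentMeet_fst (K : Set Plane) (z : ℝ × ℝ) :
    gap K (tangentMeet (supportFn K) z) z.2 = 0 := by
  simp [gap, inner_tangentMeet_normalVec]

theorem gap_tangentMeet_snd (K : Set Plane) {z : ℝ × ℝ} (hz : Real.sin z.1 ≠ 0) :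
    gap K (tangentMeet (supportFn K) z) (z.2 + z.1) = 0 := by
  rw [gap, inner_tangentMeet_normalVec, footDist]
  rw [show z.2 + z.1 - z.2 = z.1 by ring, div_mul_cancel₀ _ hz]
  ring

theorem gapDeriv_tangentMeet_fst (K : Set Plane) (z : ℝ × ℝ) :
    gapDeriv K (tangentMeet (supportFn K) z) z.2 = -tanLenL (supportFn K) z := by
  simp [gapDeriv, inner_tangentMeet_tangentVec, tanLenL]

theorem gapDeriv_tangentMeet_snd (K : Set Plane) {z : ℝ × ℝ} (hz : Real.sin z.1 ≠ 0) :
    gapDeriv K (tangentMeet (supportFn K) z) (z.2 + z.1) = tanLenR (supportFn K) z := by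
  rw [gapDeriv, inner_tangentMeet_tangentVec, tanLenR, footDist]
  rw [show z.2 + z.1 - z.2 = z.1 by ring]
  field_simp
  linear_combination supportFn K z.2 * Real.sin_sq_add_cos_sq z.1

theorem eq_tangentMeet {K : Set Plane} {P : Plane} {z : ℝ × ℝ} (hz : Real.sin z.1 ≠ 0)
    (h1 : gap K P z.2 = 0) (h2 : gap K P (z.2 + z.1) = 0) : P = tangentMeet (supportFn K) z := by
  have hN : inner ℝ P (normalVec z.2) = supportFn K z.2 := by simp only [gap] at h1; linarith
  have hexp : inner ℝ P (normalVec (z.2 + z.1)) = inner ℝ P (normalVec z.2) * Real.cos z.1 +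
      inner ℝ P (tangentVec z.2) * Real.sin z.1 := by
    rw [inner_normalVec, inner_normalVec, inner_tangentVec, Real.cos_add, Real.sin_add]
    ring
  apply plane_ext_of_inner z.2
  · rw [inner_tangentMeet_normalVec, hN]; simp
  · rw [inner_tangentMeet_tangentVec, footDist]
    simp only [gap] at h2
    rw [hexp, hN] at h2
    simp
    field_simp
    linear_combination -h2

/-! ### Derivatives of the map sending two normal angles to the meeting point of the tangents -/

section Jacobian

variable {p : ℝ → ℝ} (hp : ∀ x, HasDerivAt p (deriv p x) x)
include hp

theorem hasFDerivAt_footDist {z : ℝ × ℝ} (hz : Real.sin z.1 ≠ 0) :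
    HasFDerivAt (footDist p)
      ((tanLenR p z / Real.sin z.1) • ContinuousLinearMap.fst ℝ ℝ ℝ +
        ((deriv p (z.2 + z.1) - deriv p z.2 * Real.cos z.1) / Real.sin z.1) •
          ContinuousLinearMap.snd ℝ ℝ ℝ) z := by
  have h1 : HasFDerivAt (fun z : ℝ × ℝ => z.1) (ContinuousLinearMap.fst ℝ ℝ ℝ) z := hasFDerivAt_fst
  have h2 : HasFDerivAt (fun z : ℝ × ℝ => z.2) (ContinuousLinearMap.snd ℝ ℝ ℝ) z := hasFDerivAt_snd
  have hp1 := (hp z.2).comp_hasFDerivAt z h2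
  have hp2 := (hp (z.2 + z.1)).comp_hasFDerivAt z (h2.add h1)
  have hs := (Real.hasDerivAt_sin z.1).comp_hasFDerivAt z h1
  have hc := (Real.hasDerivAt_cos z.1).comp_hasFDerivAt z h1
  have hi := (hasDerivAt_inv hz).comp_hasFDerivAt z hs
  have := (hp2.sub (hp1.mul hc)).mul hi
  refine (this.congr_fderiv ?_).congr_of_eventuallyEq (Filter.Eventually.of_forall fun w => ?_)
  · have hsc := Real.sin_sq_add_cos_sq z.1
    ext
    · simp [tanLenR]
      field_simp
      linear_combination p z.2 * hsc
    · simp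
      field_simp
  · simp [footDist, div_eq_mul_inv]

theorem hasFDerivAt_tangentMeet_fst {z : ℝ × ℝ} (hz : Real.sin z.1 ≠ 0) :
    HasFDerivAt (fun z : ℝ × ℝ => p z.2 * Real.cos z.2 - footDist p z * Real.sin z.2)
      ((-(tanLenR p z / Real.sin z.1) * Real.sin z.2) • ContinuousLinearMap.fst ℝ ℝ ℝ +
        (-tanLenL p z * Real.cos z.2 - (p z.2 + (deriv p (z.2 + z.1) -
          deriv p z.2 * Real.cos z.1) / Real.sin z.1) * Real.sin z.2) •
          ContinuousLinearMap.snd ℝ ℝ ℝ) z := by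
  have h2 : HasFDerivAt (fun z : ℝ × ℝ => z.2) (ContinuousLinearMap.snd ℝ ℝ ℝ) z := hasFDerivAt_snd
  have hp1 := (hp z.2).comp_hasFDerivAt z h2
  have hs := (Real.hasDerivAt_sin z.2).comp_hasFDerivAt z h2
  have hc := (Real.hasDerivAt_cos z.2).comp_hasFDerivAt z h2
  refine ((hp1.mul hc).sub ((hasFDerivAt_footDist hp hz).mul hs)).congr_fderiv ?_
  ext <;> simp [tanLenL] <;> ring

theorem hasFDerivAt_tangentMeet_snd {z : ℝ × ℝ} (hz : Real.sin z.1 ≠ 0) :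
    HasFDerivAt (fun z : ℝ × ℝ => p z.2 * Real.sin z.2 + footDist p z * Real.cos z.2)
      (((tanLenR p z / Real.sin z.1) * Real.cos z.2) • ContinuousLinearMap.fst ℝ ℝ ℝ +
        (-tanLenL p z * Real.sin z.2 + (p z.2 + (deriv p (z.2 + z.1) -
          deriv p z.2 * Real.cos z.1) / Real.sin z.1) * Real.cos z.2) •
          ContinuousLinearMap.snd ℝ ℝ ℝ) z := by
  have h2 : HasFDerivAt (fun z : ℝ × ℝ => z.2) (ContinuousLinearMap.snd ℝ ℝ ℝ) z := hasFDerivAt_snd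
  have hp1 := (hp z.2).comp_hasFDerivAt z h2
  have hs := (Real.hasDerivAt_sin z.2).comp_hasFDerivAt z h2
  have hc := (Real.hasDerivAt_cos z.2).comp_hasFDerivAt z h2
  refine ((hp1.mul hs).add ((hasFDerivAt_footDist hp hz).mul hc)).congr_fderiv ?_
  ext <;> simp [tanLenL] <;> ring

end Jacobian

/-- The parameter domain of the exterior of `K`. -/
def tangentDomain : Set (ℝ × ℝ) := Ioo 0 π ×ˢ Ico 0 (2 * π)

theorem sin_pos_of_mem_tangentDomain {z : ℝ × ℝ} (hz : z ∈ tangentDomain) : 0 < Real.sin z.1 :=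
  Real.sin_pos_of_pos_of_lt_pi hz.1.1 hz.1.2

theorem measurableSet_tangentDomain : MeasurableSet tangentDomain :=
  measurableSet_Ioo.prod measurableSet_Ico

namespace IsStrictlyConvexC2

variable {K : Set Plane} (hK : IsStrictlyConvexC2 K)
include hK

theorem tanLenL_pos {z : ℝ × ℝ} (hz : z ∈ tangentDomain) : 0 < tanLenL (supportFn K) z := by
  have := hK.gapDeriv_neg hz.1 (gap_tangentMeet_fst K z)
    (gap_tangentMeet_snd K (sin_pos_of_mem_tangentDomain hz).ne')
  rw [gapDeriv_tangentMeet_fst] at this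
  linarith

theorem tanLenR_pos {z : ℝ × ℝ} (hz : z ∈ tangentDomain) : 0 < tanLenR (supportFn K) z := by
  have hs := (sin_pos_of_mem_tangentDomain hz).ne'
  have := hK.gapDeriv_pos hz.1 (gap_tangentMeet_fst K z) (gap_tangentMeet_snd K hs)
  rwa [gapDeriv_tangentMeet_snd K hs] at this

theorem tangentMeet_injOn : InjOn (tangentMeet (supportFn K)) tangentDomain := by
  intro z hz w hw h
  have h1 := gap_tangentMeet_fst K z
  have h2 := gap_tangentMeet_snd K (sin_pos_of_mem_tangentDomain hz).ne'
  have h1' := gap_tangentMeet_fst K w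
  have h2' := gap_tangentMeet_snd K (sin_pos_of_mem_tangentDomain hw).ne'
  rw [← h] at h1' h2'
  obtain ⟨e1, e2⟩ := hK.zeros_unique hz.2 hw.2 hz.1 hw.1 h1 h2 h1' h2'
  exact Prod.ext e2 e1

theorem tangentMeet_image : tangentMeet (supportFn K) '' tangentDomain = Kᶜ := by
  ext P
  constructor
  · rintro ⟨z, hz, rfl⟩
    exact hK.notMem_of_zeros hz.1 (gap_tangentMeet_fst K z)
      (gap_tangentMeet_snd K (sin_pos_of_mem_tangentDomain hz).ne')
  · intro hP
    obtain ⟨φ, hφ, δ, hδ, h1, h2⟩ := hK.exists_zeros hP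
    have hz : (δ, φ) ∈ tangentDomain := ⟨hδ, hφ⟩
    exact ⟨(δ, φ), hz, (eq_tangentMeet (sin_pos_of_mem_tangentDomain hz).ne' h1 h2).symm⟩

/-- The `δ`-derivative of the meeting point is `(tanLenR / sin δ) N'(φ)`, while the `N(φ)`-component
of the `φ`-derivative is `-tanLenL`. The tangential component of the latter drops out of the
determinant. -/
theorem jacobian_mul_visual {z : ℝ × ℝ} (hz : z ∈ tangentDomain) (g : ℝ → ℝ) :
    |(-(tanLenR (supportFn K) z / Real.sin z.1) * Real.sin z.2) *
      (-tanLenL (supportFn K) z * Real.sin z.2 + (supportFn K z.2 +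
        (deriv (supportFn K) (z.2 + z.1) - deriv (supportFn K) z.2 * Real.cos z.1) /
          Real.sin z.1) * Real.cos z.2) -
      (-tanLenL (supportFn K) z * Real.cos z.2 - (supportFn K z.2 +
        (deriv (supportFn K) (z.2 + z.1) - deriv (supportFn K) z.2 * Real.cos z.1) /
          Real.sin z.1) * Real.sin z.2) *
      ((tanLenR (supportFn K) z / Real.sin z.1) * Real.cos z.2)| *
      g (visualAngle K (tangentMeet (supportFn K) z)) =
    tanLenL (supportFn K) z * tanLenR (supportFn K) z / Real.sin z.1 * g (π - z.1) := by
  have hs := sin_pos_of_mem_tangentDomain hz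
  rw [hK.visualAngle_eq hz.1 (gap_tangentMeet_fst K z) (gap_tangentMeet_snd K hs.ne')]
  congr 1
  have hpos : 0 < tanLenL (supportFn K) z * tanLenR (supportFn K) z / Real.sin z.1 :=
    div_pos (mul_pos (hK.tanLenL_pos hz) (hK.tanLenR_pos hz)) hs
  rw [← abs_of_pos hpos]
  congr 1
  have := Real.sin_sq_add_cos_sq z.2
  linear_combination
    (tanLenL (supportFn K) z * tanLenR (supportFn K) z / Real.sin z.1) * this

/-- A function of the visual angle is integrable over the exterior of `K` iff its expression in
the normal angles of the two tangents is. -/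
theorem integrableOn_visualAngle_iff (g : ℝ → ℝ) :
    IntegrableOn (fun P => g (visualAngle K P)) Kᶜ ↔
      IntegrableOn (fun z => tanLenL (supportFn K) z * tanLenR (supportFn K) z / Real.sin z.1 *
        g (π - z.1)) tangentDomain := by
  rw [← hK.tangentMeet_image]
  refine (integrableOn_image_plane_iff measurableSet_tangentDomain
    (fun z hz => hasFDerivAt_tangentMeet_fst hK.hasDerivAt (sin_pos_of_mem_tangentDomain hz).ne')
    (fun z hz => hasFDerivAt_tangentMeet_snd hK.hasDerivAt (sin_pos_of_mem_tangentDomain hz).ne')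
    hK.tangentMeet_injOn _).trans ?_
  exact integrableOn_congr_fun (fun z hz => hK.jacobian_mul_visual hz g)
    measurableSet_tangentDomain

theorem setIntegral_visualAngle (g : ℝ → ℝ) :
    ∫ P in Kᶜ, g (visualAngle K P) =
      ∫ z in tangentDomain, tanLenL (supportFn K) z * tanLenR (supportFn K) z / Real.sin z.1 *
        g (π - z.1) := by
  rw [← hK.tangentMeet_image]
  refine (setIntegral_image_plane measurableSet_tangentDomain
    (fun z hz => hasFDerivAt_tangentMeet_fst hK.hasDerivAt (sin_pos_of_mem_tangentDomain hz).ne')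
    (fun z hz => hasFDerivAt_tangentMeet_snd hK.hasDerivAt (sin_pos_of_mem_tangentDomain hz).ne')
    hK.tangentMeet_injOn _).trans ?_
  exact setIntegral_congr_fun measurableSet_tangentDomain
    (fun z hz => hK.jacobian_mul_visual hz g)

end IsStrictlyConvexC2

/-! ### Integrability over the exterior -/

theorem trig_le_right {h h' h'' : ℝ → ℝ} (d : ∀ x, HasDerivAt h (h' x) x)
    (d' : ∀ x, HasDerivAt h' (h'' x) x) (hpos : ∀ x, 0 ≤ h x + h'' x) {a x : ℝ}
    (hax : a ≤ x) (hx : x ≤ a + π) :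
    h a * Real.cos (x - a) + h' a * Real.sin (x - a) ≤ h x := by
  have := sturm_nonneg (hasDerivAt_sub_trig d (h a) (h' a) a)
    (hasDerivAt_sub_trig d' (h' a) (-h a) a)
    (fun x => by linarith [hpos x]) (a := a) (x := x) (by simp) (by simp) hax hx
  linarith

theorem trig_le_left {h h' h'' : ℝ → ℝ} (d : ∀ x, HasDerivAt h (h' x) x)
    (d' : ∀ x, HasDerivAt h' (h'' x) x) (hpos : ∀ x, 0 ≤ h x + h'' x) {a x : ℝ}
    (hax : x ≤ a) (hx : a - π ≤ x) :
    h a * Real.cos (x - a) + h' a * Real.sin (x - a) ≤ h x := by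
  have := sturm_nonneg_left (hasDerivAt_sub_trig d (h a) (h' a) a)
    (hasDerivAt_sub_trig d' (h' a) (-h a) a)
    (fun x => by linarith [hpos x]) (a := a) (x := x) (by simp) (by simp) hax hx
  linarith

theorem exists_abs_le_of_periodic {f : ℝ → ℝ} (hf : Continuous f)
    (hp : Function.Periodic f (2 * π)) : ∃ M, 0 ≤ M ∧ ∀ x, |f x| ≤ M := by
  obtain ⟨M, hM⟩ := isCompact_Icc.exists_bound_of_continuousOn
    (hf.continuousOn (s := Icc 0 (2 * π)))
  have hpi : (0 : ℝ) < 2 * π := by positivity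
  refine ⟨M, (abs_nonneg _).trans (hM 0 ⟨le_rfl, hpi.le⟩), fun x => ?_⟩
  obtain ⟨y, hy, he⟩ := hp.exists_mem_Ico₀ hpi x
  rw [he]
  exact hM y ⟨hy.1, hy.2.le⟩

/-- The function of the visual angle that is integrated. -/
noncomputable def angleFn (u : ℝ) : ℝ := u - Real.sin u - (2 / 3) * Real.sin u ^ 3

/-- The cubic decay as `ω → 0`, that is as `P` goes to infinity, compensates the factor `1 / sin³ δ`
at `δ = π`. -/
theorem abs_angleFn_le {u : ℝ} (h0 : 0 ≤ u) (hπ : u ≤ π) : |angleFn u| ≤ u ^ 3 := by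
  rcases eq_or_lt_of_le h0 with rfl | h
  · simp [angleFn]
  have h1 := Real.sin_gt_sub_cube h
  have h2 := Real.sin_le h.le
  have h3 := Real.sin_nonneg_of_nonneg_of_le_pi h0 hπ
  have h4 : Real.sin u ^ 3 ≤ u ^ 3 := pow_le_pow_left₀ h3 h2 3
  have h5 : 0 ≤ Real.sin u ^ 3 := pow_nonneg h3 3
  rw [abs_le, angleFn]
  constructor <;> linarith

/-- Jordan's inequality on `[0, π/2]`, carried to the other half by `x ↦ π - x`. -/
theorem mul_sub_le_sin {x : ℝ} (h0 : 0 ≤ x) (hπ : x ≤ π) :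
    x * (π - x) ≤ π ^ 2 / 2 * Real.sin x := by
  have hpi := Real.pi_pos
  have key : ∀ y : ℝ, 0 ≤ y → y ≤ π / 2 → y * (π - y) ≤ π ^ 2 / 2 * Real.sin y := by
    intro y hy hy2
    have h := Real.mul_le_sin hy hy2
    calc y * (π - y) ≤ y * π := by nlinarith
      _ = π ^ 2 / 2 * (2 / π * y) := by field_simp
      _ ≤ _ := by gcongr
  rcases le_total x (π / 2) with h | h
  · exact key x h0 h
  · have := key (π - x) (by linarith) (by linarith)
    rw [Real.sin_pi_sub] at this
    linarith

namespace IsStrictlyConvexC2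

variable {K : Set Plane} (hK : IsStrictlyConvexC2 K)
include hK

theorem exists_curvature_le :
    ∃ M, 0 ≤ M ∧ ∀ φ, supportFn K φ + deriv (deriv (supportFn K)) φ ≤ M := by
  obtain ⟨M, hM, h⟩ := exists_abs_le_of_periodic
    (f := fun φ => supportFn K φ + deriv (deriv (supportFn K)) φ)
    (hK.continuous.add hK.continuous_deriv2) (fun x => by
      simp only [supportFn_periodic K x, deriv_periodic (deriv_periodic (supportFn_periodic K)) x])
  exact ⟨M, hM, fun φ => (le_abs_self _).trans (h φ)⟩

/-- Comparison with a disk of radius `M`: the function `M - p` satisfies the nonstrict Sturm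
hypothesis, so both tangents are at most as long as those of the disk, namely `M (1 - cos δ) / sin
δ`. -/
theorem sin_mul_tanLen_le {M : ℝ}
    (hM : ∀ φ, supportFn K φ + deriv (deriv (supportFn K)) φ ≤ M) {z : ℝ × ℝ}
    (hz : z ∈ tangentDomain) :
    Real.sin z.1 * tanLenL (supportFn K) z ≤ M * (1 - Real.cos z.1) ∧
      Real.sin z.1 * tanLenR (supportFn K) z ≤ M * (1 - Real.cos z.1) := by
  have hs := sin_pos_of_mem_tangentDomain hz
  have d : ∀ x, HasDerivAt (fun t => M - supportFn K t) (-deriv (supportFn K) x) x :=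
    fun x => (hK.hasDerivAt x).const_sub M
  have d' : ∀ x, HasDerivAt (fun t => -deriv (supportFn K) t)
    (-deriv (deriv (supportFn K)) x) x := fun x => (hK.hasDerivAt_deriv x).neg
  constructor
  · have := trig_le_right d d' (fun x => by linarith [hM x]) (a := z.2) (x := z.2 + z.1)
      (by linarith [hz.1.1]) (by linarith [hz.1.2])
    rw [show z.2 + z.1 - z.2 = z.1 by ring] at this
    rw [tanLenL, footDist, mul_sub, mul_div_cancel₀ _ hs.ne']
    linarith
  · have := trig_le_left d d' (fun x => by linarith [hM x]) (a := z.2 + z.1) (x := z.2)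
      (by linarith [hz.1.1]) (by linarith [hz.1.2])
    rw [show z.2 - (z.2 + z.1) = -z.1 by ring, Real.cos_neg, Real.sin_neg] at this
    rw [tanLenR, mul_add, mul_div_cancel₀ _ hs.ne']
    linarith

theorem continuousOn_tangentIntegrand : ContinuousOn (fun z : ℝ × ℝ =>
    tanLenL (supportFn K) z * tanLenR (supportFn K) z / Real.sin z.1 * angleFn (π - z.1))
    tangentDomain := by
  have h0 : ∀ z ∈ tangentDomain, Real.sin z.1 ≠ 0 := fun z hz =>
    (sin_pos_of_mem_tangentDomain hz).ne'
  have hp := hK.continuous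
  have hp' := hK.continuous_deriv
  have hs : ContinuousOn (fun z : ℝ × ℝ => Real.sin z.1) tangentDomain := by fun_prop
  unfold tanLenL tanLenR footDist angleFn
  refine ContinuousOn.mul (ContinuousOn.div (ContinuousOn.mul (ContinuousOn.sub
    (ContinuousOn.div ?_ hs h0) ?_) (ContinuousOn.add (ContinuousOn.div ?_ hs h0) ?_)) hs h0) ?_
  all_goals exact Continuous.continuousOn (by fun_prop)

theorem integrableOn_tangentIntegrand : IntegrableOn (fun z : ℝ × ℝ =>
    tanLenL (supportFn K) z * tanLenR (supportFn K) z / Real.sin z.1 * angleFn (π - z.1))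
    tangentDomain := by
  obtain ⟨M, hM0, hM⟩ := hK.exists_curvature_le
  have hfin : volume tangentDomain < ⊤ := by
    rw [tangentDomain, Measure.volume_eq_prod, Measure.prod_prod, Real.volume_Ioo,
      Real.volume_Ico]
    exact ENNReal.mul_lt_top ENNReal.ofReal_lt_top ENNReal.ofReal_lt_top
  refine IntegrableOn.of_bound hfin
    (hK.continuousOn_tangentIntegrand.aestronglyMeasurable measurableSet_tangentDomain)
    -- Using `1 - cos δ ≤ δ²/2` twice and the cubic bound gives `(M²/4) δ⁴ (π - δ)³ / sin³ δ`.
    -- Regrouped as `δ · (δ (π - δ))³`, it is bounded by `δ ≤ π` and `mul_sub_le_sin`, so the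
    -- integrand is bounded up to both ends of the `δ`-interval.
    (M ^ 2 / 4 * π * (π ^ 2 / 2) ^ 3) ?_
  refine (ae_restrict_iff' measurableSet_tangentDomain).2 (Filter.Eventually.of_forall fun z hz => ?_)
  have hs := sin_pos_of_mem_tangentDomain hz
  obtain ⟨hL, hR⟩ := hK.sin_mul_tanLen_le hM hz
  have hL0 := mul_pos hs (hK.tanLenL_pos hz)
  have hR0 := mul_pos hs (hK.tanLenR_pos hz)
  have hδ0 := hz.1.1
  have hδπ := hz.1.2
  have hg := abs_angleFn_le (u := π - z.1) (by linarith) (by linarith)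
  have hk := mul_sub_le_sin hδ0.le hδπ.le
  have hcos : M * (1 - Real.cos z.1) ≤ M * (z.1 ^ 2 / 2) := by
    gcongr
    linarith [Real.one_sub_sq_div_two_le_cos (x := z.1)]
  set s := Real.sin z.1
  have e : tanLenL (supportFn K) z * tanLenR (supportFn K) z / s =
      (s * tanLenL (supportFn K) z) * (s * tanLenR (supportFn K) z) / s ^ 3 := by
    field_simp
  rw [e, Real.norm_eq_abs, abs_mul, abs_of_pos (div_pos (mul_pos hL0 hR0) (pow_pos hs 3)),
    div_mul_eq_mul_div, div_le_iff₀ (pow_pos hs 3)]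
  calc s * tanLenL (supportFn K) z * (s * tanLenR (supportFn K) z) * |angleFn (π - z.1)|
      ≤ (M * (z.1 ^ 2 / 2)) * (M * (z.1 ^ 2 / 2)) * (π - z.1) ^ 3 :=
        mul_le_mul (mul_le_mul (hL.trans hcos) (hR.trans hcos) hR0.le (by positivity)) hg
          (abs_nonneg _) (by positivity)
    _ = M ^ 2 / 4 * z.1 * (z.1 * (π - z.1)) ^ 3 := by ring
    _ ≤ M ^ 2 / 4 * π * (π ^ 2 / 2 * s) ^ 3 := by
        have : 0 ≤ z.1 * (π - z.1) := mul_nonneg hδ0.le (by linarith)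
        gcongr
    _ = _ := by ring

theorem integrableOn_visualIntegrand : IntegrableOn (visualIntegrand K) Kᶜ :=
  (hK.integrableOn_visualAngle_iff angleFn).2 hK.integrableOn_tangentIntegrand

end IsStrictlyConvexC2

/-! ### Correlation integrals of periodic functions -/

/-- The correlation integral `∫ f(φ) g(φ + δ) dφ` over a period. -/
noncomputable def corr (f g : ℝ → ℝ) (δ : ℝ) : ℝ :=
  ∫ φ in (0 : ℝ)..(2 * π), f φ * g (φ + δ)

theorem continuous_corr {f g : ℝ → ℝ} (hf : Continuous f) (hg : Continuous g) :
    Continuous (corr f g) :=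
  intervalIntegral.continuous_parametric_intervalIntegral_of_continuous' (by fun_prop) _ _

theorem hasDerivAt_corr {f g g' : ℝ → ℝ} (hf : Continuous f) (hg : ∀ x, HasDerivAt g (g' x) x)
    (hg' : Continuous g') (δ : ℝ) : HasDerivAt (corr f g) (corr f g' δ) δ := by
  have hgc : Continuous g := continuous_iff_continuousAt.2 fun x => (hg x).continuousAt
  obtain ⟨C, hC⟩ := (isCompact_Icc (a := (0 : ℝ)) (b := 2 * π)).prod
    (isCompact_closedBall δ 1) |>.exists_bound_of_continuousOn
    (f := fun z : ℝ × ℝ => f z.1 * g' (z.1 + z.2)) (by fun_prop)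
  refine (intervalIntegral.hasDerivAt_integral_of_dominated_loc_of_deriv_le (𝕜 := ℝ)
    (F := fun δ φ => f φ * g (φ + δ)) (F' := fun δ φ => f φ * g' (φ + δ)) (bound := fun _ => C)
    (s := Metric.closedBall δ 1) (Metric.closedBall_mem_nhds δ one_pos)
    (Filter.Eventually.of_forall fun x => Continuous.aestronglyMeasurable (by fun_prop))
    (Continuous.intervalIntegrable (by fun_prop) _ _)
    (Continuous.aestronglyMeasurable (by fun_prop)) ?_ intervalIntegrable_const ?_).2
  · refine Filter.Eventually.of_forall fun t ht x hx => hC (t, x) ⟨?_, hx⟩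
    rw [uIoc_of_le (by positivity)] at ht
    exact ⟨ht.1.le, ht.2⟩
  · refine Filter.Eventually.of_forall fun t _ x _ => ?_
    have := (hg (t + x)).comp x ((hasDerivAt_id' x).const_add t)
    simpa [Function.comp_def] using this.const_mul (f t)

theorem integral_shift {f : ℝ → ℝ} (hp : Function.Periodic f (2 * π)) (δ : ℝ) :
    ∫ φ in (0 : ℝ)..(2 * π), f (φ + δ) = ∫ φ in (0 : ℝ)..(2 * π), f φ := by
  rw [intervalIntegral.integral_comp_add_right, zero_add, add_comm,
    hp.intervalIntegral_add_eq δ 0, zero_add]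

theorem integral_deriv_periodic {f f' : ℝ → ℝ} (hf : ∀ x, HasDerivAt f (f' x) x)
    (hf' : Continuous f') (hp : Function.Periodic f (2 * π)) :
    ∫ φ in (0 : ℝ)..(2 * π), f' φ = 0 := by
  rw [intervalIntegral.integral_eq_sub_of_hasDerivAt (fun x _ => hf x)
    (hf'.intervalIntegrable _ _)]
  have := hp 0
  rw [zero_add] at this
  rw [this, sub_self]

theorem corr_symm {f : ℝ → ℝ} (hp : Function.Periodic f (2 * π)) (δ : ℝ) :
    corr f f (2 * π - δ) = corr f f δ := by
  unfold corr
  rw [← integral_shift (f := fun φ => f φ * f (φ + (2 * π - δ)))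
    (fun x => by
      show f (x + 2 * π) * f (x + 2 * π + (2 * π - δ)) = _
      rw [add_right_comm, hp, hp]) δ]
  congr 1
  ext φ
  rw [show φ + δ + (2 * π - δ) = φ + 2 * π by ring, hp]
  ring

/-- The Fourier transform of an autocorrelation is the power spectrum: after Fubini, write `cos 2δ =
cos (2(δ + φ) - 2φ)` and shift. The symmetry of the correlation under `δ ↦ 2π - δ` makes the
integral over `[0, π]` half of the one over a full period. -/
theorem integral_cos_two_mul_corr {f : ℝ → ℝ} (hf : Continuous f)
    (hp : Function.Periodic f (2 * π)) :
    ∫ δ in (0 : ℝ)..π, Real.cos (2 * δ) * corr f f δ =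
      (1 / 2) * ((∫ φ in (0 : ℝ)..(2 * π), f φ * Real.cos (2 * φ)) ^ 2 +
        (∫ φ in (0 : ℝ)..(2 * π), f φ * Real.sin (2 * φ)) ^ 2) := by
  have hc := continuous_corr hf hf
  have hint : Continuous fun δ => Real.cos (2 * δ) * corr f f δ := by fun_prop
  have hhalf : ∫ δ in (0 : ℝ)..(2 * π), Real.cos (2 * δ) * corr f f δ =
      2 * ∫ δ in (0 : ℝ)..π, Real.cos (2 * δ) * corr f f δ := by
    rw [← intervalIntegral.integral_add_adjacent_intervals (hint.intervalIntegrable 0 π)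
      (hint.intervalIntegrable π (2 * π))]
    have h2 : ∫ δ in π..(2 * π), Real.cos (2 * δ) * corr f f δ =
        ∫ δ in (0 : ℝ)..π, Real.cos (2 * (2 * π - δ)) * corr f f (2 * π - δ) := by
      rw [intervalIntegral.integral_comp_sub_left (fun δ => Real.cos (2 * δ) * corr f f δ)]
      congr 1 <;> ring
    rw [h2]
    have h3 : ∀ δ, Real.cos (2 * (2 * π - δ)) * corr f f (2 * π - δ) =
        Real.cos (2 * δ) * corr f f δ := by
      intro δ
      rw [corr_symm hp, show 2 * (2 * π - δ) = 2 * π - 2 * δ + 2 * π by ring, Real.cos_add_two_pi,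
        Real.cos_two_pi_sub]
    simp only [h3]
    ring
  have hswap : ∫ δ in (0 : ℝ)..(2 * π), Real.cos (2 * δ) * corr f f δ =
      ∫ φ in (0 : ℝ)..(2 * π), ∫ δ in (0 : ℝ)..(2 * π),
        Real.cos (2 * δ) * (f φ * f (φ + δ)) := by
    simp only [corr, ← intervalIntegral.integral_const_mul]
    refine intervalIntegral_intervalIntegral_swap ?_
    exact ((Continuous.continuousOn (by fun_prop)).integrableOn_compact
      (isCompact_uIcc.prod isCompact_uIcc)).mono_set
      (prod_mono uIoc_subset_uIcc uIoc_subset_uIcc)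
  have hinner : ∀ φ, ∫ δ in (0 : ℝ)..(2 * π), Real.cos (2 * δ) * (f φ * f (φ + δ)) =
      (∫ x in (0 : ℝ)..(2 * π), f x * Real.cos (2 * x)) * (f φ * Real.cos (2 * φ)) +
      (∫ x in (0 : ℝ)..(2 * π), f x * Real.sin (2 * x)) * (f φ * Real.sin (2 * φ)) := by
    intro φ
    rw [← intervalIntegral.integral_mul_const, ← intervalIntegral.integral_mul_const,
      ← intervalIntegral.integral_add (Continuous.intervalIntegrable (by fun_prop) _ _)
        (Continuous.intervalIntegrable (by fun_prop) _ _),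
      ← integral_shift (f := fun x => f x * Real.cos (2 * x) * (f φ * Real.cos (2 * φ)) +
        f x * Real.sin (2 * x) * (f φ * Real.sin (2 * φ))) (fun x => ?_) φ]
    · congr 1
      ext δ
      rw [show 2 * δ = 2 * (δ + φ) - 2 * φ by ring, Real.cos_sub, add_comm φ δ]
      ring
    · show f (x + 2 * π) * Real.cos (2 * (x + 2 * π)) * _ +
        f (x + 2 * π) * Real.sin (2 * (x + 2 * π)) * _ = _
      rw [hp, show 2 * (x + 2 * π) = 2 * x + 2 * π + 2 * π by ring, Real.cos_add_two_pi,
        Real.cos_add_two_pi, Real.sin_add_two_pi, Real.sin_add_two_pi]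
  simp only [hinner] at hswap
  rw [intervalIntegral.integral_add (Continuous.intervalIntegrable (by fun_prop) _ _)
        (Continuous.intervalIntegrable (by fun_prop) _ _),
    intervalIntegral.integral_const_mul, intervalIntegral.integral_const_mul] at hswap
  linarith

/-! ### The integral over the exterior -/

section Correlation

variable {p p' p'' : ℝ → ℝ} (hp : ∀ x, HasDerivAt p (p' x) x)
  (hp' : ∀ x, HasDerivAt p' (p'' x) x) (hc : Continuous p'')
  (hper : Function.Periodic p (2 * π))

/-- The reduced correlation `R(δ) - R(0) cos δ`. -/
noncomputable def redCorr (p : ℝ → ℝ) (δ : ℝ) : ℝ := corr p p δ - corr p p 0 * Real.cos δ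

include hp in
theorem continuous_of_hasDerivAt : Continuous p :=
  continuous_iff_continuousAt.2 fun x => (hp x).continuousAt

include hp hp' in
theorem hasDerivAt_redCorr (δ : ℝ) :
    HasDerivAt (redCorr p) (corr p p' δ + corr p p 0 * Real.sin δ) δ := by
  have := (hasDerivAt_corr (continuous_of_hasDerivAt hp) hp (continuous_of_hasDerivAt hp') δ).sub
    ((Real.hasDerivAt_cos δ).const_mul (corr p p 0))
  exact this.congr_deriv (by ring)

include hp hp' hc in
theorem hasDerivAt_redCorr' (δ : ℝ) :
    HasDerivAt (fun δ => corr p p' δ + corr p p 0 * Real.sin δ)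
      (corr p p'' δ + corr p p 0 * Real.cos δ) δ :=
  (hasDerivAt_corr (continuous_of_hasDerivAt hp) hp' hc δ).add
    ((Real.hasDerivAt_sin δ).const_mul (corr p p 0))

include hp hp' hper in
theorem corr_deriv_zero : corr p p' 0 = 0 := by
  have h : ∀ x, HasDerivAt (fun t => p t ^ 2 / 2) (p x * p' x) x := fun x =>
    (((hp x).pow 2).div_const 2).congr_deriv (by norm_num; ring)
  have := integral_deriv_periodic h
    ((continuous_of_hasDerivAt hp).mul (continuous_of_hasDerivAt hp')) (fun x => by simp only [hper x])
  simpa [corr] using this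

include hp hp' hc hper in
/-- The product of the lengths of the two tangents, integrated over all directions. -/
theorem integral_tanLen_mul {δ : ℝ} (hδ : Real.sin δ ≠ 0) (hper' : Function.Periodic p' (2 * π)) :
    ∫ φ in (0 : ℝ)..(2 * π), ((p (φ + δ) - p φ * Real.cos δ) / Real.sin δ - p' φ) *
      ((p φ - p (φ + δ) * Real.cos δ) / Real.sin δ + p' (φ + δ)) =
    corr p p'' δ - 2 * Real.cos δ / Real.sin δ * corr p p' δ +
      ((1 + Real.cos δ ^ 2) * corr p p δ - 2 * Real.cos δ * corr p p 0) / Real.sin δ ^ 2 := by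
  have hpc := continuous_of_hasDerivAt hp
  have hpc' := continuous_of_hasDerivAt hp'
  set s := Real.sin δ
  set c := Real.cos δ
  have hsh : ∀ x, HasDerivAt (fun t => p (t + δ)) (p' (x + δ)) x := fun x =>
    (hp (x + δ)).comp_add_const x δ
  have hsh' : ∀ x, HasDerivAt (fun t => p' (t + δ)) (p'' (x + δ)) x := fun x =>
    (hp' (x + δ)).comp_add_const x δ
  -- The expanded product contains terms which are not correlations of `p` with `p`, `p'` or `p''`.
  -- They are completed to the derivative of this periodic function, which integrates to zero; in
  -- particular `p'(φ) p'(φ + δ)` is traded for `p(φ) p''(φ + δ)`.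
  have hW : ∀ x, HasDerivAt (fun t => p (t + δ) ^ 2 / (2 * s) - p t ^ 2 / (2 * s) +
      c / s * (p t * p (t + δ)) - p t * p' (t + δ))
      (p (x + δ) * p' (x + δ) / s - p x * p' x / s + c / s * (p' x * p (x + δ) +
        p x * p' (x + δ)) - (p' x * p' (x + δ) + p x * p'' (x + δ))) x := fun x =>
    ((((((hsh x).pow 2).div_const (2 * s)).sub (((hp x).pow 2).div_const (2 * s))).add
      (((hp x).mul (hsh x)).const_mul (c / s))).sub ((hp x).mul (hsh' x))).congr_deriv (by
        norm_num; field_simp)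
  have h0 := integral_deriv_periodic hW (by fun_prop) (fun x => by
    simp only [add_right_comm x (2 * π) δ, hper x, hper (x + δ), hper' (x + δ)])
  have hsq : ∫ φ in (0 : ℝ)..(2 * π), p (φ + δ) ^ 2 = corr p p 0 := by
    rw [integral_shift (f := fun x => p x ^ 2) (fun x => by simp only [hper x])]
    simp [corr, sq]
  have hsq0 : ∫ φ in (0 : ℝ)..(2 * π), p φ ^ 2 = corr p p 0 := by
    simp [corr, sq]
  have hexp : ∀ φ, ((p (φ + δ) - p φ * c) / s - p' φ) * ((p φ - p (φ + δ) * c) / s + p' (φ + δ)) =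
      ((1 + c ^ 2) / s ^ 2) * (p φ * p (φ + δ)) + (-(c / s ^ 2)) * p φ ^ 2 +
      (-(c / s ^ 2)) * p (φ + δ) ^ 2 + (-(2 * c / s)) * (p φ * p' (φ + δ)) + p φ * p'' (φ + δ) +
      (p (φ + δ) * p' (φ + δ) / s - p φ * p' φ / s + c / s * (p' φ * p (φ + δ) +
        p φ * p' (φ + δ)) - (p' φ * p' (φ + δ) + p φ * p'' (φ + δ))) := by
    intro φ
    field_simp
    ring
  simp only [hexp]
  rw [intervalIntegral.integral_add, h0, intervalIntegral.integral_add,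
    intervalIntegral.integral_add, intervalIntegral.integral_add, intervalIntegral.integral_add,
    intervalIntegral.integral_const_mul, intervalIntegral.integral_const_mul,
    intervalIntegral.integral_const_mul, intervalIntegral.integral_const_mul, hsq, hsq0]
  · simp only [corr]
    field_simp
    ring
  all_goals exact Continuous.intervalIntegrable (by fun_prop) _ _

end Correlation

/-! ### Derivatives and endpoint limits for the integration by parts -/

theorem hasDerivAt_angleFn_pi_sub (δ : ℝ) :
    HasDerivAt (fun t => angleFn (π - t))
      (-1 - Real.cos δ - 2 * Real.sin δ ^ 2 * Real.cos δ) δ := by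
  have : (fun t => angleFn (π - t)) =
      fun t => π - t - Real.sin t - (2 / 3) * Real.sin t ^ 3 := by
    ext t
    simp [angleFn]
  rw [this]
  exact ((((hasDerivAt_id' δ).const_sub π).sub (Real.hasDerivAt_sin δ)).sub
    (((Real.hasDerivAt_sin δ).pow 3).const_mul (2 / 3))).congr_deriv (by norm_num; ring)

/-- Since `3 - 6 cos² δ = -3 cos 2δ`, the second derivative is `-3 sin δ cos 2δ`. The coefficient
`2/3` in the integrand is the one for which, after division by `sin δ`, no constant term accompanies
`cos 2δ`. -/
theorem hasDerivAt_angleFn_deriv (δ : ℝ) :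
    HasDerivAt (fun t => -1 - Real.cos t - 2 * Real.sin t ^ 2 * Real.cos t)
      (Real.sin δ * (3 - 6 * Real.cos δ ^ 2)) δ := by
  refine (((Real.hasDerivAt_cos δ).const_sub (-1)).sub
    ((((Real.hasDerivAt_sin δ).pow 2).const_mul 2).mul (Real.hasDerivAt_cos δ))).congr_deriv ?_
  have := Real.sin_sq_add_cos_sq δ
  simp
  linear_combination (2 * Real.sin δ) * this

open Filter Topology in
theorem tendsto_div_sin_zero {f f' : ℝ → ℝ} (hf : ∀ x, HasDerivAt f (f' x) x)
    (hf' : Continuous f') (h0 : f 0 = 0) :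
    Tendsto (fun x => f x / Real.sin x) (𝓝[>] 0) (𝓝 (f' 0)) := by
  have hfc := continuous_of_hasDerivAt hf
  have hcos : ∀ᶠ x in 𝓝[>] (0 : ℝ), Real.cos x ≠ 0 :=
    (Real.continuous_cos.continuousAt.eventually_ne (by simp)).filter_mono nhdsWithin_le_nhds
  refine HasDerivAt.lhopital_zero_nhdsGT (Eventually.of_forall hf)
    (Eventually.of_forall Real.hasDerivAt_sin) hcos
    (by simpa [h0] using hfc.continuousAt.tendsto.mono_left (nhdsWithin_le_nhds (a := (0:ℝ))))
    (by
      simpa using Real.continuous_sin.continuousAt.tendsto.mono_left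
        (nhdsWithin_le_nhds (a := (0:ℝ)))) ?_
  have : ContinuousAt (fun x => f' x / Real.cos x) 0 :=
    hf'.continuousAt.div Real.continuous_cos.continuousAt (by simp)
  simpa using this.tendsto.mono_left nhdsWithin_le_nhds

open Filter Topology in
theorem tendsto_div_sin_sq_zero {f f' f'' : ℝ → ℝ} (hf : ∀ x, HasDerivAt f (f' x) x)
    (hf' : ∀ x, HasDerivAt f' (f'' x) x) (hf'' : Continuous f'') (h0 : f 0 = 0) (h0' : f' 0 = 0) :
    Tendsto (fun x => f x / Real.sin x ^ 2) (𝓝[>] 0) (𝓝 (f'' 0 / 2)) := by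
  have hfc := continuous_of_hasDerivAt hf
  have hsc : Continuous fun x => Real.sin x ^ 2 := by fun_prop
  have hne : ∀ᶠ x in 𝓝[>] (0 : ℝ), 2 * Real.sin x * Real.cos x ≠ 0 := by
    have hcos : ∀ᶠ x in 𝓝[>] (0 : ℝ), Real.cos x ≠ 0 :=
      (Real.continuous_cos.continuousAt.eventually_ne (by simp)).filter_mono nhdsWithin_le_nhds
    filter_upwards [hcos, Ioo_mem_nhdsGT Real.pi_pos] with x h1 h2
    exact mul_ne_zero (mul_ne_zero two_ne_zero (Real.sin_pos_of_pos_of_lt_pi h2.1 h2.2).ne') h1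
  refine HasDerivAt.lhopital_zero_nhdsGT (Eventually.of_forall hf)
    (g' := fun x => 2 * Real.sin x * Real.cos x)
    (Eventually.of_forall fun x => by simpa using (Real.hasDerivAt_sin x).fun_pow 2) hne
    (by simpa [h0] using hfc.continuousAt.tendsto.mono_left (nhdsWithin_le_nhds (a := (0:ℝ))))
    (by simpa using hsc.continuousAt.tendsto.mono_left (nhdsWithin_le_nhds (a := (0:ℝ)))) ?_
  have h1 := tendsto_div_sin_zero hf' hf'' h0'
  have h2 : Tendsto (fun x => 2 * Real.cos x) (𝓝[>] 0) (𝓝 2) := by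
    have : Continuous fun x => 2 * Real.cos x := by fun_prop
    simpa using this.continuousAt.tendsto.mono_left (nhdsWithin_le_nhds (a := (0:ℝ)))
  refine (h1.div h2 two_ne_zero).congr fun x => ?_
  simp only [Pi.div_apply, div_div]
  congr 1
  ring

open Filter Topology in
theorem tendsto_angleFn_deriv_div_sin_pi :
    Tendsto (fun x => (-1 - Real.cos x - 2 * Real.sin x ^ 2 * Real.cos x) / Real.sin x)
      (𝓝[<] π) (𝓝 0) := by
  have hcos : ∀ᶠ x in 𝓝[<] π, Real.cos x ≠ 0 :=
    (Real.continuous_cos.continuousAt.eventually_ne (by simp)).filter_mono nhdsWithin_le_nhds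
  have hfc := continuous_of_hasDerivAt hasDerivAt_angleFn_deriv
  refine HasDerivAt.lhopital_zero_nhdsLT (Eventually.of_forall hasDerivAt_angleFn_deriv)
    (Eventually.of_forall Real.hasDerivAt_sin) hcos
    (by simpa using hfc.continuousAt.tendsto.mono_left (nhdsWithin_le_nhds (a := π)))
    (by
      simpa using Real.continuous_sin.continuousAt.tendsto.mono_left
        (nhdsWithin_le_nhds (a := π))) ?_
  have : ContinuousAt (fun x => Real.sin x * (3 - 6 * Real.cos x ^ 2) / Real.cos x) π :=
    ContinuousAt.div (by fun_prop) Real.continuous_cos.continuousAt (by simp)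
  simpa using this.tendsto.mono_left nhdsWithin_le_nhds

open Filter Topology in
theorem tendsto_angleFn_div_sin_sq_pi :
    Tendsto (fun x => angleFn (π - x) / Real.sin x ^ 2) (𝓝[<] π) (𝓝 0) := by
  have hfc := continuous_of_hasDerivAt hasDerivAt_angleFn_pi_sub
  have hsc : Continuous fun x => Real.sin x ^ 2 := by fun_prop
  have hne : ∀ᶠ x in 𝓝[<] π, 2 * Real.sin x * Real.cos x ≠ 0 := by
    have hcos : ∀ᶠ x in 𝓝[<] π, Real.cos x ≠ 0 :=
      (Real.continuous_cos.continuousAt.eventually_ne (by simp)).filter_mono nhdsWithin_le_nhds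
    filter_upwards [hcos, Ioo_mem_nhdsLT Real.pi_pos] with x h1 h2
    exact mul_ne_zero (mul_ne_zero two_ne_zero (Real.sin_pos_of_pos_of_lt_pi h2.1 h2.2).ne') h1
  refine HasDerivAt.lhopital_zero_nhdsLT (Eventually.of_forall hasDerivAt_angleFn_pi_sub)
    (g' := fun x => 2 * Real.sin x * Real.cos x)
    (Eventually.of_forall fun x => by simpa using (Real.hasDerivAt_sin x).fun_pow 2) hne
    (by simpa [angleFn] using hfc.continuousAt.tendsto.mono_left (nhdsWithin_le_nhds (a := π)))
    (by simpa using hsc.continuousAt.tendsto.mono_left (nhdsWithin_le_nhds (a := π))) ?_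
  have h2 : Tendsto (fun x => 2 * Real.cos x) (𝓝[<] π) (𝓝 (-2)) := by
    have : Continuous fun x => 2 * Real.cos x := by fun_prop
    simpa using this.continuousAt.tendsto.mono_left (nhdsWithin_le_nhds (a := π))
  have := tendsto_angleFn_deriv_div_sin_pi.div h2 (by norm_num)
  rw [zero_div] at this
  refine this.congr fun x => ?_
  simp only [Pi.div_apply, div_div]
  congr 1
  ring

section Parts

variable {V V' V'' : ℝ → ℝ} (hV : ∀ x, HasDerivAt V (V' x) x)
  (hV' : ∀ x, HasDerivAt V' (V'' x) x) (hV'' : Continuous V'') (h0 : V 0 = 0) (h0' : V' 0 = 0)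

open Filter Topology in
include hV hV' hV'' h0 h0' in
/-- Integration by parts against the second derivative of `V / sin`. -/
theorem integral_angleFn_mul
    (hint : IntervalIntegrable (fun δ => angleFn (π - δ) * (V'' δ / Real.sin δ -
      2 * V' δ * Real.cos δ / Real.sin δ ^ 2 +
        V δ * (1 + Real.cos δ ^ 2) / Real.sin δ ^ 3)) volume 0 π) :
    ∫ δ in (0 : ℝ)..π, angleFn (π - δ) * (V'' δ / Real.sin δ -
      2 * V' δ * Real.cos δ / Real.sin δ ^ 2 + V δ * (1 + Real.cos δ ^ 2) / Real.sin δ ^ 3) =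
    (∫ δ in (0 : ℝ)..π, (3 - 6 * Real.cos δ ^ 2) * V δ) - π / 2 * V'' 0 := by
  have hVc := continuous_of_hasDerivAt hV
  have hVc' := continuous_of_hasDerivAt hV'
  set J : ℝ → ℝ := fun x => ∫ δ in (0 : ℝ)..x, (3 - 6 * Real.cos δ ^ 2) * V δ with hJ
  have hJd : ∀ x, HasDerivAt J ((3 - 6 * Real.cos x ^ 2) * V x) x := fun x =>
    intervalIntegral.integral_hasDerivAt_right (Continuous.intervalIntegrable (by fun_prop) _ _)
      (Continuous.stronglyMeasurableAtFilter (by fun_prop) _ _) (by fun_prop)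
  have hJc := continuous_of_hasDerivAt hJd
  -- Writing `g` for `angleFn (π - ·)` and `U = V / sin`, the integrand is `g U''` and `H = g U' -
  -- g' U + ∫ g'' U`, where `g'' U` has no singularity left.
  set H : ℝ → ℝ := fun x => angleFn (π - x) * (V' x / Real.sin x -
    V x / Real.sin x ^ 2 * Real.cos x) -
    (-1 - Real.cos x - 2 * Real.sin x ^ 2 * Real.cos x) * (V x / Real.sin x) + J x with hH
  have key := intervalIntegral.integral_eq_sub_of_hasDerivAt_of_tendsto (f := H) Real.pi_pos
    -- At `0`, `g` tends to `π` and `U'` to `V''(0) - V''(0)/2`. At `π` the function `V` need not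
    -- vanish, but `g / sin²` and `g' / sin` tend to zero, so only the integral term survives.
    (fa := π * (V'' 0 - V'' 0 / 2 * 1) - (-2) * V' 0 + 0) (fb := J π) ?_ hint ?_ ?_
  · rw [key, h0']
    ring
  · intro x hx
    have hs : Real.sin x ≠ 0 := (Real.sin_pos_of_pos_of_lt_pi hx.1 hx.2).ne'
    have hsd := Real.hasDerivAt_sin x
    have := (((hasDerivAt_angleFn_pi_sub x).mul (((hV' x).div hsd hs).sub
      (((hV x).div (hsd.pow 2) (pow_ne_zero 2 hs)).mul (Real.hasDerivAt_cos x)))).sub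
      ((hasDerivAt_angleFn_deriv x).mul ((hV x).div hsd hs))).add (hJd x)
    refine this.congr_deriv ?_
    simp
    field_simp
    have hsc := Real.sin_sq_add_cos_sq x
    generalize angleFn (π - x) = g
    generalize Real.sin x = s at *
    generalize Real.cos x = c at *
    linear_combination g * V x * hsc
  · have h1 := tendsto_div_sin_zero hV' hV'' h0'
    have h2 := tendsto_div_sin_sq_zero hV hV' hV'' h0 h0'
    have h3 := tendsto_div_sin_zero hV hVc' h0
    have hc : ∀ {f : ℝ → ℝ}, Continuous f → Tendsto f (𝓝[>] 0) (𝓝 (f 0)) := fun hf =>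
      hf.continuousAt.tendsto.mono_left nhdsWithin_le_nhds
    have hg := hc (continuous_of_hasDerivAt hasDerivAt_angleFn_pi_sub)
    have hg' := hc (continuous_of_hasDerivAt hasDerivAt_angleFn_deriv)
    have hj := hc hJc
    have := ((hg.mul (h1.sub (h2.mul (hc Real.continuous_cos)))).sub (hg'.mul h3)).add hj
    convert this using 2
    simp [hJ, angleFn]
    ring
  · have h1 := tendsto_angleFn_div_sin_sq_pi
    have h2 := tendsto_angleFn_deriv_div_sin_pi
    have hc : ∀ {f : ℝ → ℝ}, Continuous f → Tendsto f (𝓝[<] π) (𝓝 (f π)) := fun hf =>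
      hf.continuousAt.tendsto.mono_left nhdsWithin_le_nhds
    have := ((h1.mul (hc (show Continuous fun x => V' x * Real.sin x - V x * Real.cos x by
      fun_prop))).sub (h2.mul (hc hVc))).add (hc hJc)
    simp only [zero_mul, sub_zero, zero_add] at this
    refine this.congr' ?_
    filter_upwards [Ioo_mem_nhdsLT Real.pi_pos] with x hx
    have hs : Real.sin x ≠ 0 := (Real.sin_pos_of_pos_of_lt_pi hx.1 hx.2).ne'
    simp only [hH]
    field_simp

end Parts

namespace IsStrictlyConvexC2

variable {K : Set Plane} (hK : IsStrictlyConvexC2 K)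
include hK

/-- The bracket is the second derivative of `V / sin` for `V = redCorr p`. Subtracting `R(0) cos δ`
from the correlation makes `V` vanish to second order at `0`, as the boundary terms require. -/
theorem integral_tangentIntegrand_slice {δ : ℝ} (hδ : δ ∈ Ioo 0 π) :
    ∫ φ in Ico 0 (2 * π), tanLenL (supportFn K) (δ, φ) * tanLenR (supportFn K) (δ, φ) /
      Real.sin δ * angleFn (π - δ) =
    angleFn (π - δ) * ((corr (supportFn K) (deriv (deriv (supportFn K))) δ +
        corr (supportFn K) (supportFn K) 0 * Real.cos δ) / Real.sin δ -
      2 * (corr (supportFn K) (deriv (supportFn K)) δ +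
        corr (supportFn K) (supportFn K) 0 * Real.sin δ) * Real.cos δ / Real.sin δ ^ 2 +
      redCorr (supportFn K) δ * (1 + Real.cos δ ^ 2) / Real.sin δ ^ 3) := by
  have hs : Real.sin δ ≠ 0 := (Real.sin_pos_of_pos_of_lt_pi hδ.1 hδ.2).ne'
  have h := integral_tanLen_mul hK.hasDerivAt hK.hasDerivAt_deriv hK.continuous_deriv2
    (supportFn_periodic K) hs (deriv_periodic (supportFn_periodic K))
  rw [integral_Ico_eq_integral_Ioc, ← intervalIntegral.integral_of_le (by positivity),
    intervalIntegral.integral_mul_const, intervalIntegral.integral_div]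
  simp only [tanLenL, tanLenR, footDist]
  rw [h, redCorr]
  field_simp
  linear_combination (angleFn (π - δ) * corr (supportFn K) (supportFn K) 0 * Real.cos δ) *
    Real.sin_sq_add_cos_sq δ

/-- The integral of `ω - sin ω - (2/3) sin³ ω` over the exterior of `K`. -/
theorem integral_visualIntegrand :
    ∫ P in Kᶜ, visualIntegrand K P =
      -(3 / 2) * ((∫ φ in (0 : ℝ)..(2 * π), supportFn K φ * Real.cos (2 * φ)) ^ 2 +
        (∫ φ in (0 : ℝ)..(2 * π), supportFn K φ * Real.sin (2 * φ)) ^ 2) -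
      π / 2 * ∫ φ in (0 : ℝ)..(2 * π),
        supportFn K φ * (supportFn K φ + deriv (deriv (supportFn K)) φ) := by
  have hint := hK.integrableOn_tangentIntegrand
  have hcont := continuous_corr hK.continuous hK.continuous
  rw [tangentDomain, Measure.volume_eq_prod] at hint
  have h1 : ∫ P in Kᶜ, visualIntegrand K P = _ := hK.setIntegral_visualAngle angleFn
  rw [h1, tangentDomain, Measure.volume_eq_prod, setIntegral_prod _ hint,
    setIntegral_congr_fun measurableSet_Ioo fun δ hδ => hK.integral_tangentIntegrand_slice hδ,
    ← integral_Ioc_eq_integral_Ioo, ← intervalIntegral.integral_of_le Real.pi_pos.le,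
    integral_angleFn_mul (hasDerivAt_redCorr hK.hasDerivAt hK.hasDerivAt_deriv)
      (hasDerivAt_redCorr' hK.hasDerivAt hK.hasDerivAt_deriv hK.continuous_deriv2)]
  · have h2 : ∫ δ in (0 : ℝ)..π, (3 - 6 * Real.cos δ ^ 2) * redCorr (supportFn K) δ =
        -3 * ∫ δ in (0 : ℝ)..π, Real.cos (2 * δ) * corr (supportFn K) (supportFn K) δ := by
      have e : ∀ δ, (3 - 6 * Real.cos δ ^ 2) * redCorr (supportFn K) δ =
          -3 * (Real.cos (2 * δ) * corr (supportFn K) (supportFn K) δ) +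
          (-3 * corr (supportFn K) (supportFn K) 0) * (Real.cos δ - 2 * Real.cos δ ^ 3) := by
        intro δ
        rw [redCorr, Real.cos_two_mul]
        ring
      have h3 : ∫ δ in (0 : ℝ)..π, (Real.cos δ - 2 * Real.cos δ ^ 3) = 0 := by
        have hd : ∀ x, HasDerivAt (fun t => 2 / 3 * Real.sin t ^ 3 - Real.sin t)
            (Real.cos x - 2 * Real.cos x ^ 3) x := fun x => by
          refine ((((Real.hasDerivAt_sin x).pow 3).const_mul (2 / 3)).sub
            (Real.hasDerivAt_sin x)).congr_deriv ?_
          norm_num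
          linear_combination (2 * Real.cos x) * Real.sin_sq_add_cos_sq x
        rw [intervalIntegral.integral_eq_sub_of_hasDerivAt (fun x _ => hd x)
          (Continuous.intervalIntegrable (by fun_prop) _ _)]
        simp
      simp only [e]
      rw [intervalIntegral.integral_add (Continuous.intervalIntegrable (by fun_prop) _ _)
        (Continuous.intervalIntegrable (by fun_prop) _ _), intervalIntegral.integral_const_mul,
        intervalIntegral.integral_const_mul, h3]
      ring
    rw [h2, integral_cos_two_mul_corr hK.continuous (supportFn_periodic K)]
    have hp := hK.continuous
    have hp2 := hK.continuous_deriv2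
    have h4 : corr (supportFn K) (deriv (deriv (supportFn K))) 0 +
        corr (supportFn K) (supportFn K) 0 * Real.cos 0 = ∫ φ in (0 : ℝ)..(2 * π),
          supportFn K φ * (supportFn K φ + deriv (deriv (supportFn K)) φ) := by
      simp only [corr, add_zero, Real.cos_zero, mul_one]
      rw [← intervalIntegral.integral_add (Continuous.intervalIntegrable (by fun_prop) _ _)
        (Continuous.intervalIntegrable (by fun_prop) _ _)]
      congr 1
      ext φ
      ring
    rw [h4]
    ring
  · exact (continuous_corr hK.continuous hK.continuous_deriv2).add
      (continuous_const.mul Real.continuous_cos)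
  · simp [redCorr]
  · simp [corr_deriv_zero hK.hasDerivAt hK.hasDerivAt_deriv (supportFn_periodic K)]
  · rw [intervalIntegrable_iff_integrableOn_Ioo_of_le Real.pi_pos.le]
    -- Integrability of the slices in `δ` comes from Fubini, so the three singular quotients need
    -- not be estimated separately.
    rw [IntegrableOn, ← Measure.prod_restrict] at hint
    refine IntegrableOn.congr_fun (hint.integral_prod_left) (fun δ hδ => ?_) measurableSet_Ioo
    exact hK.integral_tangentIntegrand_slice hδ

end IsStrictlyConvexC2

/-! ### Frontier and area -/

theorem hasDerivAt_envelope_fst {f f' : ℝ → ℝ} (hf : ∀ x, HasDerivAt f (deriv f x) x)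
    (hf' : ∀ x, HasDerivAt (deriv f) (f' x) x) (t : ℝ) :
    HasDerivAt (fun s => envelope f s 0) (-(f t + f' t) * Real.sin t) t := by
  have h := ((hf t).mul (Real.hasDerivAt_cos t)).add ((hf' t).mul (Real.hasDerivAt_sin t).neg)
  have e : (fun s => envelope f s 0) = (f * Real.cos + deriv f * -Real.sin) := by
    funext s
    simp [envelope, normalVec, tangentVec]
  rw [e]
  exact h.congr_deriv (by simp; ring)

theorem hasDerivAt_envelope_snd {f f' : ℝ → ℝ} (hf : ∀ x, HasDerivAt f (deriv f x) x)
    (hf' : ∀ x, HasDerivAt (deriv f) (f' x) x) (t : ℝ) :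
    HasDerivAt (fun s => envelope f s 1) ((f t + f' t) * Real.cos t) t := by
  have h := ((hf t).mul (Real.hasDerivAt_sin t)).add ((hf' t).mul (Real.hasDerivAt_cos t))
  have e : (fun s => envelope f s 1) = (f * Real.sin + deriv f * Real.cos) := by
    funext s
    simp [envelope, normalVec, tangentVec]
  rw [e]
  exact h.congr_deriv (by ring)

namespace IsStrictlyConvexC2

variable {K : Set Plane} (hK : IsStrictlyConvexC2 K)
include hK

/-- By compactness of a period `gap` has a positive minimum, and the ball of that radius about `x`
lies in every supporting half-plane. -/
theorem mem_interior_of_gap_pos {x : Plane} (h : ∀ φ, 0 < gap K x φ) : x ∈ interior K := by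
  have hcont : Continuous (gap K x) :=
    continuous_iff_continuousAt.2 fun φ => (hK.hasDerivAt_gap x φ).continuousAt
  have hpi : (0 : ℝ) < 2 * π := by positivity
  obtain ⟨φ₀, -, hmin⟩ := isCompact_Icc.exists_isMinOn (nonempty_Icc.2 hpi.le)
    (hcont.continuousOn (s := Icc 0 (2 * π)))
  rw [mem_interior_iff_mem_nhds, Metric.mem_nhds_iff]
  refine ⟨gap K x φ₀, h φ₀, fun y hy => (hK.mem_iff_gap y).2 fun φ => ?_⟩
  have h1 : gap K x φ₀ ≤ gap K x φ := by
    obtain ⟨ψ, hψ, he⟩ := (gap_periodic K x).exists_mem_Ico₀ hpi φ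
    rw [he]
    exact hmin ⟨hψ.1, hψ.2.le⟩
  have h2 : inner ℝ (y - x) (normalVec φ) ≤ ‖y - x‖ := by
    simpa [norm_normalVec] using real_inner_le_norm (y - x) (normalVec φ)
  rw [inner_sub_left] at h2
  rw [Metric.mem_ball, dist_eq_norm] at hy
  unfold gap at *
  linarith

theorem exists_eq_envelope {x : Plane} (hx : x ∈ K) (hi : x ∉ interior K) :
    ∃ φ ∈ Ico 0 (2 * π), x = envelope (supportFn K) φ := by
  by_contra! hcon
  refine hi (hK.mem_interior_of_gap_pos fun φ => ?_)
  refine lt_of_le_of_ne ((hK.mem_iff_gap x).1 hx φ) fun h0 => ?_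
  have hpi : (0 : ℝ) < 2 * π := by positivity
  obtain ⟨ψ, hψ, he⟩ := (gap_periodic K x).exists_mem_Ico₀ hpi φ
  rw [he] at h0
  exact hcon ψ hψ (hK.eq_envelope hx (by unfold gap at h0; linarith))

theorem envelope_notMem_interior (φ : ℝ) : envelope (supportFn K) φ ∉ interior K := by
  intro h
  rw [mem_interior_iff_mem_nhds, Metric.mem_nhds_iff] at h
  obtain ⟨ε, hε, hb⟩ := h
  have hy : envelope (supportFn K) φ + (ε / 2) • normalVec φ ∈ K := by
    apply hb
    rw [Metric.mem_ball, dist_eq_norm, add_sub_cancel_left, norm_smul, norm_normalVec,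
      Real.norm_eq_abs, abs_of_pos (by linarith)]
    linarith
  have := inner_le_supportFn hK.isCompact hy φ
  rw [inner_add_left, inner_envelope_normalVec, real_inner_smul_left, real_inner_self_eq_norm_sq,
    norm_normalVec] at this
  simp at this
  linarith

theorem frontier_eq : frontier K = range (envelope (supportFn K)) := by
  rw [hK.isCompact.isClosed.frontier_eq]
  ext x
  constructor
  · rintro ⟨hx, hi⟩
    obtain ⟨φ, -, rfl⟩ := hK.exists_eq_envelope hx hi
    exact mem_range_self φ
  · rintro ⟨φ, rfl⟩
    exact ⟨hK.envelope_mem φ, hK.envelope_notMem_interior φ⟩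

/-- Every point of `K` other than `c` lies on a segment from `c` to the boundary. -/
theorem exists_smul_eq {c x : Plane} (hx : x ∈ K) (hne : x ≠ c) :
    ∃ r ∈ Ioc (0 : ℝ) 1, ∃ φ ∈ Ico 0 (2 * π),
      x = c + r • (envelope (supportFn K) φ - c) := by
  set v := x - c with hv
  have hv0 : 0 < ‖v‖ := norm_pos_iff.2 (sub_ne_zero.2 hne)
  have hcont : Continuous fun l : ℝ => c + l • v := by fun_prop
  obtain ⟨R, hR⟩ := hK.isCompact.isBounded.subset_closedBall c
  have hcomp : IsCompact ((fun l : ℝ => c + l • v) ⁻¹' K) := by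
    refine (isCompact_closedBall (0 : ℝ) (R / ‖v‖)).of_isClosed_subset
      (hK.isCompact.isClosed.preimage hcont) fun l hl => ?_
    have := hR hl
    rw [mem_closedBall_iff_norm, add_sub_cancel_left, norm_smul] at this
    rwa [mem_closedBall_zero_iff, le_div_iff₀ hv0]
  have h1 : (1 : ℝ) ∈ (fun l : ℝ => c + l • v) ⁻¹' K := by
    simpa [hv] using hx
  -- The largest `l` with `c + l v` in `K` is the exit point of the ray; it is at least `1`, and its
  -- inverse is the required factor.
  obtain ⟨l, hl, hmax⟩ := hcomp.exists_isMaxOn ⟨1, h1⟩ continuousOn_id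
  have hl1 : 1 ≤ l := hmax h1
  have hi : c + l • v ∉ interior K := by
    intro hi
    have hnh : ∀ᶠ t in nhds l, c + t • v ∈ K :=
      hcont.continuousAt.eventually_mem (mem_interior_iff_mem_nhds.1 hi)
    obtain ⟨ε, hε, hb⟩ := Metric.eventually_nhds_iff.1 hnh
    have : l + ε / 2 ≤ l := hmax (hb (y := l + ε / 2) (by
      rw [Real.dist_eq, add_sub_cancel_left, abs_of_pos (by linarith)]; linarith))
    linarith
  obtain ⟨φ, hφ, he⟩ := hK.exists_eq_envelope hl hi
  refine ⟨l⁻¹, ⟨by positivity, inv_le_one_of_one_le₀ hl1⟩, φ, hφ, ?_⟩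
  rw [← he, add_sub_cancel_left, smul_smul, inv_mul_cancel₀ (by positivity), one_smul, hv]
  abel

/-- The area of `K` in terms of the support function. -/
theorem area_eq : area K = (1 / 2) * ∫ φ in (0 : ℝ)..(2 * π),
    supportFn K φ * (supportFn K φ + deriv (deriv (supportFn K)) φ) := by
  set p := supportFn K with hp
  set γ := envelope p with hγ
  set ρ : ℝ → ℝ := fun φ => p φ + deriv (deriv p) φ with hρ
  -- The set `K` minus `γ 0` is swept by the chords from the boundary point `γ 0`, the pair `(r, φ)`
  -- going to `γ 0 + r (γ φ - γ 0)`. The angle `0`, whose chord is degenerate, is excluded.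
  set S : Set (ℝ × ℝ) := Ioc 0 1 ×ˢ Ioo 0 (2 * π) with hSdef
  have hS : MeasurableSet S := measurableSet_Ioc.prod measurableSet_Ioo
  have hpi : (0 : ℝ) < 2 * π := by positivity
  have hd : ∀ i : Fin 2, ∀ g' : ℝ → ℝ, (∀ t, HasDerivAt (fun s => γ s i) (g' t) t) →
      ∀ z ∈ S, HasFDerivAt (fun z : ℝ × ℝ => γ 0 i + z.1 * (γ z.2 i - γ 0 i))
        ((γ z.2 i - γ 0 i) • ContinuousLinearMap.fst ℝ ℝ ℝ +
          (z.1 * g' z.2) • ContinuousLinearMap.snd ℝ ℝ ℝ) z := by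
    intro i g' hg z _
    have h1 : HasFDerivAt (fun z : ℝ × ℝ => z.1) (ContinuousLinearMap.fst ℝ ℝ ℝ) z :=
      hasFDerivAt_fst
    have h2 : HasFDerivAt (fun z : ℝ × ℝ => z.2) (ContinuousLinearMap.snd ℝ ℝ ℝ) z :=
      hasFDerivAt_snd
    have h3 := (hg z.2).comp_hasFDerivAt z h2
    refine ((h1.mul (h3.sub_const (γ 0 i))).const_add (γ 0 i)).congr_fderiv ?_
    ext <;> simp
  have hX := hd 0 _ (hasDerivAt_envelope_fst hK.hasDerivAt hK.hasDerivAt_deriv)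
  have hY := hd 1 _ (hasDerivAt_envelope_snd hK.hasDerivAt hK.hasDerivAt_deriv)
  have hmap : ∀ z : ℝ × ℝ, (!₂[γ 0 0 + z.1 * (γ z.2 0 - γ 0 0),
      γ 0 1 + z.1 * (γ z.2 1 - γ 0 1)] : Plane) = γ 0 + z.1 • (γ z.2 - γ 0) := by
    intro z
    ext i
    fin_cases i <;> simp
  have hgpos : ∀ φ ∈ Ioo 0 (2 * π), 0 < gap K (γ 0) φ := fun φ hφ =>
    hK.gap_envelope_pos (a := 0) (by rwa [zero_add])
  have hgn : ∀ φ ψ, gap K (γ ψ) φ = gap K (γ 0) φ - inner ℝ (γ ψ - γ 0) (normalVec φ) := by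
    intro φ ψ
    rw [inner_sub_left, gap, gap]
    ring
  -- Pair both sides with `N(φ')`: among the boundary points, `γ φ'` is extreme in that direction,
  -- and `γ 0` lies strictly below it by `hgpos`. Exchanging the roles gives `r = r'`.
  have hle : ∀ r r' φ φ' : ℝ, 0 < r → 0 < r' → φ' ∈ Ioo 0 (2 * π) →
      r • (γ φ - γ 0) = r' • (γ φ' - γ 0) → r' ≤ r := by
    intro r r' φ φ' hr hr' hφ' he
    have h1 := (hK.mem_iff_gap _).1 (hK.envelope_mem φ) φ'
    have h2 := (eq_envelope_iff (K := K) (P := γ φ') (φ := φ')).1 rfl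
    have h3 := hgpos φ' hφ'
    have h4 := congrArg (fun x => inner ℝ x (normalVec φ')) he
    simp only [real_inner_smul_left] at h4
    rw [← hp, ← hγ, hgn] at h1
    rw [hgn] at h2
    nlinarith [h2.1]
  have hinj : InjOn (fun z : ℝ × ℝ => (!₂[γ 0 0 + z.1 * (γ z.2 0 - γ 0 0),
      γ 0 1 + z.1 * (γ z.2 1 - γ 0 1)] : Plane)) S := by
    rintro ⟨r, φ⟩ hz ⟨r', φ'⟩ hw he
    have he : r • (γ φ - γ 0) = r' • (γ φ' - γ 0) :=
      add_left_cancel ((hmap (r, φ)).symm.trans (he.trans (hmap (r', φ'))))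
    have hr : r = r' := le_antisymm (hle _ _ _ _ hw.1.1 hz.1.1 hz.2 he.symm)
      (hle _ _ _ _ hz.1.1 hw.1.1 hw.2 he)
    subst hr
    have he := sub_left_injective (smul_right_injective _ hz.1.1.ne' he)
    have := hK.envelope_injOn 0 (by rw [zero_add]; exact ⟨hz.2.1.le, hz.2.2⟩)
      (by rw [zero_add]; exact ⟨hw.2.1.le, hw.2.2⟩) he
    rw [this]
  have himg : (fun z : ℝ × ℝ => (!₂[γ 0 0 + z.1 * (γ z.2 0 - γ 0 0),
      γ 0 1 + z.1 * (γ z.2 1 - γ 0 1)] : Plane)) '' S = K \ {γ 0} := by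
    ext x
    simp only [hmap]
    constructor
    · rintro ⟨⟨r, φ⟩, hz, rfl⟩
      refine ⟨hK.convex.add_smul_sub_mem (hK.envelope_mem 0) (hK.envelope_mem φ)
        ⟨hz.1.1.le, hz.1.2⟩, fun h0 => ?_⟩
      simp only [mem_singleton_iff, add_eq_left, smul_eq_zero] at h0
      rcases h0 with h0 | h0
      · exact hz.1.1.ne' h0
      · have := hK.envelope_injOn 0 (by rw [zero_add]; exact ⟨hz.2.1.le, hz.2.2⟩)
          (by rw [zero_add]; exact ⟨le_rfl, hpi⟩) (sub_eq_zero.1 h0)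
        exact hz.2.1.ne' this
    · rintro ⟨hx, hne⟩
      obtain ⟨r, hr, φ, hφ, rfl⟩ := hK.exists_smul_eq hx hne
      refine ⟨(r, φ), ⟨hr, lt_of_le_of_ne hφ.1 ?_, hφ.2⟩, rfl⟩
      rintro rfl
      simp [hγ, hp] at hne
  have hvol : area K = ∫ _ in K \ {γ 0}, (1 : ℝ) := by
    rw [setIntegral_const, smul_eq_mul, mul_one, Measure.real,
      measure_sdiff_null (measure_singleton _), area]
  rw [hvol, ← himg, setIntegral_image_plane hS hX hY hinj (fun _ => 1)]
  have hjac : ∀ z ∈ S, |(γ z.2 0 - γ 0 0) * (z.1 * ((p z.2 + deriv (deriv p) z.2) *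
      Real.cos z.2)) - z.1 * (-(p z.2 + deriv (deriv p) z.2) * Real.sin z.2) *
        (γ z.2 1 - γ 0 1)| * 1 = z.1 * (ρ z.2 * gap K (γ 0) z.2) := by
    intro z hz
    have h1 : 0 < z.1 * (ρ z.2 * gap K (γ 0) z.2) :=
      mul_pos hz.1.1 (mul_pos (hK.curvature_pos _) (hgpos _ hz.2))
    rw [mul_one, ← abs_of_pos h1]
    congr 1
    have h2 := (eq_envelope_iff (K := K) (P := γ z.2) (φ := z.2)).1 rfl
    rw [hgn, inner_normalVec] at h2
    simp only [PiLp.sub_apply] at h2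
    rw [sub_eq_zero.1 h2.1]
    simp only [hρ]
    ring
  rw [setIntegral_congr_fun hS hjac, hSdef, Measure.volume_eq_prod,
    setIntegral_prod_mul (fun r : ℝ => r) (fun φ => ρ φ * gap K (γ 0) φ)]
  rw [← intervalIntegral.integral_of_le zero_le_one, integral_id, ← integral_Ioc_eq_integral_Ioo,
    ← intervalIntegral.integral_of_le hpi.le]
  have hpc := hK.continuous
  have hpc2 := hK.continuous_deriv2
  have hnc : Continuous fun φ => inner ℝ (γ 0) (normalVec φ) :=
    continuous_of_hasDerivAt (hasDerivAt_inner_normalVec (γ 0))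
  -- The closing condition of the boundary curve; it makes the area formula independent of the base
  -- point `γ 0`.
  have hlin : ∫ φ in (0 : ℝ)..(2 * π), ρ φ * inner ℝ (γ 0) (normalVec φ) = 0 := by
    have h1 : ∀ x, HasDerivAt (fun t => deriv p t * inner ℝ (γ 0) (normalVec t) -
        p t * inner ℝ (γ 0) (tangentVec t)) (ρ x * inner ℝ (γ 0) (normalVec x)) x := fun x =>
      (((hK.hasDerivAt_deriv x).mul (hasDerivAt_inner_normalVec (γ 0) x)).sub
        ((hK.hasDerivAt x).mul (hasDerivAt_inner_tangentVec (γ 0) x))).congr_deriv (by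
          simp only [hρ]; ring)
    refine integral_deriv_periodic h1 (by fun_prop) fun x => ?_
    simp only [normalVec_periodic x, tangentVec_periodic x, supportFn_periodic K x, hp,
      deriv_periodic (supportFn_periodic K) x]
  have hsplit : ∫ φ in (0 : ℝ)..(2 * π), ρ φ * gap K (γ 0) φ =
      (∫ φ in (0 : ℝ)..(2 * π), p φ * ρ φ) -
        ∫ φ in (0 : ℝ)..(2 * π), ρ φ * inner ℝ (γ 0) (normalVec φ) := by
    rw [← intervalIntegral.integral_sub (Continuous.intervalIntegrable (by fun_prop) _ _)
      (Continuous.intervalIntegrable (by fun_prop) _ _)]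
    congr 1
    ext φ
    simp only [gap, hp]
    ring
  rw [hsplit, hlin, sub_zero]
  norm_num
  rfl

/-- The length of the boundary in terms of the support function. -/
theorem boundaryLength_eq : boundaryLength K = ∫ φ in (0 : ℝ)..(2 * π), supportFn K φ := by
  have hd : ∀ φ, ‖deriv (envelope (supportFn K)) φ‖ =
      supportFn K φ + deriv (deriv (supportFn K)) φ := by
    intro φ
    have h : HasDerivAt (envelope (supportFn K))
        ((supportFn K φ + deriv (deriv (supportFn K)) φ) • tangentVec φ) φ := by
      rw [← hasDerivWithinAt_univ, hasDerivWithinAt_iff_hasFDerivWithinAt,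
        hasFDerivWithinAt_euclidean]
      intro i
      rw [hasFDerivWithinAt_univ]
      fin_cases i
      · refine (hasDerivAt_envelope_fst hK.hasDerivAt hK.hasDerivAt_deriv φ).hasFDerivAt.congr_fderiv ?_
        ext
        simp [tangentVec]
        ring
      · refine (hasDerivAt_envelope_snd hK.hasDerivAt hK.hasDerivAt_deriv φ).hasFDerivAt.congr_fderiv ?_
        ext
        simp [tangentVec]
    rw [h.deriv, norm_smul, norm_tangentVec, mul_one, Real.norm_eq_abs,
      abs_of_pos (hK.curvature_pos φ)]
  have hp := hK.continuous
  have hp2 := hK.continuous_deriv2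
  rw [boundaryLength]
  simp only [hd]
  rw [intervalIntegral.integral_add (Continuous.intervalIntegrable (by fun_prop) _ _)
    (Continuous.intervalIntegrable (by fun_prop) _ _),
    integral_deriv_periodic hK.hasDerivAt_deriv hp2 (deriv_periodic (supportFn_periodic K)),
    add_zero]

end IsStrictlyConvexC2

/-! ### Fourier coefficients -/

/-- The cosine integral `∫ f(x) cos(n x) dx` over a period. -/
noncomputable def cosCoeff (f : ℝ → ℝ) (n : ℤ) : ℝ :=
  ∫ x in (0 : ℝ)..(2 * π), f x * Real.cos (n * x)

/-- The sine integral `∫ f(x) sin(n x) dx` over a period. -/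
noncomputable def sinCoeff (f : ℝ → ℝ) (n : ℤ) : ℝ :=
  ∫ x in (0 : ℝ)..(2 * π), f x * Real.sin (n * x)

theorem cosCoeff_neg (f : ℝ → ℝ) (n : ℤ) : cosCoeff f (-n) = cosCoeff f n := by
  simp [cosCoeff]

theorem sinCoeff_neg (f : ℝ → ℝ) (n : ℤ) : sinCoeff f (-n) = -sinCoeff f n := by
  simp [sinCoeff]

theorem periodic_cos_int_mul (n : ℤ) : Function.Periodic (fun x => Real.cos (n * x)) (2 * π) := by
  intro x
  simp only [mul_add, Real.cos_add_int_mul_two_pi]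

theorem periodic_sin_int_mul (n : ℤ) : Function.Periodic (fun x => Real.sin (n * x)) (2 * π) := by
  intro x
  simp only [mul_add, Real.sin_add_int_mul_two_pi]

theorem hasDerivAt_cos_mul (n x : ℝ) :
    HasDerivAt (fun t => Real.cos (n * t)) (-(n * Real.sin (n * x))) x :=
  ((hasDerivAt_id' x).const_mul n).cos.congr_deriv (by ring)

theorem hasDerivAt_sin_mul (n x : ℝ) :
    HasDerivAt (fun t => Real.sin (n * t)) (n * Real.cos (n * x)) x :=
  ((hasDerivAt_id' x).const_mul n).sin.congr_deriv (by ring)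

section Derivative

variable {f f' : ℝ → ℝ} (hf : ∀ x, HasDerivAt f (f' x) x) (hf' : Continuous f')
  (hp : Function.Periodic f (2 * π))
include hf hf' hp

theorem cosCoeff_deriv (n : ℤ) : cosCoeff f' n = n * sinCoeff f n := by
  have hfc := continuous_of_hasDerivAt hf
  have h := integral_deriv_periodic (fun x => (hf x).mul (hasDerivAt_cos_mul n x))
    (by fun_prop) (hp.mul (periodic_cos_int_mul n))
  rw [intervalIntegral.integral_add (Continuous.intervalIntegrable (by fun_prop) _ _)
    (Continuous.intervalIntegrable (by fun_prop) _ _)] at h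
  have e : ∀ x, f x * -(n * Real.sin (n * x)) = (-(n : ℝ)) * (f x * Real.sin (n * x)) := fun x => by
    ring
  simp only [e, intervalIntegral.integral_const_mul] at h
  rw [cosCoeff, sinCoeff]
  linarith

theorem sinCoeff_deriv (n : ℤ) : sinCoeff f' n = -n * cosCoeff f n := by
  have hfc := continuous_of_hasDerivAt hf
  have h := integral_deriv_periodic (fun x => (hf x).mul (hasDerivAt_sin_mul n x))
    (by fun_prop) (hp.mul (periodic_sin_int_mul n))
  rw [intervalIntegral.integral_add (Continuous.intervalIntegrable (by fun_prop) _ _)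
    (Continuous.intervalIntegrable (by fun_prop) _ _)] at h
  have e : ∀ x, f x * (n * Real.cos (n * x)) = (n : ℝ) * (f x * Real.cos (n * x)) := fun x => by
    ring
  simp only [e, intervalIntegral.integral_const_mul] at h
  rw [cosCoeff, sinCoeff]
  linarith

theorem sq_coeff_deriv (n : ℤ) : cosCoeff f' n ^ 2 + sinCoeff f' n ^ 2 =
    n ^ 2 * (cosCoeff f n ^ 2 + sinCoeff f n ^ 2) := by
  rw [cosCoeff_deriv hf hf' hp, sinCoeff_deriv hf hf' hp]
  ring

end Derivative

/-- The coefficients of a trigonometric monomial of frequency `k` vanish at `n ≠ ± k`. -/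
theorem coeff_trig_eq_zero (a b : ℝ) (k n : ℤ) (h : (n : ℝ) ^ 2 ≠ (k : ℝ) ^ 2) :
    cosCoeff (fun x => a * Real.cos (k * x) + b * Real.sin (k * x)) n = 0 ∧
      sinCoeff (fun x => a * Real.cos (k * x) + b * Real.sin (k * x)) n = 0 := by
  have d : ∀ a b x : ℝ, HasDerivAt (fun x => a * Real.cos (k * x) + b * Real.sin (k * x))
      ((k * b) * Real.cos (k * x) + (-(k * a)) * Real.sin (k * x)) x := fun a b x =>
    (((hasDerivAt_cos_mul k x).const_mul a).add
      ((hasDerivAt_sin_mul k x).const_mul b)).congr_deriv (by ring)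
  have hper : ∀ a b : ℝ, Function.Periodic
      (fun x => a * Real.cos (k * x) + b * Real.sin (k * x)) (2 * π) := fun a b x => by
    have h1 := periodic_cos_int_mul k x
    have h2 := periodic_sin_int_mul k x
    simp only at h1 h2 ⊢
    rw [h1, h2]
  -- Differentiating twice multiplies the monomial by `-k²` and its `n`-th coefficients by `-n²`, so
  -- `n² - k²` times each coefficient is zero.
  have h1 := cosCoeff_deriv (d a b) (by fun_prop) (hper a b) n
  have h2 := sinCoeff_deriv (d a b) (by fun_prop) (hper a b) n
  have h3 := cosCoeff_deriv (d (k * b) (-(k * a))) (by fun_prop) (hper _ _) n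
  have h4 := sinCoeff_deriv (d (k * b) (-(k * a))) (by fun_prop) (hper _ _) n
  have e : (fun x => (k * -(k * a)) * Real.cos (k * x) + (-(k * (k * b))) * Real.sin (k * x)) =
      fun x : ℝ => (-(k : ℝ) ^ 2) * (a * Real.cos (k * x) + b * Real.sin (k * x)) := by
    ext x; ring
  rw [e, h2] at h3
  rw [e, h1] at h4
  have hc : ∀ (r : ℝ) (f : ℝ → ℝ), cosCoeff (fun x => r * f x) n = r * cosCoeff f n := fun r f => by
    simp only [cosCoeff, mul_assoc, intervalIntegral.integral_const_mul]
  have hs : ∀ (r : ℝ) (f : ℝ → ℝ), sinCoeff (fun x => r * f x) n = r * sinCoeff f n := fun r f => by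
    simp only [sinCoeff, mul_assoc, intervalIntegral.integral_const_mul]
  rw [hc] at h3
  rw [hs] at h4
  have hne := sub_ne_zero.2 h
  constructor
  · apply mul_left_cancel₀ hne
    linear_combination h3
  · apply mul_left_cancel₀ hne
    linear_combination h4

theorem coeff_add {f g : ℝ → ℝ} (hf : Continuous f) (hg : Continuous g) (n : ℤ) :
    cosCoeff (fun x => f x + g x) n = cosCoeff f n + cosCoeff g n ∧
      sinCoeff (fun x => f x + g x) n = sinCoeff f n + sinCoeff g n := by
  simp only [cosCoeff, sinCoeff, add_mul]
  exact ⟨intervalIntegral.integral_add (Continuous.intervalIntegrable (by fun_prop) _ _)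
    (Continuous.intervalIntegrable (by fun_prop) _ _),
    intervalIntegral.integral_add (Continuous.intervalIntegrable (by fun_prop) _ _)
    (Continuous.intervalIntegrable (by fun_prop) _ _)⟩

theorem fourier_apply_eq {T : ℝ} (hT : T = 2 * π) (n : ℤ) (x : ℝ) :
    fourier n (x : AddCircle T) = (Real.cos (n * x) : ℂ) + Real.sin (n * x) * Complex.I := by
  subst hT
  rw [fourier_coe_apply, show 2 * (π : ℂ) * Complex.I * n * x / ((2 * π : ℝ) : ℂ) =
    ((n * x : ℝ) : ℂ) * Complex.I by
      have : (π : ℂ) ≠ 0 := by exact_mod_cast Real.pi_ne_zero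
      push_cast
      field_simp, Complex.exp_mul_I]
  push_cast
  rfl

theorem integral_fourier_eq {T : ℝ} (hT : T = 2 * π) {f : ℝ → ℝ} (hf : Continuous f) (n : ℤ) :
    ∫ x in (0 : ℝ)..(2 * π), fourier (-n) (x : AddCircle T) • (f x : ℂ) =
      (cosCoeff f n : ℂ) - sinCoeff f n * Complex.I := by
  have e : ∀ x : ℝ, fourier (-n) (x : AddCircle T) • (f x : ℂ) =
      ((f x * Real.cos (n * x) : ℝ) : ℂ) - ((f x * Real.sin (n * x) : ℝ) : ℂ) * Complex.I := by
    intro x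
    rw [fourier_apply_eq hT]
    push_cast
    rw [neg_mul, Complex.cos_neg, Complex.sin_neg, smul_eq_mul]
    ring
  simp only [e]
  rw [intervalIntegral.integral_sub (Continuous.intervalIntegrable (by fun_prop) _ _)
    (Continuous.intervalIntegrable (by fun_prop) _ _), intervalIntegral.integral_mul_const,
    intervalIntegral.integral_ofReal, intervalIntegral.integral_ofReal]
  rfl

/-- Parseval's identity. -/
theorem hasSum_sq_coeff {f : ℝ → ℝ} (hf : Continuous f) :
    HasSum (fun n : ℤ => cosCoeff f n ^ 2 + sinCoeff f n ^ 2)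
      (2 * π * ∫ x in (0 : ℝ)..(2 * π), f x ^ 2) := by
  have hpi : (0 : ℝ) < 2 * π := by positivity
  have hL2 : MemLp (fun x => (f x : ℂ)) 2 (volume.restrict (Ioc 0 (2 * π))) := by
    have hc : Continuous fun x => (f x : ℂ) := by fun_prop
    obtain ⟨C, hC⟩ := isCompact_Icc.exists_bound_of_continuousOn
      (hc.continuousOn (s := Icc 0 (2 * π)))
    refine MemLp.of_bound hc.aestronglyMeasurable C ?_
    exact (ae_restrict_iff' measurableSet_Ioc).2
      (Filter.Eventually.of_forall fun x hx => hC x ⟨hx.1.le, hx.2⟩)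
  have h := (hasSum_sq_fourierCoeffOn hpi hL2).mul_left ((2 * π) ^ 2)
  have e1 : ∀ n : ℤ, (2 * π) ^ 2 * ‖fourierCoeffOn hpi (fun x => (f x : ℂ)) n‖ ^ 2 =
      cosCoeff f n ^ 2 + sinCoeff f n ^ 2 := by
    intro n
    have hn : ‖(cosCoeff f n : ℂ) - sinCoeff f n * Complex.I‖ ^ 2 =
        cosCoeff f n ^ 2 + sinCoeff f n ^ 2 := by
      rw [← Complex.normSq_eq_norm_sq, Complex.normSq_apply]
      simp
      ring
    rw [fourierCoeffOn_eq_integral, integral_fourier_eq (by ring) hf, norm_smul,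
      mul_pow ‖_‖ ‖_‖, hn, sub_zero, Real.norm_of_nonneg (by positivity)]
    field_simp
  simp only [e1] at h
  have e2 : (2 * π) ^ 2 * (2 * π - 0)⁻¹ • ∫ x in (0 : ℝ)..(2 * π), ‖(f x : ℂ)‖ ^ 2 =
      2 * π * ∫ x in (0 : ℝ)..(2 * π), f x ^ 2 := by
    simp only [Complex.norm_real, Real.norm_eq_abs, sq_abs, sub_zero, smul_eq_mul]
    field_simp
  rwa [e2] at h

/-- A continuous periodic function whose coefficients vanish for `|n| ≥ 4` is a trigonometric
polynomial of degree three. -/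
theorem eq_trig_of_coeff_eq_zero {f : ℝ → ℝ} (hf : Continuous f)
    (hp : Function.Periodic f (2 * π))
    (h : ∀ n : ℤ, 4 ≤ |n| → cosCoeff f n = 0 ∧ sinCoeff f n = 0) (x : ℝ) :
    f x = cosCoeff f 0 / (2 * π) + (cosCoeff f 1 * Real.cos x + sinCoeff f 1 * Real.sin x) / π +
      (cosCoeff f 2 * Real.cos (2 * x) + sinCoeff f 2 * Real.sin (2 * x)) / π +
      (cosCoeff f 3 * Real.cos (3 * x) + sinCoeff f 3 * Real.sin (3 * x)) / π := by
  have hpi : (0 : ℝ) < 2 * π := by positivity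
  have : Fact (0 < 2 * π) := ⟨hpi⟩
  have hpc : Function.Periodic (fun x => (f x : ℂ)) (2 * π) := fun x => by simp only [hp x]
  have hcont : Continuous (hpc.lift) :=
    continuous_coinduced_dom.2 (by
      show Continuous fun x => (f x : ℂ)
      fun_prop)
  let F : C(AddCircle (2 * π), ℂ) := ⟨hpc.lift, hcont⟩
  have hcoef : ∀ n : ℤ, fourierCoeff F n =
      (1 / (2 * π) : ℝ) • ((cosCoeff f n : ℂ) - sinCoeff f n * Complex.I) := by
    intro n
    rw [fourierCoeff_eq_intervalIntegral _ n 0, zero_add, ← integral_fourier_eq rfl hf]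
    rfl
  have hzero : ∀ n ∉ Finset.Icc (-3 : ℤ) 3, fourierCoeff F n = 0 := by
    intro n hn
    have : 4 ≤ |n| := by
      by_contra! hlt
      rw [abs_lt] at hlt
      exact hn (Finset.mem_Icc.2 ⟨by omega, by omega⟩)
    rw [hcoef, (h n this).1, (h n this).2]
    simp
  -- Finitely many nonzero coefficients are summable, so the Fourier series converges to the
  -- function at every point and not merely in mean square.
  have hs := has_pointwise_sum_fourier_series_of_summable
    (summable_of_ne_finset_zero hzero) (x : AddCircle (2 * π))
  have hs' := hasSum_sum_of_ne_finset_zero (L := .unconditional ℤ) (f := fun i => fourierCoeff F i • fourier i (x : AddCircle (2 * π)))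
    (s := Finset.Icc (-3 : ℤ) 3) (fun n hn => by rw [hzero n hn, zero_smul])
  have heq := hs.unique hs'
  have hre := congrArg Complex.re heq
  have hterm : ∀ n : ℤ, (fourierCoeff F n • fourier n (x : AddCircle (2 * π))).re =
      (cosCoeff f n * Real.cos (n * x) + sinCoeff f n * Real.sin (n * x)) / (2 * π) := by
    intro n
    rw [hcoef, fourier_apply_eq rfl]
    generalize Real.cos (n * x) = c
    generalize Real.sin (n * x) = s
    simp
    field_simp
  rw [Complex.re_sum, show Finset.Icc (-3 : ℤ) 3 = {-3, -2, -1, 0, 1, 2, 3} by decide] at hre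
  simp only [hterm] at hre
  have hFx : (F (x : AddCircle (2 * π))).re = f x := rfl
  rw [hFx] at hre
  rw [hre]
  simp [cosCoeff_neg, sinCoeff_neg]
  field_simp
  ring

/-! ### The equality in terms of Fourier coefficients -/

theorem supportFn_image_sub {K : Set Plane} (hK : IsCompact K) (hne : K.Nonempty) (s : Plane)
    (φ : ℝ) : supportFn ((fun x => x - s) '' K) φ = supportFn K φ - inner ℝ s (normalVec φ) := by
  have h : (fun x => x - s) '' K = K + {-s} := by
    simp [sub_eq_add_neg]
  rw [h, supportFn_add K {-s} hK isCompact_singleton hne (singleton_nonempty _)]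
  simp [supportFn, sub_eq_add_neg]

/-- The support function of `K` is, up to a translation, a trigonometric polynomial with
frequencies `0`, `2`, `3`. -/
def HasModes (f : ℝ → ℝ) : Prop :=
  ∃ (c : Plane) (a₀ a₂ b₂ a₃ b₃ : ℝ), ∀ φ : ℝ, f φ = inner ℝ c (normalVec φ) + a₀
    + a₂ * Real.cos (2 * φ) + b₂ * Real.sin (2 * φ) + a₃ * Real.cos (3 * φ) + b₃ * Real.sin (3 * φ)

theorem HasModes.coeff_eq_zero {f : ℝ → ℝ} (h : HasModes f) (n : ℤ) (hn : 4 ≤ |n|) :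
    cosCoeff f n = 0 ∧ sinCoeff f n = 0 := by
  obtain ⟨c, a₀, a₂, b₂, a₃, b₃, h⟩ := h
  have hk : ∀ k : ℤ, 0 ≤ k → k < 4 → (n : ℝ) ^ 2 ≠ (k : ℝ) ^ 2 := by
    intro k hk0 hk4 he
    have h1 : n ^ 2 = k ^ 2 := by exact_mod_cast he
    rw [sq_eq_sq_iff_abs_eq_abs, abs_of_nonneg hk0] at h1
    omega
  have h0 := coeff_trig_eq_zero a₀ 0 0 n (hk 0 (by norm_num) (by norm_num))
  have h1 := coeff_trig_eq_zero (c 0) (c 1) 1 n (hk 1 (by norm_num) (by norm_num))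
  have h2 := coeff_trig_eq_zero a₂ b₂ 2 n (hk 2 (by norm_num) (by norm_num))
  have h3 := coeff_trig_eq_zero a₃ b₃ 3 n (hk 3 (by norm_num) (by norm_num))
  set T : ℝ → ℝ → ℤ → ℝ → ℝ := fun a b k x => a * Real.cos (k * x) + b * Real.sin (k * x) with hT
  have hTc : ∀ a b k, Continuous (T a b k) := fun a b k => by
    simp only [hT]
    fun_prop
  have e : f = fun x => (T a₀ 0 0 x + T (c 0) (c 1) 1 x) + (T a₂ b₂ 2 x + T a₃ b₃ 3 x) := by
    ext x
    rw [h, inner_normalVec]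
    simp [hT]
    ring
  have e1 := coeff_add (hTc a₀ 0 0) (hTc (c 0) (c 1) 1) n
  have e2 := coeff_add (hTc a₂ b₂ 2) (hTc a₃ b₃ 3) n
  have e3 := coeff_add (f := fun x => T a₀ 0 0 x + T (c 0) (c 1) 1 x)
    (g := fun x => T a₂ b₂ 2 x + T a₃ b₃ 3 x) ((hTc a₀ 0 0).add (hTc (c 0) (c 1) 1))
    ((hTc a₂ b₂ 2).add (hTc a₃ b₃ 3)) n
  constructor
  · rw [e]
    refine e3.1.trans ?_
    rw [e1.1, e2.1, h0.1, h1.1, h2.1, h3.1]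
    norm_num
  · rw [e]
    refine e3.2.trans ?_
    rw [e1.2, e2.2, h0.2, h1.2, h2.2, h3.2]
    norm_num

namespace IsStrictlyConvexC2

variable {K : Set Plane} (hK : IsStrictlyConvexC2 K)
include hK

/-- Its pairing with `N` is the frequency-one part of `p`, so translating by the Steiner point
removes exactly that part. -/
theorem inner_steinerPoint (φ : ℝ) : inner ℝ (steinerPoint K) (normalVec φ) =
    (cosCoeff (supportFn K) 1 * Real.cos φ + sinCoeff (supportFn K) 1 * Real.sin φ) / π := by
  have hc := hK.continuous
  have hN : Continuous normalVec := by
    unfold normalVec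
    fun_prop
  have hcomp : ∀ i : Fin 2, (∫ φ in (0 : ℝ)..(2 * π), supportFn K φ • normalVec φ) i =
      ∫ φ in (0 : ℝ)..(2 * π), supportFn K φ * normalVec φ i := by
    intro i
    exact ((EuclideanSpace.proj i : Plane →L[ℝ] ℝ).intervalIntegral_comp_comm
      (Continuous.intervalIntegrable (by fun_prop) _ _)).symm
  rw [inner_normalVec, steinerPoint]
  simp only [PiLp.smul_apply, hcomp, smul_eq_mul]
  simp [normalVec, cosCoeff, sinCoeff]
  ring

theorem steinerSupportFn_eq (φ : ℝ) :
    steinerSupportFn K φ = supportFn K φ - inner ℝ (steinerPoint K) (normalVec φ) :=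
  supportFn_image_sub hK.isCompact hK.nonempty _ _

theorem hasModes_of_hasOnlyModes (h : HasOnlyModesZeroTwoThree K) : HasModes (supportFn K) := by
  obtain ⟨a₀, a₂, b₂, a₃, b₃, h⟩ := h
  refine ⟨steinerPoint K, a₀, a₂, b₂, a₃, b₃, fun φ => ?_⟩
  have := h φ
  rw [hK.steinerSupportFn_eq] at this
  linarith

theorem hasOnlyModes_of_coeff
    (h : ∀ n : ℤ, 4 ≤ |n| → cosCoeff (supportFn K) n = 0 ∧ sinCoeff (supportFn K) n = 0) :
    HasOnlyModesZeroTwoThree K := by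
  refine ⟨cosCoeff (supportFn K) 0 / (2 * π), cosCoeff (supportFn K) 2 / π,
    sinCoeff (supportFn K) 2 / π, cosCoeff (supportFn K) 3 / π, sinCoeff (supportFn K) 3 / π,
    fun φ => ?_⟩
  rw [hK.steinerSupportFn_eq, hK.inner_steinerPoint,
    eq_trig_of_coeff_eq_zero hK.continuous (supportFn_periodic K) h φ]
  ring

theorem hasOnlyModes_iff_hasModes : HasOnlyModesZeroTwoThree K ↔ HasModes (supportFn K) :=
  ⟨hK.hasModes_of_hasOnlyModes, fun h => hK.hasOnlyModes_of_coeff h.coeff_eq_zero⟩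

/-- All quantities become weighted sums of the `wₙ`, and the difference of the two sides is a sum of
nonnegative terms supported on `|n| ≥ 4`. -/
theorem equalityHolds_iff_coeff : EqualityHolds K ↔
    ∀ n : ℤ, 4 ≤ |n| → cosCoeff (supportFn K) n = 0 ∧ sinCoeff (supportFn K) n = 0 := by
  have hp := hK.continuous
  have hp1 := hK.continuous_deriv
  have hp2 := hK.continuous_deriv2
  have hpi := Real.pi_pos
  set p := supportFn K with hpdef
  set w : ℤ → ℝ := fun n => cosCoeff p n ^ 2 + sinCoeff p n ^ 2 with hw
  have hw0 : ∀ n, 0 ≤ w n := fun n => by positivity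
  have hs0 : HasSum w (2 * π * ∫ x in (0 : ℝ)..(2 * π), p x ^ 2) := hasSum_sq_coeff hp
  have hsq1 : ∀ n : ℤ, cosCoeff (deriv p) n ^ 2 + sinCoeff (deriv p) n ^ 2 = (n : ℝ) ^ 2 * w n :=
    fun n => sq_coeff_deriv hK.hasDerivAt hp1 (supportFn_periodic K) n
  have hsq2 : ∀ n : ℤ, cosCoeff (deriv (deriv p)) n ^ 2 + sinCoeff (deriv (deriv p)) n ^ 2 =
      (n : ℝ) ^ 4 * w n := fun n => by
    rw [sq_coeff_deriv hK.hasDerivAt_deriv hp2 (deriv_periodic (supportFn_periodic K)), hsq1]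
    ring
  have hs1 : HasSum (fun n : ℤ => (n : ℝ) ^ 2 * w n)
      (2 * π * ∫ x in (0 : ℝ)..(2 * π), deriv p x ^ 2) := by
    have h := hasSum_sq_coeff hp1
    rwa [funext hsq1] at h
  have hs2 : HasSum (fun n : ℤ => (n : ℝ) ^ 4 * w n)
      (2 * π * ∫ x in (0 : ℝ)..(2 * π), deriv (deriv p) x ^ 2) := by
    have h := hasSum_sq_coeff hp2
    rwa [funext hsq2] at h
  set I0 := ∫ x in (0 : ℝ)..(2 * π), p x ^ 2 with hI0
  set I1 := ∫ x in (0 : ℝ)..(2 * π), deriv p x ^ 2 with hI1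
  set I2 := ∫ x in (0 : ℝ)..(2 * π), deriv (deriv p) x ^ 2 with hI2
  have hL : boundaryLength K ^ 2 = w 0 := by
    rw [hK.boundaryLength_eq]
    simp [hw, cosCoeff, sinCoeff, hpdef]
  have hF : ∫ φ in (0 : ℝ)..(2 * π), p φ * (p φ + deriv (deriv p) φ) = I0 - I1 := by
    have h := sweptArea_eq p hK.contDiff (supportFn_periodic K)
    rw [sweptArea, intervalIntegral.integral_sub (Continuous.intervalIntegrable (by fun_prop) _ _)
      (Continuous.intervalIntegrable (by fun_prop) _ _)] at h
    linarith
  -- Wirtinger's inequality for `p'`, in the form `n² ≤ n⁴` for integers. It shows that the signed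
  -- area of the evolute is nonpositive, which resolves the absolute value.
  have hI12 : I1 ≤ I2 := by
    have h := hasSum_le (fun n : ℤ => ?_) hs1 hs2
    · exact le_of_mul_le_mul_left h (by positivity)
    · refine mul_le_mul_of_nonneg_right ?_ (hw0 n)
      have : (n ^ 2 : ℤ) ≤ n ^ 4 := by
        rcases eq_or_ne n 0 with rfl | hn
        · norm_num
        · have : 0 < n ^ 2 := by positivity
          nlinarith
      exact_mod_cast this
  have hFe : |evoluteArea K| = (I2 - I1) / 2 := by
    have h1 : evoluteArea K = (I1 - I2) / 2 := by
      have hd : deriv (evoluteSupport K) = fun φ => deriv (deriv p) (φ - π / 2) := by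
        ext φ
        unfold evoluteSupport
        rw [deriv_comp_sub_const]
      have hper1 : Function.Periodic (deriv p) (2 * π) := deriv_periodic (supportFn_periodic K)
      have hper2 := deriv_periodic hper1
      rw [evoluteArea, sweptArea, hd]
      simp only [evoluteSupport]
      have := integral_shift (f := fun x => deriv p x ^ 2 - deriv (deriv p) x ^ 2)
        (fun x => by simp only [hper1 x, hper2 x]) (-(π / 2))
      simp only [← sub_eq_add_neg] at this
      rw [this, intervalIntegral.integral_sub (Continuous.intervalIntegrable (by fun_prop) _ _)
        (Continuous.intervalIntegrable (by fun_prop) _ _)]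
      ring
    rw [h1, abs_of_nonpos (by linarith)]
    ring
  have hB : (∫ φ in (0 : ℝ)..(2 * π), p φ * Real.cos (2 * φ)) ^ 2 +
      (∫ φ in (0 : ℝ)..(2 * π), p φ * Real.sin (2 * φ)) ^ 2 = w 2 := by
    simp [hw, cosCoeff, sinCoeff]
  have hw2 : w (-2) = w 2 := by
    simp [hw, cosCoeff_neg, sinCoeff_neg]
  have hE : EqualityHolds K ↔
      2 * π * I2 - 10 * (2 * π * I1) + 9 * (2 * π * I0) - 9 * w 0 + 15 * w 2 + 15 * w (-2) = 0 := by
    rw [EqualityHolds, hFe, hL, hK.area_eq, hK.integral_visualIntegrand, ← hpdef, hF, hB, hw2]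
    constructor <;> intro h
    · linear_combination 4 * h
    · linear_combination (1 / 4) * h
  -- The symbol is `(n² - 1)(n² - 9)`, equal to `9` at `n = 0` and `-15` at `n = ±2`. The three
  -- corrections, from the length and from the exterior integral split evenly between `2` and `-2`,
  -- cancel precisely these values.
  set e : ℤ → ℝ := fun n => ((n : ℝ) ^ 4 - 10 * n ^ 2 + 9) * w n - (if n = 0 then 9 * w 0 else 0) +
    (if n = 2 then 15 * w 2 else 0) + (if n = -2 then 15 * w (-2) else 0) with he
  have hse : HasSum e
      (2 * π * I2 - 10 * (2 * π * I1) + 9 * (2 * π * I0) - 9 * w 0 + 15 * w 2 + 15 * w (-2)) := by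
    have h := ((((hs2.sub (hs1.mul_left 10)).add (hs0.mul_left 9)).sub
      (hasSum_ite_eq (0 : ℤ) (9 * w 0))).add (hasSum_ite_eq (2 : ℤ) (15 * w 2))).add
      (hasSum_ite_eq (-2 : ℤ) (15 * w (-2)))
    refine (congrArg (fun g => HasSum g _) (funext fun n => ?_)).mp h
    simp only [he]
    ring
  have hbig : ∀ n : ℤ, 4 ≤ |n| → e n = ((n : ℝ) ^ 4 - 10 * n ^ 2 + 9) * w n ∧
      0 < (n : ℝ) ^ 4 - 10 * n ^ 2 + 9 := by
    intro n hn
    have h1 : n ≠ 0 := by rintro rfl; norm_num at hn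
    have h2 : n ≠ 2 := by rintro rfl; norm_num at hn
    have h3 : n ≠ -2 := by rintro rfl; norm_num at hn
    refine ⟨by simp [he, h1, h2, h3], ?_⟩
    have h4 : (4 : ℝ) ^ 2 ≤ (n : ℝ) ^ 2 := by
      rw [← sq_abs (n : ℝ)]
      have : (4 : ℝ) ≤ |(n : ℝ)| := by exact_mod_cast hn
      gcongr
    nlinarith
  have hsmall : ∀ n : ℤ, ¬ 4 ≤ |n| → e n = 0 := by
    intro n hn
    have h1 : -3 ≤ n ∧ n ≤ 3 := by
      rw [not_le, abs_lt] at hn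
      omega
    obtain ⟨h1, h2⟩ := h1
    interval_cases n <;> norm_num [he]
  have hnonneg : 0 ≤ e := by
    intro n
    by_cases hn : 4 ≤ |n|
    · rw [(hbig n hn).1]
      exact mul_nonneg (hbig n hn).2.le (hw0 n)
    · rw [hsmall n hn]; rfl
  rw [hE]
  constructor
  · intro h n hn
    rw [h, hasSum_zero_iff_of_nonneg hnonneg] at hse
    have h1 := congrFun hse n
    rw [(hbig n hn).1] at h1
    have h2 : w n = 0 := (mul_eq_zero.1 h1).resolve_left (hbig n hn).2.ne'
    simp only [hw] at h2
    constructor <;> nlinarith [sq_nonneg (cosCoeff p n), sq_nonneg (sinCoeff p n)]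
  · intro h
    have h1 : e = 0 := by
      ext n
      by_cases hn : 4 ≤ |n|
      · rw [(hbig n hn).1]
        simp [hw, (h n hn).1, (h n hn).2]
      · exact hsmall n hn
    rw [h1] at hse
    exact hse.unique hasSum_zero

theorem equalityHolds_iff_hasModes : EqualityHolds K ↔ HasModes (supportFn K) :=
  hK.equalityHolds_iff_coeff.trans
    ⟨fun h => hK.hasModes_of_hasOnlyModes (hK.hasOnlyModes_of_coeff h), fun h => h.coeff_eq_zero⟩

end IsStrictlyConvexC2

/-! ### Hypocycloids, disks and trigonometric support functions -/

theorem inner_rotate_normalVec (α φ : ℝ) (v : Plane) :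
    inner ℝ (rotate α v) (normalVec φ) = v 0 * Real.cos (φ - α) + v 1 * Real.sin (φ - α) := by
  rw [inner_normalVec, Real.cos_sub, Real.sin_sub]
  simp [rotate, normalVec, tangentVec]
  ring

theorem inner_rotate_tangentVec (α φ : ℝ) (v : Plane) :
    inner ℝ (rotate α v) (tangentVec φ) = v 1 * Real.cos (φ - α) - v 0 * Real.sin (φ - α) := by
  rw [inner_tangentVec, Real.cos_sub, Real.sin_sub]
  simp [rotate, normalVec, tangentVec]
  ring

/-- Both `t + (k - 2)t/2` and `(k - 1)t - (k - 2)t/2` equal `k t / 2`, so the two rotating terms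
contribute the same harmonic. -/
theorem hypocycloid_inner_normal (k r t : ℝ) :
    hypocycloid k r t 0 * Real.cos ((k - 2) / 2 * t) +
      hypocycloid k r t 1 * Real.sin ((k - 2) / 2 * t) = r * (k - 2) * Real.sin (k / 2 * t) := by
  have h1 : Real.sin (k / 2 * t) = Real.sin (t + (k - 2) / 2 * t) := by ring_nf
  have h2 : Real.sin (k / 2 * t) = Real.sin ((k - 1) * t - (k - 2) / 2 * t) := by ring_nf
  rw [Real.sin_add] at h1
  rw [Real.sin_sub] at h2
  simp [hypocycloid]
  linear_combination (-r * (k - 1)) * h1 + r * h2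

theorem hypocycloid_inner_tangent (k r t : ℝ) :
    hypocycloid k r t 1 * Real.cos ((k - 2) / 2 * t) -
      hypocycloid k r t 0 * Real.sin ((k - 2) / 2 * t) = r * k * Real.cos (k / 2 * t) := by
  have h1 : Real.cos (k / 2 * t) = Real.cos (t + (k - 2) / 2 * t) := by ring_nf
  have h2 : Real.cos (k / 2 * t) = Real.cos ((k - 1) * t - (k - 2) / 2 * t) := by ring_nf
  rw [Real.cos_add] at h1
  rw [Real.cos_sub] at h2
  simp [hypocycloid]
  linear_combination (-r * (k - 1)) * h1 - r * h2

theorem hasDerivAt_harmonic (c : Plane) (d A k α x : ℝ) :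
    HasDerivAt (fun t => inner ℝ c (normalVec t) + d + A * Real.sin (k * (t - α)))
      (inner ℝ c (tangentVec x) + A * k * Real.cos (k * (x - α))) x := by
  have h := (((hasDerivAt_id' x).sub_const α).const_mul k).sin.const_mul A
  exact (((hasDerivAt_inner_normalVec c x).add_const d).add h).congr_deriv (by ring)

theorem hasDerivAt_harmonic_deriv (c : Plane) (A k α x : ℝ) :
    HasDerivAt (fun t => inner ℝ c (tangentVec t) + A * k * Real.cos (k * (t - α)))
      (-inner ℝ c (normalVec x) - A * k ^ 2 * Real.sin (k * (x - α))) x := by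
  have h := (((hasDerivAt_id' x).sub_const α).const_mul k).cos.const_mul (A * k)
  exact ((hasDerivAt_inner_tangentVec c x).add h).congr_deriv (by ring)

/-- The parameter is changed to the normal angle `τ = α + (k - 2)t/2`. The normal component of the
curve alone determines `g`; conversely the tangential component must be matched as well, with the
derivative of the harmonic. -/
theorem isHypocycloidSupport_iff {k : ℝ} (hk : k ≠ 2) (g : ℝ → ℝ) :
    IsHypocycloidSupport k g ↔ ∃ (r : ℝ) (c : Plane) (α : ℝ), 0 < r ∧ ∀ τ : ℝ,
      g τ = inner ℝ c (normalVec τ) + r * (k - 2) * Real.sin (k / (k - 2) * (τ - α)) := by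
  have hk' : k - 2 ≠ 0 := sub_ne_zero.2 hk
  constructor
  · rintro ⟨r, c, α, hr, h⟩
    refine ⟨r, c, α, hr, fun τ => ?_⟩
    have h1 := h (2 / (k - 2) * (τ - α))
    have e1 : α + (k - 2) / 2 * (2 / (k - 2) * (τ - α)) = τ := by field_simp; ring
    have h2 := hypocycloid_inner_normal k r (2 / (k - 2) * (τ - α))
    rw [e1] at h1
    have h3 := congrArg (fun x => inner ℝ x (normalVec τ)) h1
    simp only [inner_envelope_normalVec, inner_add_left, inner_rotate_normalVec] at h3
    rw [show (k - 2) / 2 * (2 / (k - 2) * (τ - α)) = τ - α by field_simp,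
      show k / 2 * (2 / (k - 2) * (τ - α)) = k / (k - 2) * (τ - α) by field_simp] at h2
    rw [h2] at h3
    simpa using h3
  · rintro ⟨r, c, α, hr, h⟩
    refine ⟨r, c, α, hr, fun t => ?_⟩
    have hg : g = fun t => inner ℝ c (normalVec t) + 0 +
        r * (k - 2) * Real.sin (k / (k - 2) * (t - α)) := by
      ext t
      rw [h, add_zero]
    have hd : ∀ x, deriv g x = inner ℝ c (tangentVec x) +
        r * (k - 2) * (k / (k - 2)) * Real.cos (k / (k - 2) * (x - α)) := fun x => by
      rw [hg]
      exact (hasDerivAt_harmonic c 0 (r * (k - 2)) (k / (k - 2)) α x).deriv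
    have e1 : k / (k - 2) * (α + (k - 2) / 2 * t - α) = k / 2 * t := by
      field_simp
      ring
    have e2 : α + (k - 2) / 2 * t - α = (k - 2) / 2 * t := by ring
    apply plane_ext_of_inner (α + (k - 2) / 2 * t)
    · rw [inner_envelope_normalVec, inner_add_left, inner_rotate_normalVec, e2,
        hypocycloid_inner_normal, h, e1]
      simp
    · rw [inner_envelope_tangentVec, inner_add_left, inner_rotate_tangentVec, e2,
        hypocycloid_inner_tangent, hd, e1, sub_self, Real.cos_zero, Real.sin_zero]
      field_simp
      ring

theorem isAstroidParallel_iff (f : ℝ → ℝ) : IsAstroidParallel f ↔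
    ∃ (c : Plane) (d A α : ℝ), 0 < A ∧
      ∀ τ, f τ = inner ℝ c (normalVec τ) + d + A * Real.sin (2 * (τ - α)) := by
  constructor
  · rintro ⟨g, d, hg, hf⟩
    obtain ⟨r, c, α, hr, h⟩ := (isHypocycloidSupport_iff (by norm_num) g).1 hg
    refine ⟨c, d, r * (4 - 2), α, by linarith, fun τ => ?_⟩
    rw [hf, h]
    norm_num
    ring
  · rintro ⟨c, d, A, α, hA, h⟩
    refine ⟨fun τ => f τ - d, d, (isHypocycloidSupport_iff (by norm_num) _).2
      ⟨A / 2, c, α, by linarith, fun τ => ?_⟩, fun t => by ring⟩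
    rw [h]
    norm_num
    ring

theorem isDeltoidParallel_iff (f : ℝ → ℝ) : IsDeltoidParallel f ↔
    ∃ (c : Plane) (d A α : ℝ), 0 < A ∧
      ∀ τ, f τ = inner ℝ c (normalVec τ) + d + A * Real.sin (3 * (τ - α)) := by
  constructor
  · rintro ⟨g, d, hg, hf⟩
    obtain ⟨r, c, α, hr, h⟩ := (isHypocycloidSupport_iff (by norm_num) g).1 hg
    refine ⟨c, d, r, α, hr, fun τ => ?_⟩
    rw [hf, h]
    norm_num
    ring
  · rintro ⟨c, d, A, α, hA, h⟩
    refine ⟨fun τ => f τ - d, d, (isHypocycloidSupport_iff (by norm_num) _).2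
      ⟨A, c, α, hA, fun τ => ?_⟩, fun t => by ring⟩
    rw [h]
    norm_num
    ring

theorem supportFn_closedBall (c : Plane) {r : ℝ} (hr : 0 ≤ r) (φ : ℝ) :
    supportFn (Metric.closedBall c r) φ = inner ℝ c (normalVec φ) + r := by
  refine IsGreatest.csSup_eq ⟨⟨c + r • normalVec φ, ?_, ?_⟩, ?_⟩
  · rw [mem_closedBall_iff_norm, add_sub_cancel_left, norm_smul, norm_normalVec, mul_one,
      Real.norm_of_nonneg hr]
  · simp only [inner_add_left, real_inner_smul_left, real_inner_self_eq_norm_sq, norm_normalVec]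
    ring
  · rintro _ ⟨x, hx, rfl⟩
    rw [mem_closedBall_iff_norm] at hx
    have h := real_inner_le_norm (x - c) (normalVec φ)
    rw [norm_normalVec, mul_one, inner_sub_left] at h
    simp only
    linarith

theorem isDiskSupport_iff (f : ℝ → ℝ) : IsDiskSupport f ↔
    ∃ (c : Plane) (r : ℝ), 0 < r ∧ ∀ t, f t = inner ℝ c (normalVec t) + r := by
  constructor
  · rintro ⟨c, r, hr, h⟩
    exact ⟨c, r, hr, fun t => by rw [h, supportFn_closedBall c hr.le]⟩
  · rintro ⟨c, r, hr, h⟩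
    exact ⟨c, r, hr, fun t => by rw [h, supportFn_closedBall c hr.le]⟩

theorem HasModes.add {f g : ℝ → ℝ} (hf : HasModes f) (hg : HasModes g) :
    HasModes (fun t => f t + g t) := by
  obtain ⟨c, a₀, a₂, b₂, a₃, b₃, h⟩ := hf
  obtain ⟨c', a₀', a₂', b₂', a₃', b₃', h'⟩ := hg
  refine ⟨c + c', a₀ + a₀', a₂ + a₂', b₂ + b₂', a₃ + a₃', b₃ + b₃', fun φ => ?_⟩
  simp only [h, h', inner_add_left]
  ring

theorem HasModes.neg {f : ℝ → ℝ} (hf : HasModes f) : HasModes (fun t => -f t) := by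
  obtain ⟨c, a₀, a₂, b₂, a₃, b₃, h⟩ := hf
  refine ⟨-c, -a₀, -a₂, -b₂, -a₃, -b₃, fun φ => ?_⟩
  simp only [h, inner_neg_left]
  ring

theorem hasModes_linear (c : Plane) (d : ℝ) :
    HasModes (fun t => inner ℝ c (normalVec t) + d) :=
  ⟨c, d, 0, 0, 0, 0, fun φ => by ring⟩

theorem HasModes.sum {n : ℕ} {f : Fin n → ℝ → ℝ} (h : ∀ i, HasModes (f i)) :
    HasModes (fun t => ∑ i, f i t) := by
  induction n with
  | zero =>
    simpa using hasModes_linear 0 0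
  | succ n ih =>
    simp only [Fin.sum_univ_castSucc]
    exact (ih fun i => h i.castSucc).add (h (Fin.last n))

theorem hasModes_two (c : Plane) (d A α : ℝ) :
    HasModes (fun t => inner ℝ c (normalVec t) + d + A * Real.sin (2 * (t - α))) := by
  refine ⟨c, d, -A * Real.sin (2 * α), A * Real.cos (2 * α), 0, 0, fun φ => ?_⟩
  simp only [mul_sub, Real.sin_sub]
  ring

theorem hasModes_three (c : Plane) (d A α : ℝ) :
    HasModes (fun t => inner ℝ c (normalVec t) + d + A * Real.sin (3 * (t - α))) := by
  refine ⟨c, d, 0, 0, -A * Real.sin (3 * α), A * Real.cos (3 * α), fun φ => ?_⟩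
  simp only [mul_sub, Real.sin_sub]
  ring

theorem IsDiskSupport.hasModes {f : ℝ → ℝ} (h : IsDiskSupport f) : HasModes f := by
  obtain ⟨c, r, -, h⟩ := (isDiskSupport_iff f).1 h
  rw [funext h]
  exact hasModes_linear c r

theorem IsAstroidParallel.hasModes {f : ℝ → ℝ} (h : IsAstroidParallel f) : HasModes f := by
  obtain ⟨c, d, A, α, -, h⟩ := (isAstroidParallel_iff f).1 h
  rw [funext h]
  exact hasModes_two c d A α

theorem IsDeltoidParallel.hasModes {f : ℝ → ℝ} (h : IsDeltoidParallel f) : HasModes f := by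
  obtain ⟨c, d, A, α, -, h⟩ := (isDeltoidParallel_iff f).1 h
  rw [funext h]
  exact hasModes_three c d A α

theorem hasModes_of_isMinkowskiSumType {K : Set Plane} (h : IsMinkowskiSumType K) :
    HasModes (supportFn K) := by
  obtain ⟨n, f, -, hf, hs⟩ := h
  rw [funext hs]
  refine HasModes.sum fun i => ?_
  rcases hf i with h | h | h
  · exact h.hasModes
  · exact h.hasModes
  · exact h.hasModes

/-! ### Domains bounded by a curve with a given generalized support function -/

/-- For the curves used here these are the parameters of zero curvature radius. At two of them the
sine takes the same value, so they all lie in two arithmetic progressions through a given one. -/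
theorem countable_harmonic_zeros (a b k α : ℝ) (hb : b ≠ 0) (hk : k ≠ 0) :
    {t : ℝ | a + b * Real.sin (k * (t - α)) = 0}.Countable := by
  rcases eq_empty_or_nonempty {t : ℝ | a + b * Real.sin (k * (t - α)) = 0} with h | ⟨t₀, h₀⟩
  · rw [h]; exact countable_empty
  refine ((countable_range fun n : ℤ => (2 * n * π + k * (t₀ - α)) / k + α).union
    (countable_range fun n : ℤ => ((2 * n + 1) * π - k * (t₀ - α)) / k + α)).mono fun t ht => ?_
  simp only [mem_ofPred_eq] at h₀ ht
  have hs : Real.sin (k * (t₀ - α)) = Real.sin (k * (t - α)) :=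
    mul_left_cancel₀ hb (by linarith)
  obtain ⟨n, h | h⟩ := Real.sin_eq_sin_iff.1 hs
  · refine Or.inl ⟨n, ?_⟩
    simp only [← h]
    field_simp
    ring
  · refine Or.inr ⟨n, ?_⟩
    simp only [← h]
    field_simp
    ring

namespace IsStrictlyConvexC2

variable {K : Set Plane} (hK : IsStrictlyConvexC2 K)
include hK

theorem countable_envelope_preimage {Z : Set Plane} (hZ : Z.Countable) :
    (envelope (supportFn K) ⁻¹' Z).Countable := by
  have hpi : (0 : ℝ) < 2 * π := by positivity
  have h : envelope (supportFn K) ⁻¹' Z ⊆ ⋃ n : ℤ, envelope (supportFn K) ⁻¹' Z ∩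
      Ico (n • (2 * π)) (n • (2 * π) + 2 * π) := by
    intro x hx
    have hx' : x ∈ ⋃ n : ℤ, Ico (n • (2 * π)) ((n + 1) • (2 * π)) := by
      rw [iUnion_Ico_zsmul hpi]; trivial
    obtain ⟨n, hn⟩ := mem_iUnion.1 hx'
    rw [add_smul, one_smul] at hn
    exact mem_iUnion.2 ⟨n, hx, hn⟩
  refine (countable_iUnion fun n => ?_).mono h
  exact MapsTo.countable_of_injOn (f := envelope (supportFn K)) (fun x hx => hx.1)
    ((hK.envelope_injOn _).mono inter_subset_right) hZ

/-- If `K` is bounded by the curve with generalized support function `f`, then at every angle the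
support function of `K` is given by one of the two orientations of the curve. -/
theorem eq_or_eq_neg_of_isBoundedBy {f f'' : ℝ → ℝ} (hf : ∀ x, HasDerivAt f (deriv f x) x)
    (hf' : ∀ x, HasDerivAt (deriv f) (f'' x) x) (hper : Function.Periodic f (2 * π))
    (hZ : {t | f t + f'' t = 0}.Countable) (h : IsBoundedBy K f) (φ : ℝ) :
    supportFn K φ = f φ ∨ supportFn K φ = -f (φ + π) := by
  have hfc := continuous_of_hasDerivAt hf
  have hB := hK.countable_envelope_preimage (hZ.image (envelope f))
  -- The alternative is a closed condition, so it suffices to check it off the countable set of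
  -- angles whose boundary point is the image of a singular parameter of the curve.
  have hclosed : IsClosed {φ | supportFn K φ = f φ ∨ supportFn K φ = -f (φ + π)} :=
    (isClosed_eq hK.continuous hfc).union (isClosed_eq hK.continuous (by fun_prop))
  have hdense := hB.dense_compl ℝ
  refine hclosed.closure_subset_iff.2 ?_ (hdense φ)
  intro ψ hψ
  have hfr : envelope (supportFn K) ψ ∈ frontier K := by
    rw [hK.frontier_eq]; exact mem_range_self ψ
  rw [h] at hfr
  obtain ⟨t, ht⟩ := hfr
  have hx : f t + f'' t ≠ 0 := fun h0 => hψ ⟨t, h0, ht⟩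
  have hmem : ∀ s, envelope f s ∈ K := fun s =>
    hK.isCompact.isClosed.frontier_subset (by rw [h]; exact mem_range_self s)
  have hpt : supportFn K ψ = inner ℝ (envelope f t) (normalVec ψ) := by
    rw [ht, inner_envelope_normalVec]; simp
  have hd : HasDerivAt (fun s => inner ℝ (envelope f s) (normalVec ψ))
      ((f t + f'' t) * Real.sin (ψ - t)) t := by
    simp only [inner_normalVec]
    refine (((hasDerivAt_envelope_fst hf hf' t).mul_const (Real.cos ψ)).add
      ((hasDerivAt_envelope_snd hf hf' t).mul_const (Real.sin ψ))).congr_deriv ?_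
    rw [Real.sin_sub]
    ring
  -- The whole curve lies in `K`, so its height in direction `N(ψ)` is maximal at `t`. The
  -- derivative of the height is `(f + f'') sin (ψ - t)` and the first factor is nonzero, so `ψ` and
  -- `t` differ by a multiple of `π`; its parity decides the orientation.
  have hmax : IsLocalMax (fun s => inner ℝ (envelope f s) (normalVec ψ)) t :=
    Filter.Eventually.of_forall fun s => by
      simp only
      rw [← hpt]
      exact inner_le_supportFn hK.isCompact (hmem s) ψ
  have h0 := (mul_eq_zero.1 (hmax.hasDerivAt_eq_zero hd)).resolve_left hx
  rw [inner_envelope_normalVec, h0, mul_zero, add_zero] at hpt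
  obtain ⟨n, hn⟩ := Real.sin_eq_zero_iff.1 h0
  rcases Int.even_or_odd' n with ⟨m, rfl | rfl⟩
  · left
    have e : ψ = t + m * (2 * π) := by
      push_cast at hn
      linarith
    rw [hpt, e, hper.int_mul m t, show t + m * (2 * π) - t = 0 + m * (2 * π) by ring,
      Real.cos_add_int_mul_two_pi, Real.cos_zero, mul_one]
  · right
    have e : ψ + π = t + ((m + 1 : ℤ) : ℝ) * (2 * π) := by
      push_cast at hn ⊢
      linarith
    rw [hpt, e, hper.int_mul (m + 1) t,
      show ψ - t = π + m * (2 * π) by push_cast at hn; linarith,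
      Real.cos_add_int_mul_two_pi, Real.cos_pi, mul_neg, mul_one]

end IsStrictlyConvexC2

/-! ### Recovering a support function from its radius of curvature; amplitude and phase -/

/-- The velocity of the envelope is a multiple of `y + y''`, so the envelope is a single point and
`y` is the support function of that point. -/
theorem eq_inner_of_add_deriv_eq_zero {y y'' : ℝ → ℝ} (h : ∀ x, HasDerivAt y (deriv y x) x)
    (h' : ∀ x, HasDerivAt (deriv y) (y'' x) x) (h0 : ∀ x, y x + y'' x = 0) (φ : ℝ) :
    y φ = inner ℝ (envelope y 0) (normalVec φ) := by
  have h1 : ∀ t, HasDerivAt (fun s => envelope y s 0) 0 t := fun t =>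
    (hasDerivAt_envelope_fst h h' t).congr_deriv (by rw [h0]; ring)
  have h2 : ∀ t, HasDerivAt (fun s => envelope y s 1) 0 t := fun t =>
    (hasDerivAt_envelope_snd h h' t).congr_deriv (by rw [h0]; ring)
  have e1 := is_const_of_deriv_eq_zero (fun t => (h1 t).differentiableAt) (fun t => (h1 t).deriv) 0 φ
  have e2 := is_const_of_deriv_eq_zero (fun t => (h2 t).differentiableAt) (fun t => (h2 t).deriv) 0 φ
  have e3 := inner_envelope_normalVec y φ φ
  rw [inner_normalVec] at e3 ⊢
  simp only at e1 e2
  rw [e1, e2, e3]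
  simp

theorem pos_or_neg_of_continuous {x : ℝ → ℝ} (hx : Continuous x) (h : ∀ t, x t ≠ 0) :
    (∀ t, 0 < x t) ∨ ∀ t, x t < 0 := by
  by_contra! hcon
  obtain ⟨⟨a, ha⟩, b, hb⟩ := hcon
  obtain ⟨t, ht⟩ := mem_range_of_exists_le_of_exists_ge hx ⟨a, ha⟩ ⟨b, hb⟩
  exact h t ht

theorem exists_amplitude {a b : ℝ} (h : ¬(a = 0 ∧ b = 0)) {k : ℝ} (hk : k ≠ 0) :
    ∃ A α : ℝ, 0 < A ∧ ∀ x, a * Real.cos (k * x) + b * Real.sin (k * x) =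
      A * Real.sin (k * (x - α)) := by
  have hz : (⟨b, -a⟩ : ℂ) ≠ 0 := by
    intro h0
    rw [Complex.ext_iff] at h0
    exact h ⟨by simpa using h0.2, by simpa using h0.1⟩
  refine ⟨‖(⟨b, -a⟩ : ℂ)‖, Complex.arg ⟨b, -a⟩ / k, norm_pos_iff.2 hz, fun x => ?_⟩
  have h1 := Complex.norm_mul_cos_arg (⟨b, -a⟩ : ℂ)
  have h2 := Complex.norm_mul_sin_arg (⟨b, -a⟩ : ℂ)
  rw [mul_sub, mul_div_cancel₀ _ hk, Real.sin_sub]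
  simp only at h1 h2
  linear_combination (-Real.sin (k * x)) * h1 + Real.cos (k * x) * h2

namespace IsStrictlyConvexC2

variable {K : Set Plane} (hK : IsStrictlyConvexC2 K)
include hK

/-- A `C²` support function with radius of curvature that of `f` differs from `f` by a linear
term. -/
theorem eq_add_inner_of_curvature_eq {f f' f'' : ℝ → ℝ} (hf : ∀ x, HasDerivAt f (f' x) x)
    (hf' : ∀ x, HasDerivAt f' (f'' x) x)
    (h : ∀ φ, supportFn K φ + deriv (deriv (supportFn K)) φ = f φ + f'' φ) :
    ∃ c : Plane, ∀ φ, supportFn K φ = f φ + inner ℝ c (normalVec φ) := by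
  have h1 : ∀ x, HasDerivAt (fun t => supportFn K t - f t) (deriv (supportFn K) x - f' x) x :=
    fun x => (hK.hasDerivAt x).sub (hf x)
  have h2 : deriv (fun t => supportFn K t - f t) = fun x => deriv (supportFn K) x - f' x :=
    funext fun x => (h1 x).deriv
  refine ⟨envelope (fun t => supportFn K t - f t) 0, fun φ => ?_⟩
  have := eq_inner_of_add_deriv_eq_zero (y := fun t => supportFn K t - f t)
    (y'' := fun x => deriv (deriv (supportFn K)) x - f'' x)
    (fun x => (h1 x).differentiableAt.hasDerivAt)
    (fun x => by rw [h2]; exact (hK.hasDerivAt_deriv x).sub (hf' x))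
    (fun x => by linarith [h x]) φ
  linarith

/-- The two candidates `f` and `g = -f(· + π)` have opposite curvature radii `X` and `-X`. Hence `ρ²
= X²` for the curvature radius `ρ` of `K`; positivity of `ρ` keeps `X` from vanishing, so its sign
is constant and one candidate has curvature radius `ρ` at every angle. -/
theorem hasModes_of_astroid {f : ℝ → ℝ} (hf : IsAstroidParallel f) (hb : IsBoundedBy K f) :
    HasModes (supportFn K) := by
  have hm := hf.hasModes
  obtain ⟨c, d, A, α, hA, h⟩ := (isAstroidParallel_iff f).1 hf
  obtain rfl : f = _ := funext h
  have d1 := hasDerivAt_harmonic c d A 2 α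
  have d2 := hasDerivAt_harmonic_deriv c A 2 α
  set f : ℝ → ℝ := fun τ => inner ℝ c (normalVec τ) + d + A * Real.sin (2 * (τ - α)) with hfdef
  have hd : deriv f = fun x => inner ℝ c (tangentVec x) + A * 2 * Real.cos (2 * (x - α)) :=
    funext fun x => (d1 x).deriv
  set f'' : ℝ → ℝ := fun x => -inner ℝ c (normalVec x) - A * 2 ^ 2 * Real.sin (2 * (x - α))
  have hx : ∀ t, f t + f'' t = d + (-3 * A) * Real.sin (2 * (t - α)) := fun t => by
    simp only [hfdef, f'']
    ring
  have hper : Function.Periodic f (2 * π) := fun t => by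
    simp only [hfdef, normalVec_periodic t]
    rw [show 2 * (t + 2 * π - α) = 2 * (t - α) + 2 * π + 2 * π by ring, Real.sin_add_two_pi,
      Real.sin_add_two_pi]
  have hcase := hK.eq_or_eq_neg_of_isBoundedBy (f'' := f'') (fun x => by rw [hd]; exact d1 x)
    (fun x => by rw [hd]; exact d2 x) hper
    (by simp only [hx]; exact countable_harmonic_zeros d _ 2 α (by nlinarith) two_ne_zero) hb
  set g : ℝ → ℝ := fun τ => inner ℝ c (normalVec τ) + (-d) + (-A) * Real.sin (2 * (τ - α)) with hg
  have hfg : ∀ φ, -f (φ + π) = g φ := fun φ => by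
    simp only [hfdef, hg, normalVec_add_pi, inner_neg_right]
    rw [show 2 * (φ + π - α) = 2 * (φ - α) + 2 * π by ring, Real.sin_add_two_pi]
    ring
  simp only [hfg] at hcase
  have g1 := hasDerivAt_harmonic c (-d) (-A) 2 α
  have g2 := hasDerivAt_harmonic_deriv c (-A) 2 α
  have hgd : deriv g = fun x => inner ℝ c (tangentVec x) + (-A) * 2 * Real.cos (2 * (x - α)) :=
    funext fun x => (g1 x).deriv
  set ρ : ℝ → ℝ := fun φ => supportFn K φ + deriv (deriv (supportFn K)) φ with hρ
  have hρc : Continuous ρ := hK.continuous.add hK.continuous_deriv2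
  set X : ℝ → ℝ := fun t => d + (-3 * A) * Real.sin (2 * (t - α)) with hX
  have hXc : Continuous X := by fun_prop
  have hloc : ∀ {u u' u'' : ℝ → ℝ}, (∀ x, HasDerivAt u (u' x) x) →
      (∀ x, HasDerivAt u' (u'' x) x) → ∀ φ, (∀ᶠ t in nhds φ, supportFn K t = u t) →
      ρ φ = u φ + u'' φ := by
    intro u u' u'' hu hu' φ hev
    have hu1 : deriv u = u' := funext fun x => (hu x).deriv
    have h1 : deriv (supportFn K) =ᶠ[nhds φ] u' := hu1 ▸ Filter.EventuallyEq.deriv hev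
    simp only [hρ]
    rw [hev.self_of_nhds, h1.deriv_eq, (hu' φ).deriv]
  -- The angles where this fails form an open set. At such an angle the support function equals `g`,
  -- for otherwise it would equal `f` on a neighbourhood and the squares would agree; but equality
  -- with `g` on an open set also makes the squares agree.
  have hsq : ∀ φ, ρ φ ^ 2 = X φ ^ 2 := by
    have hclosed : IsClosed {φ | ρ φ ^ 2 = X φ ^ 2} :=
      isClosed_eq (by fun_prop) (by fun_prop)
    by_contra! hcon
    obtain ⟨φ₀, h₀⟩ := hcon
    have hV := hclosed.isOpen_compl
    have hC2 : IsClosed {φ | supportFn K φ = g φ} :=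
      isClosed_eq hK.continuous (continuous_of_hasDerivAt g1)
    have hG : ∀ φ ∈ {φ | ρ φ ^ 2 = X φ ^ 2}ᶜ, supportFn K φ = g φ := by
      intro φ hφ
      by_contra hne
      have hev : ∀ᶠ t in nhds φ, supportFn K t = f t := by
        filter_upwards [hC2.isOpen_compl.mem_nhds hne] with t ht
        exact (hcase t).resolve_right ht
      refine hφ ?_
      show ρ φ ^ 2 = X φ ^ 2
      rw [hloc d1 d2 φ hev, hx]
    have hev : ∀ᶠ t in nhds φ₀, supportFn K t = g t :=
      Filter.mem_of_superset (hV.mem_nhds h₀) hG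
    refine h₀ ?_
    rw [hloc g1 g2 φ₀ hev]
    simp only [hX]
    ring
  have hX0 : ∀ t, X t ≠ 0 := fun t h0 => by
    have h1 := hsq t
    have h2 : 0 < ρ t := hK.curvature_pos t
    rw [h0] at h1
    nlinarith
  rcases pos_or_neg_of_continuous hXc hX0 with hpos | hneg
  · obtain ⟨c', hc'⟩ := hK.eq_add_inner_of_curvature_eq d1 d2 (fun φ => by
      have := (sq_eq_sq₀ (hK.curvature_pos φ).le (hpos φ).le).1 (hsq φ)
      exact this.trans (hx φ).symm)
    rw [funext hc']
    simpa using hm.add (hasModes_linear c' 0)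
  · obtain ⟨c', hc'⟩ := hK.eq_add_inner_of_curvature_eq g1 g2 (fun φ => by
      have h1 : ρ φ ^ 2 = (-X φ) ^ 2 := by rw [hsq, neg_sq]
      have := (sq_eq_sq₀ (hK.curvature_pos φ).le (neg_nonneg.2 (hneg φ).le)).1 h1
      refine this.trans ?_
      simp only [hX]
      ring)
    rw [funext hc']
    simpa using (hasModes_two c (-d) (-A) α).add (hasModes_linear c' 0)

/-- For an odd frequency the two candidates `f` and `-f(· + π)` differ only by the constant `2d`.
The continuous function `p - f + d` takes only the values `d` and `-d`, so a single candidate is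
valid for all angles. -/
theorem hasModes_of_deltoid {f : ℝ → ℝ} (hf : IsDeltoidParallel f) (hb : IsBoundedBy K f) :
    HasModes (supportFn K) := by
  have hm := hf.hasModes
  obtain ⟨c, d, A, α, hA, h⟩ := (isDeltoidParallel_iff f).1 hf
  obtain rfl : f = _ := funext h
  have d1 := hasDerivAt_harmonic c d A 3 α
  have d2 := hasDerivAt_harmonic_deriv c A 3 α
  set f : ℝ → ℝ := fun τ => inner ℝ c (normalVec τ) + d + A * Real.sin (3 * (τ - α)) with hfdef
  have hd : deriv f = fun x => inner ℝ c (tangentVec x) + A * 3 * Real.cos (3 * (x - α)) :=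
    funext fun x => (d1 x).deriv
  set f'' : ℝ → ℝ := fun x => -inner ℝ c (normalVec x) - A * 3 ^ 2 * Real.sin (3 * (x - α))
  have hx : ∀ t, f t + f'' t = d + (-8 * A) * Real.sin (3 * (t - α)) := fun t => by
    simp only [hfdef, f'']
    ring
  have hper : Function.Periodic f (2 * π) := fun t => by
    simp only [hfdef, normalVec_periodic t]
    rw [show 3 * (t + 2 * π - α) = 3 * (t - α) + 2 * π + 2 * π + 2 * π by ring,
      Real.sin_add_two_pi, Real.sin_add_two_pi, Real.sin_add_two_pi]
  have hcase := hK.eq_or_eq_neg_of_isBoundedBy (f'' := f'') (fun x => by rw [hd]; exact d1 x)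
    (fun x => by rw [hd]; exact d2 x) hper
    (by simp only [hx]; exact countable_harmonic_zeros d _ 3 α (by nlinarith) three_ne_zero) hb
  have hfg : ∀ φ, -f (φ + π) = f φ - 2 * d := fun φ => by
    simp only [hfdef, normalVec_add_pi, inner_neg_right]
    rw [show 3 * (φ + π - α) = 3 * (φ - α) + π + 2 * π by ring, Real.sin_add_two_pi,
      Real.sin_add_pi]
    ring
  simp only [hfg] at hcase
  have hcont : Continuous fun φ => supportFn K φ - f φ + d :=
    (hK.continuous.sub (continuous_of_hasDerivAt d1)).add continuous_const
  rcases eq_or_ne d 0 with h0 | h0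
  · have : supportFn K = f := funext fun φ => by
      rcases hcase φ with h | h <;> rw [h]
      rw [h0]; ring
    rwa [this]
  · have hne : ∀ φ, supportFn K φ - f φ + d ≠ 0 := fun φ he => by
      rcases hcase φ with h | h <;> rw [h] at he
      · exact h0 (by linarith)
      · exact h0 (by linarith)
    have hsame : (∀ φ, supportFn K φ = f φ) ∨ ∀ φ, supportFn K φ = f φ - 2 * d := by
      by_contra! hcon
      obtain ⟨⟨a, ha⟩, b, hb'⟩ := hcon
      have ha' := (hcase a).resolve_left ha
      have hb'' := (hcase b).resolve_right hb'
      rcases pos_or_neg_of_continuous hcont hne with hp | hn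
      · have h1 := hp a
        have h2 := hp b
        linarith
      · have h1 := hn a
        have h2 := hn b
        linarith
    rcases hsame with h | h
    · rwa [funext h]
    · rw [funext h]
      simpa [sub_eq_add_neg] using hm.add (hasModes_linear 0 (-(2 * d)))

theorem eq_closedBall_of_supportFn {c : Plane} {r : ℝ} (hr : 0 < r)
    (h : ∀ φ, supportFn K φ = inner ℝ c (normalVec φ) + r) : K = Metric.closedBall c r := by
  ext x
  rw [hK.mem_iff]
  simp only [h, ← supportFn_closedBall c hr.le]
  exact ⟨mem_of_forall_inner_le (isCompact_closedBall c r) (convex_closedBall c r)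
    ⟨c, Metric.mem_closedBall_self hr.le⟩,
    fun hx => inner_le_supportFn (isCompact_closedBall c r) hx⟩

/-- The type is read off from which of the frequencies two and three occur. When both do, two
summands suffice: the astroid one carries the translation and the constant, and neither has to be
convex. -/
theorem type_of_hasModes (h : HasModes (supportFn K)) :
    IsDiskOrAstroidType K ∨ IsDeltoidType K ∨ IsMinkowskiSumType K := by
  obtain ⟨c, a₀, a₂, b₂, a₃, b₃, h⟩ := h
  by_cases h2 : a₂ = 0 ∧ b₂ = 0
  · obtain ⟨rfl, rfl⟩ := h2
    by_cases h3 : a₃ = 0 ∧ b₃ = 0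
    · obtain ⟨rfl, rfl⟩ := h3
      have hs : supportFn K = fun t => inner ℝ c (normalVec t) + a₀ + 0 * Real.sin (1 * (t - 0)) := by
        ext t
        rw [h]
        ring
      -- With no oscillating terms the radius of curvature is the constant `a₀`, so positivity of
      -- curvature makes it a genuine radius.
      have hr : 0 < a₀ := by
        have h1 := hK.curvature_pos 0
        have h4 : deriv (supportFn K) = fun t =>
            inner ℝ c (tangentVec t) + 0 * 1 * Real.cos (1 * (t - 0)) := by
          rw [hs]
          exact funext fun x => (hasDerivAt_harmonic c a₀ 0 1 0 x).deriv
        rw [h4, (hasDerivAt_harmonic_deriv c 0 1 0 0).deriv, hs] at h1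
        simpa using h1
      exact Or.inl (Or.inl ⟨c, a₀, hr, hK.eq_closedBall_of_supportFn hr fun φ => by rw [h]; ring⟩)
    · obtain ⟨A, α, hA, hα⟩ := exists_amplitude h3 three_ne_zero
      refine Or.inr (Or.inl ⟨supportFn K, (isDeltoidParallel_iff _).2
        ⟨c, a₀, A, α, hA, fun τ => ?_⟩, hK.frontier_eq⟩)
      rw [h, ← hα]
      ring
  · obtain ⟨A, α, hA, hα⟩ := exists_amplitude h2 two_ne_zero
    by_cases h3 : a₃ = 0 ∧ b₃ = 0
    · obtain ⟨rfl, rfl⟩ := h3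
      refine Or.inl (Or.inr ⟨supportFn K, (isAstroidParallel_iff _).2
        ⟨c, a₀, A, α, hA, fun τ => ?_⟩, hK.frontier_eq⟩)
      rw [h, ← hα]
      ring
    · obtain ⟨B, β, hB, hβ⟩ := exists_amplitude h3 three_ne_zero
      refine Or.inr (Or.inr ⟨2, ![fun τ => inner ℝ c (normalVec τ) + a₀ + A * Real.sin (2 * (τ - α)),
        fun τ => inner ℝ (0 : Plane) (normalVec τ) + 0 + B * Real.sin (3 * (τ - β))], le_rfl, ?_, ?_⟩)
      · intro i
        fin_cases i
        · exact Or.inr (Or.inl ((isAstroidParallel_iff _).2 ⟨c, a₀, A, α, hA, fun τ => rfl⟩))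
        · exact Or.inr (Or.inr ((isDeltoidParallel_iff _).2 ⟨0, 0, B, β, hB, fun τ => rfl⟩))
      · intro φ
        rw [h]
        simp only [Fin.sum_univ_two, Matrix.cons_val_zero, Matrix.cons_val_one, inner_zero_left,
          ← hα, ← hβ]
        ring

theorem hasModes_of_type
    (h : IsDiskOrAstroidType K ∨ IsDeltoidType K ∨ IsMinkowskiSumType K) :
    HasModes (supportFn K) := by
  rcases h with (⟨c, r, hr, rfl⟩ | ⟨f, hf, hb⟩) | ⟨f, hf, hb⟩ | h
  · rw [funext (supportFn_closedBall c hr.le)]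
    exact hasModes_linear c r
  · exact hK.hasModes_of_astroid hf hb
  · exact hK.hasModes_of_deltoid hf hb
  · exact hasModes_of_isMinkowskiSumType h

end IsStrictlyConvexC2

end VisualAngleDeficit

theorem mainTheorem2 (K : Set VisualAngleDeficit.Plane)
    (hK : VisualAngleDeficit.IsStrictlyConvexC2 K) :
    IntegrableOn (VisualAngleDeficit.visualIntegrand K) Kᶜ ∧
    (VisualAngleDeficit.EqualityHolds K ↔
      (VisualAngleDeficit.IsDiskOrAstroidType K ∨ VisualAngleDeficit.IsDeltoidType K ∨
        VisualAngleDeficit.IsMinkowskiSumType K)) ∧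
    (VisualAngleDeficit.EqualityHolds K ↔
      VisualAngleDeficit.HasOnlyModesZeroTwoThree K) :=
  ⟨hK.integrableOn_visualIntegrand,
    hK.equalityHolds_iff_hasModes.trans ⟨hK.type_of_hasModes, hK.hasModes_of_type⟩,
    hK.equalityHolds_iff_hasModes.trans hK.hasOnlyModes_iff_hasModes.symm⟩
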